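/- Fix a finite nonempty alphabet $\Sigma$. A history is a word $h \in \Sigma^{\le n}$; two players alternately append letters until the word has length $n$, and it is our turn after $h$ if $|h| < n$ is even, the adversary's if it is odd. A strategy is a function $\sigma : \Sigma^{\le n} \times \Sigma \to [0,1]$ such that $\sigma(h,\cdot)$ is a probability distribution whenever $|h| < n$. For our strategy $\sigma$ and an adversary $\tau$, $P_{\sigma,\tau}(\pi)$ is the probability of the play $\pi \in \Sigma^n$, $P_{\sigma,\tau}(X) = \sum_{\pi \in X} P_{\sigma,\tau}(\pi)$, and $P_{\sigma,\tau}(\pi \mid h)$ is the probability that the play continues with $\pi \in \Sigma^{n-|h|}$ when it is started from the history $h$. The width of $X \subseteq \Sigma^n$ given $h$ is $W(X \mid h) = \max_\sigma \min_\tau |\{\pi : h\pi \in X,\ P_{\sigma,\tau}(\pi \mid h) > 0\}|$. Let $\mathrm{Spec}$ be a class of specifications, each of which is represented by a bit string and defines a language $L(\mathcal X) \subseteq \Sigma^*$. An RCI instance $\mathcal C = (\mathcal H, \mathcal S, n, \epsilon, \rho)$ of $\mathrm{RCI}(\mathrm{Spec},\mathrm{Spec})$ consists of $\mathcal H, \mathcal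 S \in \mathrm{Spec}$, $n \in \mathbb N$ and $\epsilon, \rho \in [0,1] \cap \mathbb Q$; its size $|\mathcal C|$ is the total length of the representations, with $n$ in unary and $\epsilon, \rho$ in binary. Put $I = L(\mathcal H) \cap \Sigma^n$ and $A = I \cap L(\mathcal S)$. A strategy $\sigma$ is improvising for $\mathcal C$ if for every adversary $\tau$ one has $P_{\sigma,\tau}(I) = 1$, $P_{\sigma,\tau}(A) \ge 1 - \epsilon$, and $P_{\sigma,\tau}(\pi) \le \rho$ for all $\pi \in I$; $\mathcal C$ is realizable if such a $\sigma$ exists. An improviser for $\mathcal C$ is a probabilistic algorithm that, for some improvising strategy $\sigma$ and every input $h \in \Sigma^{\le n}$, runs in finite expected time and outputs each letter $u$ with probability $\sigma(h,u)$. A polynomial-time (resp. polynomial-space) improvisation scheme for $\mathrm{RCI}(\mathrm{Spec},\mathrm{Spec})$ is a deterministic algorithm $S$ for which there are polynomials $p$ and $q$ such that for every instance $\mathcal C$: (1) if $\mathcal C$ is realizable then $S(\mathcal C)$ is an improviser for $\mathcal C$, and otherwise $S(\mathcal C) = \bot$; (2) $S$ halts on $\mathcal C$ using time (resp. space) at most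 $p(|\mathcal C|)$; (3) if $G = S(\mathcal C) \ne \bot$, then on every input $h \in \Sigma^{\le n}$ the expected running time (resp. expected space) of $G$ is at most $q(|\mathcal C|)$. Theorem. Suppose that the following two problems can be solved by deterministic algorithms in polynomial time (resp. polynomial space): (intersection) given $\mathcal X, \mathcal Y \in \mathrm{Spec}$, find $\mathcal Z \in \mathrm{Spec}$ with $L(\mathcal Z) = L(\mathcal X) \cap L(\mathcal Y)$; (width measurement) given $\mathcal X \in \mathrm{Spec}$, $n \in \mathbb N$ in unary and $h \in \Sigma^{\le n}$, compute $W(L(\mathcal X) \cap \Sigma^n \mid h)$ in binary. Then $\mathrm{RCI}(\mathrm{Spec},\mathrm{Spec})$ has a polynomial-time (resp. polynomial-space) improvisation scheme. -/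

import Mathlib

open scoped ENNReal

namespace RCI

/-! ## The machine model

A machine has countably many registers (only those named in its program matter), each a stack of
bits; this is the usual multi-stack (equivalently multi-tape) machine with structured control flow.
Every elementary step costs one unit of time and touches at most one bit. The control stack of a
configuration holds only subprograms of the program, at most one per node of its syntax tree, so it
plays the role of the finite control. -/

/-- Programs. `flip` is the only probabilistic instruction. -/
inductive Prog : Type
  /-- do nothing -/
  | nop : Prog
  /-- push the bit `b` on register `r` -/
  | push (r : ℕ) (b : Bool) : Prog
  /-- remove the top bit of register `r`, if there is one -/
  | pop (r : ℕ) : Prog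
  /-- push a fair random bit on register `r` -/
  | flip (r : ℕ) : Prog
  /-- run `p`, then `q` -/
  | seq (p q : Prog) : Prog
  /-- run `pe`, `pf` or `pt` if register `r` is empty, has top bit `0`, or has top bit `1` -/
  | branch (r : ℕ) (pe pf pt : Prog) : Prog
  /-- while register `r` is nonempty, run `p` -/
  | loop (r : ℕ) (p : Prog) : Prog

/-- A program is deterministic if it does not toss coins. -/
def Prog.Deterministic : Prog → Prop
  | .nop => True
  | .push _ _ => True
  | .pop _ => True
  | .flip _ => False
  | .seq p q => p.Deterministic ∧ q.Deterministic
  | .branch _ p q s => p.Deterministic ∧ q.Deterministic ∧ s.Deterministic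
  | .loop _ p => p.Deterministic

/-- Contents of the registers. -/
abbrev Store : Type := ℕ → List Bool

/-- Total number of stored bits. -/
noncomputable def Store.space (s : Store) : ℕ := ∑ᶠ r, (s r).length

/-- A configuration: what remains to be executed (empty once the machine has halted), the register
contents, the number of steps made so far and the largest space occupied so far. -/
structure Cfg : Type where
  ctrl : List Prog
  store : Store
  time : ℕ
  peak : ℕ

/-- Execute the first step of `p` followed by the rest `K`; `b` is the outcome of the coin toss of
this step, which is looked at by `flip` only. -/
def Prog.exec (b : Bool) (K : List Prog) (s : Store) : Prog → List Prog × Store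
  | .nop => (K, s)
  | .push r x => (K, Function.update s r (x :: s r))
  | .pop r => (K, Function.update s r (s r).tail)
  | .flip r => (K, Function.update s r (b :: s r))
  | .seq p q => (p :: q :: K, s)
  | .branch r pe pf pt =>
      match s r with
      | [] => (pe :: K, s)
      | false :: _ => (pf :: K, s)
      | true :: _ => (pt :: K, s)
  | .loop r p =>
      match s r with
      | [] => (K, s)
      | _ :: _ => (p :: .loop r p :: K, s)

/-- One step of the machine with coin outcome `b`; a halted configuration does not change. -/
noncomputable def Cfg.step (b : Bool) (c : Cfg) : Cfg :=
  match c.ctrl with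
  | [] => c
  | p :: K =>
      { ctrl := (p.exec b K c.store).1
        store := (p.exec b K c.store).2
        time := c.time + 1
        peak := max c.peak (Store.space (p.exec b K c.store).2) }

/-- The `i`-th input is stored in register `i`; all other registers are empty. -/
def inputStore (inputs : List (List Bool)) : Store := fun r => inputs.getD r []

/-- Total bit length of a tuple of inputs. -/
def inputSize (inputs : List (List Bool)) : ℕ := (inputs.map List.length).sum

/-- The initial configuration of `P` on given inputs. -/
noncomputable def Prog.start (P : Prog) (inputs : List (List Bool)) : Cfg where
  ctrl := [P]
  store := inputStore inputs
  time := 0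
  peak := Store.space (inputStore inputs)

/-- The machine has halted with output `out` (which is read in register `0`). -/
def Cfg.HaltedWith (c : Cfg) (out : List Bool) : Prop := c.ctrl = [] ∧ c.store 0 = out

/-- The two complexity measures. -/
inductive Resource : Type
  | time
  | space

/-- The amount of the resource that was used up to the configuration `c`. -/
def Cfg.cost (c : Cfg) : Resource → ℕ
  | .time => c.time
  | .space => c.peak

/-- The deterministic program `P` halts on the given inputs with output `out`, having used at most
`bound` units of the resource `R`. (The coin outcome `false` is never looked at.) -/
def Prog.Computes (P : Prog) (R : Resource) (inputs : List (List Bool)) (out : List Bool)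
    (bound : ℕ) : Prop :=
  ∃ t : ℕ, ((Cfg.step false)^[t] (P.start inputs)).HaltedWith out ∧
    ((Cfg.step false)^[t] (P.start inputs)).cost R ≤ bound

/-- Distribution of the configuration after `t` steps from `c`, with independent fair coins. -/
noncomputable def Cfg.runDist : ℕ → Cfg → PMF Cfg
  | 0, c => PMF.pure c
  | t + 1, c => (PMF.uniformOfFintype Bool).bind fun b => Cfg.runDist t (c.step b)

/-- The probability that `P` halts on the given inputs with output `out`, as the limit of the
nondecreasing probabilities of having done so within `t` steps. -/
noncomputable def Prog.outputProb (P : Prog) (inputs : List (List Bool)) (out : List Bool) : ℝ≥0∞ :=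
  ⨆ t : ℕ, ((P.start inputs).runDist t).toOuterMeasure {c | c.HaltedWith out}

/-- The expected running time, resp. the expectation of the largest space occupied during the run,
as the limit of the nondecreasing expectations of the amount used within `t` steps.
It is infinite in the case of time if `P` fails to halt with positive probability. -/
noncomputable def Prog.expectedCost (P : Prog) (R : Resource) (inputs : List (List Bool)) : ℝ≥0∞ :=
  ⨆ t : ℕ, ∑' c : Cfg, (P.start inputs).runDist t c * (c.cost R : ℝ≥0∞)

/-! ### Programs as bit strings -/

/-- Self-delimiting unary code of a number. -/
def unaryCode (r : ℕ) : List Bool := List.replicate r true ++ [false]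

/-- The bit string that represents a program. -/
def Prog.encode : Prog → List Bool
  | .nop => [false, false, false]
  | .push r b => [false, false, true, b] ++ unaryCode r
  | .pop r => [false, true, false] ++ unaryCode r
  | .flip r => [false, true, true] ++ unaryCode r
  | .seq p q => [true, false, false] ++ (p.encode ++ q.encode)
  | .branch r pe pf pt =>
      [true, false, true] ++ (unaryCode r ++ (pe.encode ++ (pf.encode ++ pt.encode)))
  | .loop r p => [true, true, false] ++ (unaryCode r ++ p.encode)

/-- The bit string that represents `⊥` or a program. -/
def encodeResult : Option Prog → List Bool
  | none => [false]
  | some G => true :: G.encode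

theorem unaryCode_append_inj {r r' : ℕ} {x y : List Bool}
    (h : unaryCode r ++ x = unaryCode r' ++ y) : r = r' ∧ x = y := by
  induction r generalizing r' with
  | zero => cases r' <;> simp_all [unaryCode, List.replicate_succ]
  | succ r ih =>
    cases r' with
    | zero => simp [unaryCode, List.replicate_succ] at h
    | succ r' =>
      have := @ih r' (by simpa [unaryCode, List.replicate_succ] using h)
      simp [this]

theorem Prog.encode_append_inj {p q : Prog} {x y : List Bool}
    (h : p.encode ++ x = q.encode ++ y) : p = q ∧ x = y := by
  induction p generalizing q x y with
  | nop => cases q <;> simp_all [Prog.encode]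
  | push r b =>
    cases q <;> simp [Prog.encode] at h
    obtain ⟨rfl, h⟩ := h
    obtain ⟨rfl, rfl⟩ := unaryCode_append_inj h
    simp
  | pop r =>
    cases q <;> simp [Prog.encode] at h
    obtain ⟨rfl, rfl⟩ := unaryCode_append_inj h
    simp
  | flip r =>
    cases q <;> simp [Prog.encode] at h
    obtain ⟨rfl, rfl⟩ := unaryCode_append_inj h
    simp
  | seq p₁ p₂ ih₁ ih₂ =>
    cases q <;> simp [Prog.encode] at h
    obtain ⟨h₁, h⟩ := ih₁ h
    obtain ⟨h₂, h⟩ := ih₂ h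
    simp [h₁, h₂, h]
  | branch r p₁ p₂ p₃ ih₁ ih₂ ih₃ =>
    cases q <;> simp [Prog.encode] at h
    obtain ⟨h₀, h⟩ := unaryCode_append_inj h
    obtain ⟨h₁, h⟩ := ih₁ h
    obtain ⟨h₂, h⟩ := ih₂ h
    obtain ⟨h₃, h⟩ := ih₃ h
    simp [h₀, h₁, h₂, h₃, h]
  | loop r p₁ ih₁ =>
    cases q <;> simp [Prog.encode] at h
    obtain ⟨h₀, h⟩ := unaryCode_append_inj h
    obtain ⟨h₁, h⟩ := ih₁ h
    simp [h₀, h₁, h]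

/-- The representation determines the program (or `⊥`). -/
theorem encodeResult_injective : Function.Injective encodeResult := by
  intro a b h
  cases a <;> cases b <;> simp [encodeResult] at h ⊢
  exact (Prog.encode_append_inj (x := []) (y := []) (by simpa using h)).1

/-! ## Synthesis games -/

section Games

variable {A : Type*} [Fintype A]

/-- A strategy for plays of length `n` over the alphabet `A`. Only its values on histories of
length at most `n` are meaningful. -/
structure Strategy (A : Type*) [Fintype A] (n : ℕ) where
  prob : List A → A → ℝ
  prob_nonneg : ∀ h u, h.length ≤ n → 0 ≤ prob h u
  prob_le_one : ∀ h u, h.length ≤ n → prob h u ≤ 1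
  sum_prob : ∀ h, h.length < n → ∑ u, prob h u = 1

/-- The probability that the play continues with `w` after the history `h`, when we follow `σ`
(moving after histories of even length) and the adversary follows `τ`. -/
def condProb {n : ℕ} (σ τ : Strategy A n) : List A → List A → ℝ
  | _, [] => 1
  | h, u :: w => (if Even h.length then σ.prob h u else τ.prob h u) * condProb σ τ (h ++ [u]) w

/-- The probability of the play `w`. -/
def playProb {n : ℕ} (σ τ : Strategy A n) (w : List A) : ℝ := condProb σ τ [] w

open Classical in
/-- The probability of the set `X` of plays of length `n`. -/
noncomputable def setProb {n : ℕ} (σ τ : Strategy A n) (X : Set (List A)) : ℝ :=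
  ∑ w : Fin n → A, if List.ofFn w ∈ X then playProb σ τ (List.ofFn w) else 0

/-- The words of length `n` in a language. -/
def slice (L : Set (List A)) (n : ℕ) : Set (List A) := {w | w ∈ L ∧ w.length = n}

/-- The width of a set `X` of plays of length `n`, given the history `h`: the largest number of
plays in `X` extending `h` that we can keep possible against every adversary. -/
noncomputable def width (n : ℕ) (X : Set (List A)) (h : List A) : ℕ :=
  ⨆ σ : Strategy A n, ⨅ τ : Strategy A n,
    Set.ncard {w : List A | h ++ w ∈ X ∧ 0 < condProb σ τ h w}

end Games

/-! ## Specification classes and reactive control improvisation -/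

/-- A class of specifications of languages over `A`: each specification is represented by a bit
string and defines a language. -/
structure SpecClass (A : Type*) where
  Spec : Type*
  code : Spec → List Bool
  code_injective : Function.Injective code
  lang : Spec → Set (List A)

/-- An RCI instance with hard and soft specifications from the given classes. -/
structure Instance {A : Type*} (HSpec SSpec : SpecClass A) where
  hard : HSpec.Spec
  soft : SSpec.Spec
  n : ℕ
  ε : ℚ
  ρ : ℚ
  ε_nonneg : 0 ≤ ε
  ε_le_one : ε ≤ 1
  ρ_nonneg : 0 ≤ ρ
  ρ_le_one : ρ ≤ 1

namespace Instance

variable {A : Type*} {HSpec SSpec : SpecClass A} (C : Instance HSpec SSpec)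

/-- The set `I` of improvisations. -/
def improvisations : Set (List A) := slice (HSpec.lang C.hard) C.n

/-- The set `A` of admissible improvisations. -/
def admissible : Set (List A) := {w | w ∈ C.improvisations ∧ w ∈ SSpec.lang C.soft}

/-- `σ` is an improvising strategy. -/
structure IsImprovising [Fintype A] (σ : Strategy A C.n) : Prop where
  hard_constraint : ∀ τ : Strategy A C.n, setProb σ τ C.improvisations = 1
  soft_constraint : ∀ τ : Strategy A C.n, 1 - (C.ε : ℝ) ≤ setProb σ τ C.admissible
  randomness : ∀ τ : Strategy A C.n, ∀ w ∈ C.improvisations, playProb σ τ w ≤ (C.ρ : ℝ)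

/-- An improvising strategy exists. -/
def Realizable [Fintype A] : Prop := ∃ σ : Strategy A C.n, C.IsImprovising σ

/-- The bit strings given to an algorithm whose input is `C`: `n` is in unary, and the numerators
and denominators of `ε` and `ρ` are in binary (least significant bit first). -/
def inputs : List (List Bool) :=
  [HSpec.code C.hard, SSpec.code C.soft, List.replicate C.n true,
    C.ε.num.toNat.bits, C.ε.den.bits, C.ρ.num.toNat.bits, C.ρ.den.bits]

/-- The size of `C`. -/
def size : ℕ := inputSize C.inputs

end Instance

/-- The code of a letter, with respect to an enumeration of the alphabet. -/
def letterCode {A : Type*} {k : ℕ} (e : A ≃ Fin k) (u : A) : List Bool := unaryCode (e u)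

/-- The code of a word. -/
def wordCode {A : Type*} {k : ℕ} (e : A ≃ Fin k) (w : List A) : List Bool :=
  w.flatMap (letterCode e)

/-- The probabilistic program `G` is an improviser for `C`: in expected finite time, it implements
an improvising strategy. -/
def IsImproviser {A : Type*} [Fintype A] {k : ℕ} (e : A ≃ Fin k) {HSpec SSpec : SpecClass A}
    (C : Instance HSpec SSpec) (G : Prog) : Prop :=
  ∃ σ : Strategy A C.n, C.IsImprovising σ ∧
    ∀ h : List A, h.length ≤ C.n →
      G.expectedCost .time [wordCode e h] < ∞ ∧
      ∀ u : A, G.outputProb [wordCode e h] (letterCode e u) = ENNReal.ofReal (σ.prob h u)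

/-- The class supports intersection in polynomial time, resp. space. -/
def SupportsIntersection {A : Type*} (R : Resource) (𝒮 : SpecClass A) : Prop :=
  ∃ (P : Prog) (p : Polynomial ℕ), P.Deterministic ∧
    ∀ X Y : 𝒮.Spec, ∃ Z : 𝒮.Spec, 𝒮.lang Z = 𝒮.lang X ∩ 𝒮.lang Y ∧
      P.Computes R [𝒮.code X, 𝒮.code Y] (𝒮.code Z)
        (p.eval (inputSize [𝒮.code X, 𝒮.code Y]))

/-- The class supports width measurement in polynomial time, resp. space: `n` is given in unary
and the width is returned in binary. -/
def SupportsWidth {A : Type*} [Fintype A] {k : ℕ} (e : A ≃ Fin k) (R : Resource)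
    (𝒮 : SpecClass A) : Prop :=
  ∃ (P : Prog) (p : Polynomial ℕ), P.Deterministic ∧
    ∀ (X : 𝒮.Spec) (n : ℕ) (h : List A), h.length ≤ n →
      P.Computes R [𝒮.code X, List.replicate n true, wordCode e h]
        (width n (slice (𝒮.lang X) n) h).bits
        (p.eval (inputSize [𝒮.code X, List.replicate n true, wordCode e h]))

/-- There is a polynomial-time, resp. polynomial-space, improvisation scheme for the RCI instances
with hard and soft specifications from the given classes. `S` is the scheme and `f` the function
it computes. -/
def HasImprovisationScheme {A : Type*} [Fintype A] {k : ℕ} (e : A ≃ Fin k) (R : Resource)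
    (HSpec SSpec : SpecClass A) : Prop :=
  ∃ (S : Prog) (f : Instance HSpec SSpec → Option Prog) (p q : Polynomial ℕ),
    S.Deterministic ∧
    -- scheme efficiency
    (∀ C, S.Computes R C.inputs (encodeResult (f C)) (p.eval C.size)) ∧
    -- correctness
    (∀ C, C.Realizable → ∃ G, f C = some G ∧ IsImproviser e C G) ∧
    (∀ C, ¬ C.Realizable → f C = none) ∧
    -- improviser efficiency
    (∀ C G, f C = some G → ∀ h : List A, h.length ≤ C.n →
      G.expectedCost R [wordCode e h] ≤ ((q.eval C.size : ℕ) : ℝ≥0∞))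

end RCI

namespace RCI

/-! ## Deterministic runs and their cost -/

/-! Write `ρ = a / q` in lowest terms and scale the widths of `I` and of the admissible set by `a`,
giving functions `wI` and `wA` of the history. Then the instance is realizable exactly if `q ≤ wI
[]` and `(1 - ε) q ≤ min q (wA [])`, which two width queries and a little arithmetic decide.

Necessity (`Instance.feasible_of_improvising`): against an improvising strategy the adversary can
leave at most as many plays of `I` as the width says. Each of them has probability at most `ρ`, so
their total probability 1 is at most `ρ` times the width. The same argument for the admissible plays
gives the bound with `1 - ε`.

Sufficiency (`Instance.improvising_strategy`): allot the pair of masses `(min q (wA []), q)` to the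
empty history and pass masses down, keeping a pair `(α, β)` at `h` with `α ≤ β`, `α ≤ wA h`, `β ≤ wI
h`. On our turn both masses are split among the letters within the capacities of the successors; a
greedy split works (`allocate`) because the width of `h` is at most the sum of the widths of its
successors (`width_even`). On the adversary's turn the masses are passed on unchanged, because the
width of `h` is at most that of each successor (`width_odd`). The strategy plays letters in
proportion to `β`. A play of mass `β` at its end then has probability at most `β / q ≤ a / q = ρ`,
since leaf widths are at most 1. Leaves of nonzero mass lie in `I`, so `I` is reached surely. The
admissible set is reached with probability at least `α / q` for the initial `α`, hence at least `1 -
ε`.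

An improviser carries the instance in its program text and continues with a fixed program. It
recomputes the masses along the given history with width queries, samples a uniform number below `β`
by rejection, and outputs the letter in whose interval of partial sums of masses the number falls.
Masses never exceed `q`, so all numbers stay short.

The cost analysis treats time and space at once. `Runs` is a calculus for deterministic pieces.
`Spreads` is its probabilistic counterpart; it says that every one-sided potential on configurations
satisfies an averaging inequality, and suitable potentials yield expected time, expected space and
output probabilities (`Spreads.expectedCost_le`, `Spreads.outputProb_eq`). All costs are explicit in
a common bound `M` on register lengths, and `exists_setting` shows that `M` may be polynomial in the
size of the instance. -/

theorem Store.space_update_le (s : Store) (r : ℕ) (l : List Bool) (d : ℕ)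
    (h : l.length ≤ (s r).length + d) : Store.space (Function.update s r l) ≤ s.space + d := by
  unfold Store.space
  by_cases hf : (Function.support fun r => (s r).length).Finite
  · set F := insert r hf.toFinset
    have h1 : ∑ᶠ r, (s r).length = ∑ r ∈ F, (s r).length :=
      finsum_eq_sum_of_support_subset _ (by intro x hx; simp [F] at hx ⊢; tauto)
    have h2 : ∑ᶠ r', (Function.update s r l r').length
        = ∑ r' ∈ F, (Function.update s r l r').length := by
      refine finsum_eq_sum_of_support_subset _ ?_
      intro x hx
      by_cases hxr : x = r
      · simp [F, hxr]
      · simp [F, hxr] at hx ⊢; exact hx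
    have hr : r ∈ F := Finset.mem_insert_self _ _
    rw [h1, h2, ← Finset.add_sum_erase _ _ hr, ← Finset.add_sum_erase F _ hr]
    have : ∑ x ∈ F.erase r, (Function.update s r l x).length = ∑ x ∈ F.erase r, (s x).length :=
      Finset.sum_congr rfl fun x hx => by rw [Function.update_of_ne (Finset.ne_of_mem_erase hx)]
    rw [this]; simp; omega
  -- If infinitely many registers are nonempty, both sums take the default value 0, since changing
  -- one register leaves the support infinite.
  · rw [finsum_of_infinite_support (f := fun r' => (Function.update s r l r').length)]
    · exact Nat.zero_le _
    · intro hfin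
      refine hf ((hfin.insert r).subset ?_)
      intro x hx
      by_cases hxr : x = r
      · simp [hxr]
      · right; simpa [hxr] using hx

/-- `DRun m t K s K' s'`: whatever the coin outcomes, `t` steps lead from the control stack `K` and
the store `s` to `K'` and `s'`, through stores of space at most `m`. -/
inductive DRun (m : ℕ) : ℕ → List Prog → Store → List Prog → Store → Prop
  | refl (K : List Prog) (s : Store) : DRun m 0 K s K s
  | step {p : Prog} {K K₁ K' : List Prog} {s s₁ s' : Store} {t : ℕ}
      (h : ∀ b, p.exec b K s = (K₁, s₁)) (hm : s₁.space ≤ m) (hr : DRun m t K₁ s₁ K' s') :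
      DRun m (t + 1) (p :: K) s K' s'

theorem DRun.trans {m t t' : ℕ} {K K' K'' : List Prog} {s s' s'' : Store}
    (h : DRun m t K s K' s') (h' : DRun m t' K' s' K'' s'') : DRun m (t + t') K s K'' s'' := by
  induction h with
  | refl => simpa using h'
  | step h hm _ ih => rw [Nat.add_right_comm]; exact .step h hm (ih h')

theorem DRun.mono {m m' t : ℕ} {K K' : List Prog} {s s' : Store}
    (h : DRun m t K s K' s') (hm : m ≤ m') : DRun m' t K s K' s' := by
  induction h with
  | refl => exact .refl _ _
  | step h hm' _ ih => exact .step h (hm'.trans hm) ih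

/-- `p` turns the store `s` into `s'` without looking at coins. It increases the occupied space by
at most `B` meanwhile and, if the resource is time, takes at most `B` steps. -/
def Runs (R : Resource) (p : Prog) (s s' : Store) (B : ℕ) : Prop :=
  ∃ t, (R = .time → t ≤ B) ∧ s'.space ≤ s.space + B ∧
    ∀ K, DRun (s.space + B) t (p :: K) s K s'

section
variable {R : Resource} {p q pe pf pt : Prog} {s s' s'' : Store} {B B' B₁ B₂ r : ℕ}

theorem Runs.mono (h : Runs R p s s' B) (hB : B ≤ B') : Runs R p s s' B' := by
  obtain ⟨t, h1, h2, h3⟩ := h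
  exact ⟨t, fun h => (h1 h).trans hB, by omega, fun K => (h3 K).mono (by omega)⟩

theorem Runs.cast (h : Runs R p s s' B) (hs : s' = s'') (hB : B ≤ B') : Runs R p s s'' B' :=
  hs ▸ h.mono hB

theorem Runs.of_exec (h : ∀ b K, p.exec b K s = (K, s')) (hs : s'.space ≤ s.space + 1) :
    Runs R p s s' 1 :=
  ⟨1, fun _ => le_rfl, hs, fun K => .step (fun b => h b K) hs (.refl _ _)⟩

theorem Runs.nop : Runs R .nop s s 1 := .of_exec (fun _ _ => rfl) (by omega)

theorem Runs.push (r : ℕ) (b : Bool) :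
    Runs R (.push r b) s (Function.update s r (b :: s r)) 1 :=
  .of_exec (fun _ _ => rfl) (s.space_update_le _ _ _ (by simp))

theorem Runs.pop (r : ℕ) : Runs R (.pop r) s (Function.update s r (s r).tail) 1 :=
  .of_exec (fun _ _ => rfl) (s.space_update_le _ _ _ (by simp; omega))

theorem Runs.seq (h : Runs R p s s' B₁) (h' : Runs R q s' s'' B₂) :
    Runs R (.seq p q) s s'' (B₁ + B₂ + 1) := by
  obtain ⟨t, h1, h2, h3⟩ := h
  obtain ⟨t', h1', h2', h3'⟩ := h'
  refine ⟨t + t' + 1, fun h => ?_, by omega, fun K => ?_⟩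
  · have := h1 h; have := h1' h; omega
  · exact .step (fun _ => rfl) (by omega)
      (((h3 (q :: K)).mono (by omega)).trans ((h3' K).mono (by omega)))

theorem Runs.of_step (he : ∀ b K, p.exec b K s = (q :: K, s)) (h : Runs R q s s' B) :
    Runs R p s s' (B + 1) := by
  obtain ⟨t, h1, h2, h3⟩ := h
  refine ⟨t + 1, fun h => by have := h1 h; omega, by omega, fun K => ?_⟩
  exact .step (fun b => he b K) (by omega) ((h3 K).mono (by omega))

theorem Runs.branch_nil (hr : s r = []) (h : Runs R pe s s' B) :
    Runs R (.branch r pe pf pt) s s' (B + 1) :=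
  .of_step (fun b K => by simp [Prog.exec, hr]) h

theorem Runs.branch_false {l : List Bool} (hr : s r = false :: l) (h : Runs R pf s s' B) :
    Runs R (.branch r pe pf pt) s s' (B + 1) :=
  .of_step (fun b K => by simp [Prog.exec, hr]) h

theorem Runs.branch_true {l : List Bool} (hr : s r = true :: l) (h : Runs R pt s s' B) :
    Runs R (.branch r pe pf pt) s s' (B + 1) :=
  .of_step (fun b K => by simp [Prog.exec, hr]) h

/-- With equal programs for both top bits, a branch tests only whether the register is empty. This
is how numbers are compared with 0. -/
theorem Runs.branch_cons (hr : s r ≠ []) (h : Runs R p s s' B) :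
    Runs R (.branch r pe p p) s s' (B + 1) := by
  rcases hl : s r with _ | ⟨_ | _, l⟩
  · exact absurd hl hr
  · exact .branch_false hl h
  · exact .branch_true hl h

theorem Runs.loop_nil (hr : s r = []) : Runs R (.loop r p) s s 1 :=
  .of_exec (fun b K => by simp [Prog.exec, hr]) (by omega)

theorem Runs.loop_cons (hr : s r ≠ []) (h : Runs R p s s' B₁)
    (h' : Runs R (.loop r p) s' s'' B₂) : Runs R (.loop r p) s s'' (B₁ + B₂ + 1) := by
  obtain ⟨t, h1, h2, h3⟩ := h
  obtain ⟨t', h1', h2', h3'⟩ := h'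
  refine ⟨t + t' + 1, fun h => ?_, by omega, fun K => ?_⟩
  · have := h1 h; have := h1' h; omega
  · refine .step (K₁ := p :: .loop r p :: K) (s₁ := s) (fun _ => ?_) (by omega)
      (((h3 _).mono (by omega)).trans ((h3' K).mono (by omega)))
    rcases hl : s r with _ | ⟨_, l⟩
    · exact absurd hl hr
    · simp [Prog.exec, hl]

end

/-- A deterministic program makes the corresponding steps of the machine. -/
theorem DRun.iterate_step {m t : ℕ} {K K' : List Prog} {s s' : Store} (h : DRun m t K s K' s') :
    ∀ τ pk, pk ≤ m → ∃ pk' ≤ m,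
      (Cfg.step false)^[t] ⟨K, s, τ, pk⟩ = ⟨K', s', τ + t, pk'⟩ := by
  induction h with
  | refl => intro τ pk h; exact ⟨pk, h, rfl⟩
  | @step p K K₁ K' s s₁ s' t h hm hr ih =>
    intro τ pk hpk
    obtain ⟨pk', h1, h2⟩ := ih (τ + 1) (max pk s₁.space) (by omega)
    refine ⟨pk', h1, ?_⟩
    rw [Function.iterate_succ_apply]
    have : Cfg.step false ⟨p :: K, s, τ, pk⟩ = ⟨K₁, s₁, τ + 1, max pk s₁.space⟩ := by
      simp [Cfg.step, h false]
    rw [this, h2]; congr 1; omega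

/-- `Runs` bounds the increase of space only, so the space of the input is added; for time this
summand is slack. -/
theorem Runs.computes {R : Resource} {P : Prog} {inputs : List (List Bool)} {s' : Store} {B : ℕ}
    (h : Runs R P (inputStore inputs) s' B) :
    P.Computes R inputs (s' 0) ((inputStore inputs).space + B) := by
  obtain ⟨t, h1, -, h3⟩ := h
  obtain ⟨pk, h4, h5⟩ := (h3 []).iterate_step 0 (inputStore inputs).space (by omega)
  refine ⟨t, ?_, ?_⟩
  · simp only [Prog.start, h5]; exact ⟨rfl, rfl⟩
  · simp only [Prog.start, h5]
    cases R
    · have := h1 rfl; simp [Cfg.cost]; omega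
    · simpa [Cfg.cost] using h4

/-! ## Transfer between registers -/

/-- Push `b` on all registers of `ds`. -/
def pushAll (b : Bool) : List ℕ → Prog
  | [] => .nop
  | d :: ds => .seq (.push d b) (pushAll b ds)

theorem Runs.pushAll {R : Resource} (b : Bool) {ds : List ℕ} (hd : ds.Nodup) (s : Store) :
    Runs R (RCI.pushAll b ds) s (fun r => if r ∈ ds then b :: s r else s r)
      (2 * ds.length + 1) := by
  induction ds generalizing s with
  | nil => simpa [RCI.pushAll] using Runs.nop
  | cons d ds ih =>
    rw [List.nodup_cons] at hd
    refine ((Runs.push d b).seq (ih hd.2 _)).cast ?_ (by simp; omega)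
    funext r
    by_cases h1 : r = d
    · subst h1; simp [hd.1]
    · simp [h1]

/-- Move the contents of `src` bit by bit to all registers of `ds`, which reverses it. -/
def pour (src : ℕ) (ds : List ℕ) : Prog :=
  .loop src (.branch src .nop (.seq (.pop src) (pushAll false ds))
    (.seq (.pop src) (pushAll true ds)))

theorem Runs.pour {R : Resource} {src : ℕ} {ds : List ℕ} (hd : ds.Nodup) (hs : src ∉ ds)
    (s : Store) :
    Runs R (RCI.pour src ds) s
      (fun r => if r = src then [] else if r ∈ ds then (s src).reverse ++ s r else s r)
      ((s src).length * (2 * ds.length + 5) + 1) := by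
  generalize hl : s src = l
  induction l generalizing s with
  | nil =>
    have : (fun r => if r = src then [] else if r ∈ ds then (([] : List Bool)).reverse ++ s r
      else s r) = s := by
      funext r; split_ifs with h <;> simp [h, hl]
    rw [this]
    exact (Runs.loop_nil hl).mono (by omega)
  | cons b l ih =>
    set s₁ : Store := fun r => if r ∈ ds then b :: Function.update s src (s src).tail r
      else Function.update s src (s src).tail r
    have hbody : Runs R (.branch src .nop (.seq (.pop src) (RCI.pushAll false ds))
        (.seq (.pop src) (RCI.pushAll true ds))) s s₁ (2 * ds.length + 4) := by
      cases b
      · exact (Runs.branch_false hl ((Runs.pop src).seq (Runs.pushAll false hd _))).mono (by omega)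
      · exact (Runs.branch_true hl ((Runs.pop src).seq (Runs.pushAll true hd _))).mono (by omega)
    have := ih s₁ (by simp [s₁, hs, hl])
    refine (Runs.loop_cons (by simp [hl]) hbody this).cast ?_
      (by have := Nat.add_one_mul l.length (2 * ds.length + 5); simp only [List.length_cons]; omega)
    funext r
    by_cases h1 : r = src
    · simp [h1]
    · by_cases h2 : r ∈ ds <;> simp [h1, h2, s₁]

/-- Empty the register `r`. -/
def clear (r : ℕ) : Prog := pour r []

theorem Runs.clear {R : Resource} (r : ℕ) (s : Store) :
    Runs R (RCI.clear r) s (Function.update s r []) (5 * (s r).length + 1) := by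
  have := Runs.pour (R := R) (src := r) (ds := []) (by simp) (by simp) s
  refine this.cast ?_ (by simp; omega)
  funext x; by_cases h : x = r <;> simp [h]

/-! ## Binary arithmetic -/

/-- The number with the binary digits `l`, the least significant one first. -/
def val : List Bool → ℕ
  | [] => 0
  | b :: l => b.toNat + 2 * val l

theorem bits_two_mul_add (b : Bool) (n : ℕ) :
    (b.toNat + 2 * n).bits = if n = 0 ∧ b = false then [] else b :: n.bits := by
  split_ifs with h
  · simp [h]
  · rw [← Nat.bits_append_bit n b (by intro hn; cases b <;> simp_all), Nat.bit_val, add_comm]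

theorem val_bits (n : ℕ) : val n.bits = n := by
  induction n using Nat.strong_induction_on with
  | _ n ih =>
    obtain ⟨b, m, rfl⟩ : ∃ b m, n = Bool.toNat b + 2 * m :=
      ⟨decide (n % 2 = 1), n / 2, by
        rcases Nat.mod_two_eq_zero_or_one n with h | h <;> simp [h] <;> omega⟩
    rw [bits_two_mul_add]
    split_ifs with h
    · simp [h, val]
    · rw [val, ih m]
      rcases Nat.eq_zero_or_pos m with rfl | hm
      · cases b <;> simp_all
      · omega

theorem bits_eq_nil {n : ℕ} : n.bits = [] ↔ n = 0 :=
  ⟨fun h => by rw [← val_bits n, h, val], fun h => by simp [h]⟩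

theorem val_lt (l : List Bool) : val l < 2 ^ l.length := by
  induction l with
  | nil => simp [val]
  | cons b l ih => cases b <;> simp [val, pow_succ] <;> omega

theorem val_append (l l' : List Bool) : val (l ++ l') = val l + 2 ^ l.length * val l' := by
  induction l with
  | nil => simp [val]
  | cons b l ih => simp [val, ih, pow_succ]; ring

theorem length_bits_le {n m : ℕ} (h : n < 2 ^ m) : n.bits.length ≤ m := by
  induction m generalizing n with
  | zero => have : n = 0 := by simpa using h
            simp [this]
  | succ m ih =>
    obtain ⟨b, k, rfl⟩ : ∃ b k, n = Bool.toNat b + 2 * k :=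
      ⟨decide (n % 2 = 1), n / 2, by
        rcases Nat.mod_two_eq_zero_or_one n with h | h <;> simp [h] <;> omega⟩
    rw [bits_two_mul_add]
    split_ifs with h'
    · simp
    · have := @ih k (by rw [pow_succ] at h; omega)
      simpa using this

theorem lt_two_pow_length_bits (n : ℕ) : n < 2 ^ n.bits.length := by
  simpa [val_bits] using val_lt n.bits

theorem length_bits_mono {a b : ℕ} (h : a ≤ b) : a.bits.length ≤ b.bits.length :=
  length_bits_le (h.trans_lt (lt_two_pow_length_bits b))

theorem length_bits_mul_le (a b : ℕ) :
    (a * b).bits.length ≤ a.bits.length + b.bits.length := by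
  refine length_bits_le ?_
  rw [pow_add]
  exact Nat.mul_lt_mul'' (lt_two_pow_length_bits a) (lt_two_pow_length_bits b)

/-- At least half of the words of this length represent numbers below `n`, so rejection sampling
below `n` succeeds with probability at least 1/2 per round. -/
theorem two_pow_length_bits_le {n : ℕ} (h : n ≠ 0) : 2 ^ n.bits.length ≤ 2 * n := by
  induction n using Nat.strong_induction_on with
  | _ n ih =>
    obtain ⟨b, k, rfl⟩ : ∃ b k, n = Bool.toNat b + 2 * k :=
      ⟨decide (n % 2 = 1), n / 2, by
        rcases Nat.mod_two_eq_zero_or_one n with h | h <;> simp [h] <;> omega⟩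
    rw [bits_two_mul_add, if_neg (by rintro ⟨rfl, rfl⟩; simp at h), List.length_cons, pow_succ]
    rcases Nat.eq_zero_or_pos k with rfl | hk
    · cases b <;> simp_all
    · have := ih k (by omega) (by omega)
      omega

/-- The digitwise evaluation of `m` steps of a finite automaton on two words, with the state it
ends in. -/
def ripple (f : Bool → Bool → Bool → Bool × Bool) :
    ℕ → List Bool → List Bool → Bool → List Bool × Bool
  | 0, _, _, z => ([], z)
  | m + 1, x, y, z =>
      let o := f (x.headD false) (y.headD false) z
      (o.1 :: (ripple f m x.tail y.tail o.2).1, (ripple f m x.tail y.tail o.2).2)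

/-- Full adder. -/
def addDigit (x y z : Bool) : Bool × Bool := (xor x (xor y z), (x && y) || (x && z) || (y && z))

/-- Full subtractor. -/
def subDigit (x y z : Bool) : Bool × Bool :=
  (xor x (xor y z), (!x && y) || (!x && z) || (y && z))

theorem val_eq_head_tail (l : List Bool) : val l = (l.headD false).toNat + 2 * val l.tail := by
  cases l <;> simp [val]

theorem ripple_length (f) (m : ℕ) (x y : List Bool) (z : Bool) :
    (ripple f m x y z).1.length = m := by
  induction m generalizing x y z with
  | zero => rfl
  | succ m ih => simp [ripple, ih]

/-- The identity of the full adder, checked on its eight inputs, propagates through the digits; the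
final carry has weight `2 ^ m`. The two bounds ensure that no nonzero digit is left unread. -/
theorem ripple_add (m : ℕ) (x y : List Bool) (z : Bool) (hx : val x < 2 ^ m) (hy : val y < 2 ^ m) :
    val (ripple addDigit m x y z).1 + 2 ^ m * (ripple addDigit m x y z).2.toNat
      = val x + val y + z.toNat := by
  induction m generalizing x y z with
  | zero => simp at hx hy; simp [ripple, val, hx, hy]
  | succ m ih =>
    have hx' := val_eq_head_tail x
    have hy' := val_eq_head_tail y
    have := ih x.tail y.tail (addDigit (x.headD false) (y.headD false) z).2
      (by rw [pow_succ] at hx; omega) (by rw [pow_succ] at hy; omega)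
    have e : ∀ a b c : Bool, (addDigit a b c).1.toNat + 2 * (addDigit a b c).2.toNat
      = a.toNat + b.toNat + c.toNat := by decide
    have := e (x.headD false) (y.headD false) z
    simp only [ripple, val, pow_succ]
    generalize (ripple addDigit m _ _ _) = w at *
    rw [mul_right_comm]
    generalize 2 ^ m * w.2.toNat = v at *
    omega

/-- The final borrow stands on the side of the minuend with weight `2 ^ m`; as the result is below
`2 ^ m`, it is set exactly when the difference would be negative. -/
theorem ripple_sub (m : ℕ) (x y : List Bool) (z : Bool) (hx : val x < 2 ^ m) (hy : val y < 2 ^ m) :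
    val x + 2 ^ m * (ripple subDigit m x y z).2.toNat
      = val (ripple subDigit m x y z).1 + val y + z.toNat := by
  induction m generalizing x y z with
  | zero => simp at hx hy; simp [ripple, val, hx, hy]
  | succ m ih =>
    have hx' := val_eq_head_tail x
    have hy' := val_eq_head_tail y
    have := ih x.tail y.tail (subDigit (x.headD false) (y.headD false) z).2
      (by rw [pow_succ] at hx; omega) (by rw [pow_succ] at hy; omega)
    have e : ∀ a b c : Bool, (subDigit a b c).1.toNat + b.toNat + c.toNat
      = a.toNat + 2 * (subDigit a b c).2.toNat := by decide
    have := e (x.headD false) (y.headD false) z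
    simp only [ripple, val, pow_succ]
    generalize (ripple subDigit m _ _ _) = w at *
    rw [mul_right_comm]
    generalize 2 ^ m * w.2.toNat = v at *
    omega

/-! ### Programs for arithmetic on registers -/

/-- Remove the top bit of register `r` and continue according to it, an empty register being read
as `0`. -/
def readBit (r : ℕ) (k : Bool → Prog) : Prog :=
  .branch r (k false) (.seq (.pop r) (k false)) (.seq (.pop r) (k true))

theorem Runs.readBit {R : Resource} {r : ℕ} {k : Bool → Prog} {s s' : Store} {B : ℕ}
    (h : Runs R (k ((s r).headD false)) (Function.update s r (s r).tail) s' B) :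
    Runs R (RCI.readBit r k) s s' (B + 3) := by
  rcases hl : s r with _ | ⟨_ | _, l⟩
  · rw [hl, List.tail_nil, ← hl, Function.update_eq_self] at h
    exact (Runs.branch_nil hl (by simpa [hl] using h)).mono (by omega)
  · exact (Runs.branch_false hl ((Runs.pop r).seq (by simpa [hl] using h))).mono (by omega)
  · exact (Runs.branch_true hl ((Runs.pop r).seq (by simpa [hl] using h))).mono (by omega)

/-- Push the contents of register `x` on the registers `ds`, using register `22`. -/
def copy (x : ℕ) (ds : List ℕ) : Prog := .seq (pour x [22]) (pour 22 (x :: ds))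

theorem Runs.copy {R : Resource} {x : ℕ} {ds : List ℕ} (hx : x ≠ 22) (hd : (x :: ds).Nodup)
    (h22 : 22 ∉ ds) {s : Store} (hs : s 22 = []) :
    Runs R (RCI.copy x ds) s (fun r => if r ∈ ds then s x ++ s r else s r)
      ((s x).length * (2 * ds.length + 14) + 3) := by
  refine ((Runs.pour (by simp) (by simpa using hx) s).seq
    (Runs.pour hd (by simpa [h22] using hx.symm) _)).cast ?_ ?_
  · rw [List.nodup_cons] at hd
    funext r
    by_cases h1 : r = 22
    · subst h1; simp [h22, hs]
    · by_cases h2 : r = x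
      · subst h2; simp [hd.1, hx, Ne.symm hx, hs]
      · by_cases h3 : r ∈ ds <;> simp [h1, h2, h3, hs, Ne.symm hx]
  · simp [hs, Ne.symm hx]
    nlinarith

/-- Move the contents of register `x`, the most significant bit being on top, to register `d`,
dropping leading zeros. -/
def normPour (x d : ℕ) : Prog :=
  .loop x (readBit x fun b =>
    if b then .push d true else .branch d .nop (.push d false) (.push d false))

/-- A `0` is not pushed on an empty register, since `Nat.bits` has no leading zeros and the number 0
must stay the empty word. -/
theorem Runs.shiftIn {R : Resource} {d : ℕ} (b : Bool) {s : Store} {v : ℕ} (hd : s d = v.bits) :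
    Runs R (if b then .push d true else .branch d .nop (.push d false) (.push d false)) s
      (Function.update s d (b.toNat + 2 * v).bits) 2 := by
  rw [bits_two_mul_add]
  cases b
  · by_cases hv : v = 0
    · have hd' : s d = [] := by simp [hd, hv]
      refine (Runs.branch_nil hd' Runs.nop).cast ?_ (by omega)
      simp [hv, ← hd']
    · refine (Runs.branch_cons (by simp [hd, bits_eq_nil, hv]) (Runs.push d false)).cast ?_
        (by omega)
      simp [hv, hd]
  · refine (Runs.push d true).cast ?_ (by omega)
    simp [hd]

/-- The digits arrive with the most significant one first, and each replaces the accumulated value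
`v` by `b + 2 * v`. Starting from an empty target this yields the canonical digits of the number. -/
theorem Runs.normPour {R : Resource} {x d : ℕ} (hxd : x ≠ d) {s : Store} {v : ℕ}
    (hd : s d = v.bits) :
    Runs R (RCI.normPour x d) s
      (Function.update (Function.update s x []) d
        (val (s x).reverse + 2 ^ (s x).length * v).bits)
      ((s x).length * 6 + 1) := by
  generalize hl : s x = l
  induction l generalizing s v with
  | nil =>
    refine (Runs.loop_nil hl).cast ?_ (by omega)
    have : Function.update s x [] = s := by rw [← hl, Function.update_eq_self]
    simp [this, val, ← hd]
  | cons b l ih =>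
    have h1 := Runs.readBit (R := R) (r := x)
      (k := fun b => if b then .push d true else .branch d .nop (.push d false) (.push d false))
      (Runs.shiftIn ((s x).headD false) (s := Function.update s x (s x).tail) (v := v)
        (by simpa [hxd.symm] using hd))
    refine (Runs.loop_cons (by simp [hl]) h1 (ih (v := b.toNat + 2 * v) ?_ ?_)).cast ?_ ?_
    · simp [hl]
    · simp [hl, hxd]
    · have : val (b :: l).reverse + 2 ^ (b :: l).length * v
          = val l.reverse + 2 ^ l.length * (b.toNat + 2 * v) := by
        rw [List.reverse_cons, val_append]; simp [val, pow_succ]; ring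
      rw [this]
      funext r
      by_cases h1 : r = d
      · subst h1; simp
      · by_cases h2 : r = x <;> simp [h1, h2, hxd]
    · simp only [List.length_cons]; omega

/-- The registers `22`, `23`, … are empty; they are used as scratch memory. -/
def Clean (s : Store) : Prop := ∀ r, 22 ≤ r → s r = []

theorem Clean.update {s : Store} (h : Clean s) {d : ℕ} (hd : d < 22) (l : List Bool) :
    Clean (Function.update s d l) := fun r hr => by
  rw [Function.update_of_ne (by omega)]; exact h r hr

/-- All registers have length at most `M`. -/
def Small (M : ℕ) (s : Store) : Prop := ∀ r, (s r).length ≤ M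

theorem Small.update {M : ℕ} {s : Store} (h : Small M s) {d : ℕ} {l : List Bool}
    (hl : l.length ≤ M) : Small M (Function.update s d l) := fun r => by
  by_cases hr : r = d
  · subst hr; simpa using hl
  · simpa [hr] using h r

/-- The digitwise evaluation of registers `23` and `24` with carry `27`; register `25` counts the
digits and register `26` receives the result. -/
def rippleProg (f : Bool → Bool → Bool → Bool × Bool) : Prog :=
  .loop 25 (.seq (.pop 25) (readBit 23 fun x => readBit 24 fun y => readBit 27 fun z =>
    .seq (.push 26 (f x y z).1) (.push 27 (f x y z).2)))

/-- Digits are read from the least significant end and pushed one after another, so the result is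
reversed, which is the order that `normPour` expects. -/
theorem Runs.rippleProg {R : Resource} (f : Bool → Bool → Bool → Bool × Bool) {s : Store} {z : Bool}
    (hz : s 27 = [z]) :
    Runs R (RCI.rippleProg f) s
      (fun r => if r = 23 then (s 23).drop (s 25).length else if r = 24 then
        (s 24).drop (s 25).length else if r = 25 then [] else if r = 26 then
        (ripple f (s 25).length (s 23) (s 24) z).1.reverse ++ s 26 else if r = 27 then
        [(ripple f (s 25).length (s 23) (s 24) z).2] else s r)
      ((s 25).length * 16 + 1) := by
  generalize hl : s 25 = l
  induction l generalizing s z with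
  | nil =>
    refine (Runs.loop_nil hl).cast ?_ (by omega)
    funext r
    simp only [List.length_nil, List.drop_zero, ripple, List.reverse_nil, List.nil_append]
    split_ifs <;> simp_all
  | cons b l ih =>
    set o := f ((s 23).headD false) ((s 24).headD false) z with ho
    set s₁ : Store := fun r => if r = 23 then (s 23).tail else if r = 24 then (s 24).tail else
      if r = 25 then l else if r = 26 then o.1 :: s 26 else if r = 27 then [o.2] else s r with hs1
    have hbody : Runs R (.seq (.pop 25) (RCI.readBit 23 fun x => RCI.readBit 24 fun y =>
        RCI.readBit 27 fun z => .seq (.push 26 (f x y z).1) (.push 27 (f x y z).2))) s s₁ 14 := by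
      refine ((Runs.pop 25).seq (Runs.readBit (Runs.readBit
        (Runs.readBit ((Runs.push _ _).seq (Runs.push _ _)))))).cast ?_ (by omega)
      funext r
      simp only [hs1, ho]
      by_cases h23 : r = 23
      · subst h23; simp
      by_cases h24 : r = 24
      · subst h24; simp
      by_cases h25 : r = 25
      · subst h25; simp [hl]
      by_cases h26 : r = 26
      · subst h26; simp [hz]
      by_cases h27 : r = 27
      · subst h27; simp [hz]
      simp [h23, h24, h25, h26, h27]
    refine (Runs.loop_cons (by simp [hl]) hbody (ih (s := s₁) (z := o.2) (by simp [hs1])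
      (by simp [hs1]))).cast ?_ (by simp only [List.length_cons]; omega)
    funext r
    simp only [List.length_cons, ripple, ← ho, hs1]
    split_ifs <;> simp_all

/-- The result of adding or subtracting registers `x` and `y` is stored in register `d`. -/
def arith (f : Bool → Bool → Bool → Bool × Bool) (d x y : ℕ) : Prog :=
  .seq (copy x [23, 25]) (.seq (copy y [24, 25]) (.seq (.push 25 true) (.seq (.push 27 false)
    (.seq (rippleProg f) (.seq (.branch 27 .nop .nop (clear 26)) (.seq (.pop 27)
      (.seq (clear d) (normPour 26 d))))))))

/-- The result is discarded when a carry remains, which turns subtraction into truncated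
subtraction. The target `29` is allowed because multiplication accumulates there; accordingly only
registers `22` to `27` have to be empty. -/
theorem Runs.arith {R : Resource} (f : Bool → Bool → Bool → Bool × Bool) {d x y v M : ℕ}
    (hd : d < 22 ∨ d = 29) (hx : x < 22 ∨ 28 ≤ x) (hy : y < 22 ∨ 28 ≤ y) {s : Store}
    (hs : ∀ r, 22 ≤ r → r ≤ 27 → s r = []) (hM : Small M s)
    (hv : v = let o := ripple f ((s x).length + (s y).length + 1) (s x) (s y) false
      if o.2 then 0 else val o.1) :
    Runs R (RCI.arith f d x y) s (Function.update s d v.bits) (120 * M + 120) := by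
  -- Enough digits for the sum of the two numbers, so addition ends without a carry and only a
  -- subtraction can end with one. The counter in register `25` is made of copies of both operands
  -- and one extra bit; only its length matters.
  set m := (s x).length + (s y).length + 1 with hm
  set o := ripple f m (s x) (s y) false with ho
  have h1 := Runs.copy (R := R) (x := x) (ds := [23, 25]) (by omega) (by simp; omega) (by simp)
    (s := s) (hs 22 (by omega) (by omega))
  set s₁ : Store := fun r => if r ∈ [23, 25] then s x ++ s r else s r with hs1
  have h2 := Runs.copy (R := R) (x := y) (ds := [24, 25]) (by omega) (by simp; omega) (by simp)
    (s := s₁) (by simp [hs1, hs 22])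
  set s₂ : Store := fun r => if r ∈ [24, 25] then s₁ y ++ s₁ r else s₁ r with hs2
  have h3 := Runs.push (R := R) (s := s₂) 25 true
  set s₃ : Store := Function.update s₂ 25 (true :: s₂ 25) with hs3
  have h4 := Runs.push (R := R) (s := s₃) 27 false
  set s₄ : Store := Function.update s₃ 27 (false :: s₃ 27) with hs4
  have e1y : s₁ y = s y := by
    have : y ≠ 23 ∧ y ≠ 25 := by omega
    simp [hs1, this]
  have e23 : s₄ 23 = s x := by simp [hs4, hs3, hs2, hs1, hs 23]
  have e24 : s₄ 24 = s y := by
    simp [hs4, hs3, hs2, e1y]; simp [hs1, hs 24]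
  have e25 : (s₄ 25).length = m := by
    simp [hs4, hs3, hs2, e1y]; simp [hs1, hs 25, hm]; omega
  have e26 : s₄ 26 = [] := by simp [hs4, hs3, hs2, hs1, hs 26]
  have e27 : s₄ 27 = [false] := by simp [hs4, hs3, hs2, hs1, hs 27]
  have h5 := Runs.rippleProg (R := R) f (s := s₄) e27
  rw [e23, e24, e25, e26, ← ho] at h5
  set s₅ : Store := fun r => if r = 23 then (s x).drop m else if r = 24 then (s y).drop m else
    if r = 25 then [] else if r = 26 then o.1.reverse ++ [] else if r = 27 then [o.2]
    else s₄ r with hs5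
  have h6 : Runs R (.branch 27 .nop .nop (RCI.clear 26)) s₅
      (Function.update s₅ 26 (if o.2 then [] else o.1.reverse)) (5 * m + 2) := by
    cases ho2 : o.2
    · refine (Runs.branch_false (l := []) (by simp [hs5, ho2]) Runs.nop).cast ?_ (by omega)
      simp [hs5]
    · refine (Runs.branch_true (l := []) (by simp [hs5, ho2]) (Runs.clear 26 s₅)).cast ?_ ?_
      · simp
      · have : o.1.length = m := ripple_length _ _ _ _ _
        simp [hs5, this]
  set s₆ := Function.update s₅ 26 (if o.2 then [] else o.1.reverse) with hs6
  have h7 := Runs.pop (R := R) (s := s₆) 27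
  set s₇ := Function.update s₆ 27 (s₆ 27).tail with hs7
  have h8 := Runs.clear (R := R) d s₇
  set s₈ := Function.update s₇ d [] with hs8
  have h9 := Runs.normPour (R := R) (x := 26) (d := d) (by omega) (s := s₈) (v := 0)
    (by simp [hs8])
  have hd26 : (26 : ℕ) ≠ d := by omega
  have o4 : ∀ r, ¬(23 ≤ r ∧ r ≤ 27) → s₄ r = s r := by
    intro r hr
    have : r ≠ 23 ∧ r ≠ 24 ∧ r ≠ 25 ∧ r ≠ 27 := by omega
    simp [hs4, hs3, hs2, hs1, this]
  have o7 : ∀ r, ¬(23 ≤ r ∧ r ≤ 27) → s₇ r = s r := by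
    intro r hr
    have : r ≠ 23 ∧ r ≠ 24 ∧ r ≠ 25 ∧ r ≠ 26 ∧ r ≠ 27 := by omega
    simp [hs7, hs6, hs5, this, o4 r hr]
  have z7 : ∀ r, 23 ≤ r → r ≤ 27 → r ≠ 26 → s₇ r = [] := by
    intro r h1 h2 h3
    obtain rfl | rfl | rfl | rfl : r = 23 ∨ r = 24 ∨ r = 25 ∨ r = 27 := by omega
    · simp [hs7, hs6, hs5, hm]; omega
    · simp [hs7, hs6, hs5, hm]; omega
    · simp [hs7, hs6, hs5]
    · simp [hs7, hs6, hs5]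
  have f26 : s₈ 26 = if o.2 then [] else o.1.reverse := by
    simp [hs8, hs7, hs6, hd26]
  have l26 : (s₈ 26).length ≤ m := by
    rw [f26]; split_ifs
    · simp
    · simpa using (ripple_length f m (s x) (s y) false).le
  refine (h1.seq (h2.seq (h3.seq (h4.seq (h5.seq (h6.seq (h7.seq (h8.seq h9)))))))).cast ?_ ?_
  · have hv' : v = val (s₈ 26).reverse := by
      rw [hv, f26]; cases h : o.2 <;> simp [val, h]
    rw [hv', mul_zero, add_zero]
    funext r
    by_cases hr : r = d
    · subst hr; simp
    · rw [Function.update_of_ne hr, Function.update_of_ne hr]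
      by_cases hr26 : r = 26
      · subst hr26; rw [hs 26 (by omega) (by omega)]; simp
      · rw [Function.update_of_ne hr26, hs8, Function.update_of_ne hr]
        by_cases hr2 : 23 ≤ r ∧ r ≤ 27
        · rw [z7 r hr2.1 hr2.2 hr26, hs r (by omega) hr2.2]
        · exact o7 r hr2
  · have := hM x
    have := hM y
    have : (s₇ d).length ≤ M := by rw [o7 d (by omega)]; exact hM d
    simp only [List.length_cons, List.length_nil, e1y]
    generalize (s₈ 26).length = L at *
    generalize (s₇ d).length = L' at *
    omega

/-- Truncated subtraction. -/
def subProg (d x y : ℕ) : Prog := arith subDigit d x y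

/-- Addition. -/
def addProg (d x y : ℕ) : Prog := arith addDigit d x y

theorem val_lt_two_pow {l : List Bool} {m : ℕ} (h : l.length ≤ m) : val l < 2 ^ m :=
  (val_lt l).trans_le (Nat.pow_le_pow_right (by omega) h)

theorem Runs.subProg {R : Resource} {d x y M : ℕ}
    (hd : d < 22 ∨ d = 29) (hx : x < 22 ∨ 28 ≤ x) (hy : y < 22 ∨ 28 ≤ y) {s : Store}
    (hs : ∀ r, 22 ≤ r → r ≤ 27 → s r = []) (hM : Small M s) :
    Runs R (RCI.subProg d x y) s (Function.update s d (val (s x) - val (s y)).bits)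
      (120 * M + 120) := by
  refine Runs.arith subDigit hd hx hy hs hM ?_
  set m := (s x).length + (s y).length + 1 with hm
  have h := ripple_sub m (s x) (s y) false (val_lt_two_pow (by omega)) (val_lt_two_pow (by omega))
  have h1 := val_lt (ripple subDigit m (s x) (s y) false).1
  rw [ripple_length] at h1
  have h2 : val (s x) < 2 ^ m := val_lt_two_pow (by omega)
  simp only []
  split_ifs with hb <;> simp [hb] at h <;> omega

theorem Runs.addProg {R : Resource} {d x y M : ℕ}
    (hd : d < 22 ∨ d = 29) (hx : x < 22 ∨ 28 ≤ x) (hy : y < 22 ∨ 28 ≤ y) {s : Store}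
    (hs : ∀ r, 22 ≤ r → r ≤ 27 → s r = []) (hM : Small M s) :
    Runs R (RCI.addProg d x y) s (Function.update s d (val (s x) + val (s y)).bits)
      (120 * M + 120) := by
  refine Runs.arith addDigit hd hx hy hs hM ?_
  set m := (s x).length + (s y).length + 1 with hm
  have h := ripple_add m (s x) (s y) false (val_lt_two_pow (by omega)) (val_lt_two_pow (by omega))
  have h1 : val (s x) < 2 ^ ((s x).length + (s y).length) := val_lt_two_pow (by omega)
  have h2 : val (s y) < 2 ^ ((s x).length + (s y).length) := val_lt_two_pow (by omega)
  have h3 : 2 ^ m = 2 * 2 ^ ((s x).length + (s y).length) := by rw [hm, pow_succ, mul_comm]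
  simp only []
  split_ifs with hb <;> simp [hb] at h <;> omega

/-- Multiplication, by Horner's rule. -/
def mulProg (d x y : ℕ) : Prog :=
  .seq (copy x [29]) (.seq (pour 29 [28]) (.seq
    (.loop 28 (readBit 28 fun b =>
      .seq (.branch 29 .nop (.push 29 false) (.push 29 false))
        (if b then addProg 29 29 y else .nop)))
    (.seq (subProg d 29 30) (clear 29))))

/-- The number whose length is bounded in `hbound` is invariant under the loop and dominates every
intermediate accumulator. Hence a bound on the length of the final product serves for all rounds. -/
theorem Runs.hornerLoop {R : Resource} {y M v : ℕ} (hy : y < 22) {s : Store}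
    (hs : ∀ r, 22 ≤ r → r ≤ 27 → s r = []) (hM : Small M s) (hv : s 29 = v.bits)
    (hbound : (val (s 28).reverse * val (s y) + 2 ^ (s 28).length * v).bits.length ≤ M) :
    Runs R (.loop 28 (RCI.readBit 28 fun b =>
      .seq (.branch 29 .nop (.push 29 false) (.push 29 false))
        (if b then RCI.addProg 29 29 y else .nop))) s
      (Function.update (Function.update s 28 []) 29
        (val (s 28).reverse * val (s y) + 2 ^ (s 28).length * v).bits)
      ((s 28).length * (120 * M + 127) + 1) := by
  generalize hl : s 28 = l at hbound
  induction l generalizing s v with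
  | nil =>
    refine (Runs.loop_nil hl).cast ?_ (by omega)
    have : Function.update s 28 [] = s := by rw [← hl, Function.update_eq_self]
    simp [this, val, ← hv]
  | cons b l ih =>
    have hyne : y ≠ 28 ∧ y ≠ 29 := by omega
    have hval : val (b :: l).reverse * val (s y) + 2 ^ (b :: l).length * v
        = val l.reverse * val (s y) + 2 ^ l.length * (b.toNat * val (s y) + 2 * v) := by
      rw [List.reverse_cons, val_append]; simp [val, pow_succ]; ring
    rw [hval] at hbound ⊢
    have hle : b.toNat * val (s y) + 2 * v
        ≤ val l.reverse * val (s y) + 2 ^ l.length * (b.toNat * val (s y) + 2 * v) :=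
      le_add_left (Nat.le_mul_of_pos_left _ (by positivity))
    have hlen := (length_bits_mono hle).trans hbound
    have hlen2 : (2 * v).bits.length ≤ M :=
      (length_bits_mono (show 2 * v ≤ b.toNat * val (s y) + 2 * v by omega)).trans hlen
    set s₁ := Function.update s 28 l with hs1
    have hM1 : Small M s₁ := hM.update (by have := hM 28; rw [hl] at this; simp at this; omega)
    have h1 : Runs R (.branch 29 .nop (.push 29 false) (.push 29 false)) s₁
        (Function.update s₁ 29 (2 * v).bits) 2 := by
      simpa using Runs.shiftIn (R := R) (d := 29) false (s := s₁) (v := v) (by simpa [hs1] using hv)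
    set s₂ := Function.update s₁ 29 (2 * v).bits with hs2
    have hM2 : Small M s₂ := hM1.update hlen2
    have h2 : Runs R (if b then RCI.addProg 29 29 y else .nop) s₂
        (Function.update s₂ 29 (b.toNat * val (s y) + 2 * v).bits) (120 * M + 120) := by
      cases b
      · refine Runs.nop.cast ?_ (by omega)
        simp [hs2]
      · refine (Runs.addProg (R := R) (d := 29) (x := 29) (y := y) (by omega) (by omega) (by omega)
          (s := s₂) ?_ hM2).cast ?_ le_rfl
        · intro r hr hr'
          have : r ≠ 28 ∧ r ≠ 29 := by omega
          simpa [hs2, hs1, this] using hs r hr hr'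
        · simp [hs2, hs1, hyne, val_bits, add_comm]
    have hb := Runs.readBit (R := R) (r := 28) (k := fun b =>
      .seq (.branch 29 .nop (.push 29 false) (.push 29 false))
        (if b then RCI.addProg 29 29 y else .nop)) (s := s)
      (s' := Function.update s₂ 29 (b.toNat * val (s y) + 2 * v).bits)
      (B := 2 + (120 * M + 120) + 1) (by simpa [hl] using h1.seq h2)
    refine (Runs.loop_cons (by simp [hl]) hb (ih (v := b.toNat * val (s y) + 2 * v)
      ?_ ?_ ?_ ?_ ?_)).cast ?_ ?_
    · intro r hr hr'
      have : r ≠ 28 ∧ r ≠ 29 := by omega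
      simpa [hs2, hs1, this] using hs r hr hr'
    · exact hM2.update hlen
    · simp
    · simp [hs2, hs1]
    · simpa [hs2, hs1, hyne] using hbound
    · simp only [hs2, hs1]
      funext r
      by_cases h1 : r = 29
      · subst h1; simp [hyne]
      · by_cases h2 : r = 28 <;> simp [h1, h2]
    · have := Nat.add_one_mul l.length (120 * M + 127)
      simp only [List.length_cons]; omega

theorem Runs.mulProg {R : Resource} {d x y M : ℕ} (hd : d < 22) (hx : x < 22) (hy : y < 22)
    {s : Store} (hs : Clean s) (hM : Small M s)
    (hb : (val (s x) * val (s y)).bits.length ≤ M) :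
    Runs R (RCI.mulProg d x y) s (Function.update s d (val (s x) * val (s y)).bits)
      (120 * M * M + 300 * M + 200) := by
  have h1 := Runs.copy (R := R) (x := x) (ds := [29]) (by omega) (by simp; omega) (by simp)
    (s := s) (hs 22 (by omega))
  set s₁ : Store := fun r => if r ∈ [29] then s x ++ s r else s r with hs1
  have h2 := Runs.pour (R := R) (src := 29) (ds := [28]) (by simp) (by simp) s₁
  set s₂ : Store := fun r => if r = 29 then [] else if r ∈ [28] then (s₁ 29).reverse ++ s₁ r
    else s₁ r with hs2
  have hne : ∀ r < 22, r ≠ 28 ∧ r ≠ 29 := by omega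
  have c29 : s₁ 29 = s x := by simp [hs1, hs 29]
  have c28 : s₂ 28 = (s x).reverse := by
    simp only [hs2, c29]; simp [hs1, hs 28]
  have cy : s₂ y = s y := by simp [hs2, hs1, hne y hy]
  have hM2 : Small M s₂ := by
    intro r
    by_cases h28 : r = 28
    · subst h28; rw [c28]; simpa using hM x
    · by_cases h29 : r = 29
      · subst h29; simp [hs2]
      · simpa [hs2, hs1, h28, h29] using hM r
  have hrest : ∀ r, r ≠ 28 → s₂ r = s r := by
    intro r h28
    by_cases h29 : r = 29
    · subst h29; simp [hs2, hs 29]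
    · simp [hs2, hs1, h28, h29]
  have h3 := Runs.hornerLoop (R := R) (y := y) (v := 0) hy (s := s₂)
    (fun r hr hr' => by rw [hrest r (by omega)]; exact hs r hr) hM2
    (by rw [hrest 29 (by omega), hs 29 (by omega)]; simp)
    (by simpa [c28, cy] using hb)
  simp only [c28, cy, List.reverse_reverse, mul_zero, add_zero, List.length_reverse] at h3
  set w := val (s x) * val (s y) with hw
  set s₃ := Function.update (Function.update s₂ 28 []) 29 w.bits with hs3
  have hM3 : Small M s₃ := (hM2.update (by simp)).update hb
  -- Register `30` is always empty and represents 0; subtracting it copies a number to another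
  -- register.
  have h4 := Runs.subProg (R := R) (d := d) (x := 29) (y := 30) (by omega) (by omega) (by omega)
    (s := s₃) (M := M) (fun r hr hr' => by
      have : r ≠ 28 ∧ r ≠ 29 := by omega
      simp only [hs3, ne_eq, this, not_false_eq_true, Function.update_of_ne]
      rw [hrest r this.1]; exact hs r hr) hM3
  have v30 : s₃ 30 = [] := by
    simp only [hs3]; simp [hrest 30, hs 30]
  have v29 : s₃ 29 = w.bits := by simp [hs3]
  rw [v30, v29, val_bits, val, Nat.sub_zero] at h4
  set s₄ := Function.update s₃ d w.bits with hs4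
  have h5 := Runs.clear (R := R) 29 s₄
  have v29' : s₄ 29 = w.bits := by simp [hs4, (hne d hd).2.symm, v29]
  refine (h1.seq (h2.seq (h3.seq (h4.seq h5)))).cast ?_ ?_
  · funext r
    by_cases hr : r = d
    · subst hr; simp [hs4, hne r hd]
    · by_cases h29 : r = 29
      · subst h29; simp [hr, hs 29]
      · by_cases h28 : r = 28
        · subst h28; simp [hs4, hs3, hr, hs 28]
        · simp [hs4, hs3, hr, h28, h29, hrest r h28]
  · rw [c29, v29']
    have h1 := hM x
    have h2 : (s x).length * (120 * M + 127) ≤ M * (120 * M + 127) := Nat.mul_le_mul_right _ h1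
    have h3 : M * (120 * M + 127) = 120 * M * M + 127 * M := by ring
    simp only [List.length_cons, List.length_nil]
    omega

/-! ## Subroutine calls -/

/-- Move all registers of a program up by `base`. -/
def Prog.shift (base : ℕ) : Prog → Prog
  | .nop => .nop
  | .push r b => .push (base + r) b
  | .pop r => .pop (base + r)
  | .flip r => .flip (base + r)
  | .seq p q => .seq (p.shift base) (q.shift base)
  | .branch r p q t => .branch (base + r) (p.shift base) (q.shift base) (t.shift base)
  | .loop r p => .loop (base + r) (p.shift base)

/-- All registers of the program are below this bound. -/
def Prog.regs : Prog → ℕ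
  | .nop => 0
  | .push r _ => r + 1
  | .pop r => r + 1
  | .flip r => r + 1
  | .seq p q => max p.regs q.regs
  | .branch r p q t => max (r + 1) (max p.regs (max q.regs t.regs))
  | .loop r p => max (r + 1) p.regs

theorem Prog.Deterministic.shift {p : Prog} (h : p.Deterministic) (base : ℕ) :
    (p.shift base).Deterministic := by
  induction p <;> simp_all [Prog.Deterministic, Prog.shift]

/-- The store that consists of the first `base` registers of `own`, followed by `s`. -/
def embed (base : ℕ) (own s : Store) : Store := fun r => if r < base then own r else s (r - base)

theorem embed_add (base : ℕ) (own s : Store) (r : ℕ) : embed base own s (base + r) = s r := by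
  simp [embed]

theorem update_embed (base : ℕ) (own s : Store) (r : ℕ) (l : List Bool) :
    Function.update (embed base own s) (base + r) l = embed base own (Function.update s r l) := by
  funext x
  by_cases h : x = base + r
  · subst h; simp [embed]
  · by_cases h2 : x < base
    · simp [h, embed, h2]
    · have : x - base ≠ r := by omega
      simp [h, embed, h2, this]

/-- Shifting registers commutes with execution. The caller's registers `own` and its continuation
`K₀` are carried along untouched, which makes subroutine calls possible. -/
theorem Prog.exec_shift (base : ℕ) (own s : Store) (b : Bool) (K K₀ : List Prog) (p : Prog) :
    (p.shift base).exec b (K.map (Prog.shift base) ++ K₀) (embed base own s)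
      = ((p.exec b K s).1.map (Prog.shift base) ++ K₀, embed base own (p.exec b K s).2) := by
  cases p with
  | branch r pe pf pt =>
    simp only [Prog.shift, Prog.exec, embed_add]
    rcases s r with _ | ⟨_ | _, _⟩ <;> simp
  | loop r p =>
    simp only [Prog.shift, Prog.exec, embed_add]
    rcases s r with _ | ⟨_, _⟩ <;> simp [Prog.shift]
  | _ => simp [Prog.shift, Prog.exec, embed_add, update_embed]

theorem Store.space_eq_sum {s : Store} {N : ℕ} (h : ∀ r, N ≤ r → s r = []) :
    s.space = ∑ r ∈ Finset.range N, (s r).length := by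
  refine finsum_eq_sum_of_support_subset _ fun r hr => ?_
  simp only [Function.mem_support, ne_eq, List.length_eq_zero_iff] at hr
  simp only [Finset.coe_range, Set.mem_Iio]
  by_contra hN
  exact hr (h r (by omega))

theorem space_embed {base N : ℕ} {own s : Store} (h : ∀ r, N ≤ r → s r = []) :
    (embed base own s).space = ∑ r ∈ Finset.range base, (own r).length + s.space := by
  rw [Store.space_eq_sum h, Store.space_eq_sum (N := base + N), Finset.sum_range_add]
  · congr 1
    · exact Finset.sum_congr rfl fun r hr => by
        simp only [Finset.mem_range] at hr; simp [embed, hr]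
    · simp [embed_add]
  · intro r hr
    simp only [embed, show ¬ r < base by omega, if_false]
    exact h _ (by omega)

theorem length_le_space {s : Store} {N : ℕ} (h : ∀ r, N ≤ r → s r = []) (r : ℕ) :
    (s r).length ≤ s.space := by
  by_cases hr : r < N
  · rw [Store.space_eq_sum h]
    exact Finset.single_le_sum (f := fun r => (s r).length) (fun _ _ => Nat.zero_le _)
      (Finset.mem_range.2 hr)
  · simp [h r (by omega)]

/-- The programs of `K` are deterministic and use the registers below `N` only. -/
def Local (N : ℕ) (K : List Prog) : Prop := ∀ p ∈ K, p.Deterministic ∧ p.regs ≤ N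

/-- The invariants of a subroutine: its coins are never looked at, its control stack stays within
the registers below `N`, and all later registers remain empty. The last one keeps the support
finite, so that the space of an embedded store splits as a sum. -/
theorem Local.exec {N : ℕ} {p : Prog} {K : List Prog} (h : Local N (p :: K)) (s : Store)
    (hs : ∀ r, N ≤ r → s r = []) (b : Bool) :
    p.exec b K s = p.exec false K s ∧ Local N (p.exec false K s).1 ∧
      ∀ r, N ≤ r → (p.exec false K s).2 r = [] := by
  have hp := h p (by simp)
  have hK : Local N K := fun q hq => h q (by simp [hq])
  have hupd : ∀ x, x + 1 ≤ N → ∀ l, ∀ r, N ≤ r → Function.update s x l r = [] := by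
    intro x hx l r hr
    rw [Function.update_of_ne (by omega)]; exact hs r hr
  have hcons : ∀ (q : Prog) K, q.Deterministic ∧ q.regs ≤ N → Local N K → Local N (q :: K) := by
    intro q K hq hK p' hp'
    rcases List.mem_cons.1 hp' with rfl | h
    · exact hq
    · exact hK _ h
  cases p with
  | nop => exact ⟨rfl, hK, hs⟩
  | push r x => exact ⟨rfl, hK, hupd _ (by simpa [Prog.regs] using hp.2) _⟩
  | pop r => exact ⟨rfl, hK, hupd _ (by simpa [Prog.regs] using hp.2) _⟩
  | flip r => exact absurd hp.1 (by simp [Prog.Deterministic])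
  | seq p q =>
    simp only [Prog.Deterministic, Prog.regs, max_le_iff] at hp
    exact ⟨rfl, hcons _ _ ⟨hp.1.1, hp.2.1⟩ (hcons _ _ ⟨hp.1.2, hp.2.2⟩ hK), hs⟩
  | branch r pe pf pt =>
    simp only [Prog.Deterministic, Prog.regs, max_le_iff] at hp
    obtain ⟨⟨h1, h2, h3⟩, -, h4, h5, h6⟩ := hp
    refine ⟨rfl, ?_⟩
    simp only [Prog.exec]
    rcases s r with _ | ⟨_ | _, _⟩
    · exact ⟨hcons _ _ ⟨h1, h4⟩ hK, hs⟩
    · exact ⟨hcons _ _ ⟨h2, h5⟩ hK, hs⟩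
    · exact ⟨hcons _ _ ⟨h3, h6⟩ hK, hs⟩
  | loop r p =>
    refine ⟨rfl, ?_⟩
    have hp' := hp
    simp only [Prog.Deterministic, Prog.regs, max_le_iff] at hp
    simp only [Prog.exec]
    rcases s r with _ | ⟨_, _⟩
    · exact ⟨hK, hs⟩
    · exact ⟨hcons _ _ ⟨hp.1, hp.2.2⟩ (hcons _ _ hp' hK), hs⟩

theorem Prog.space_exec_le (p : Prog) (b : Bool) (K : List Prog) (s : Store) :
    (p.exec b K s).2.space ≤ s.space + 1 := by
  cases p with
  | push r x => exact s.space_update_le _ _ _ (by simp)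
  | pop r => exact s.space_update_le _ _ _ (by simp; omega)
  | flip r => exact s.space_update_le _ _ _ (by simp)
  | branch r pe pf pt =>
    simp only [Prog.exec]
    rcases s r with _ | ⟨_ | _, _⟩ <;> simp
  | loop r p =>
    simp only [Prog.exec]
    rcases s r with _ | ⟨_, _⟩ <;> simp
  | _ => simp [Prog.exec]

theorem Cfg.peak_le_iterate (c : Cfg) (t : ℕ) : c.peak ≤ ((Cfg.step false)^[t] c).peak := by
  induction t generalizing c with
  | zero => exact le_rfl
  | succ t ih =>
    refine le_trans ?_ (ih (c.step false))
    unfold Cfg.step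
    split <;> simp

/-- The final `peak` bounds the space throughout, and the caller's registers add a constant. As each
step adds at most one bit, the peak also grows by at most the number of steps, which converts a time
bound into a space bound. -/
theorem Cfg.simulate {base N : ℕ} {own : Store} (K₀ : List Prog) (t : ℕ) :
    ∀ c : Cfg, Local N c.ctrl → (∀ r, N ≤ r → c.store r = []) → c.store.space ≤ c.peak →
      (∀ i < t, ((Cfg.step false)^[i] c).ctrl ≠ []) →
      let c' := (Cfg.step false)^[t] c
      DRun (∑ r ∈ Finset.range base, (own r).length + c'.peak) t
        (c.ctrl.map (Prog.shift base) ++ K₀) (embed base own c.store)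
        (c'.ctrl.map (Prog.shift base) ++ K₀) (embed base own c'.store) ∧
      c'.time = c.time + t ∧ c'.peak ≤ c.peak + t ∧ c'.store.space ≤ c'.peak ∧
      ∀ r, N ≤ r → c'.store r = [] := by
  induction t with
  | zero => intro c h1 h2 h3 _; exact ⟨.refl _ _, rfl, le_rfl, h3, h2⟩
  | succ t ih =>
    intro c h1 h2 h3 h4
    obtain ⟨ctrl, s, τ, pk⟩ := c
    have hne := h4 0 (by omega)
    rcases ctrl with _ | ⟨p, K⟩
    · exact absurd rfl hne
    have hx := h1.exec s h2
    set c₁ : Cfg := ⟨(p.exec false K s).1, (p.exec false K s).2, τ + 1,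
      max pk (Store.space (p.exec false K s).2)⟩ with hc1
    have hstep : Cfg.step false ⟨p :: K, s, τ, pk⟩ = c₁ := rfl
    have hle := p.space_exec_le false K s
    obtain ⟨g1, g2, g3, g4, g5⟩ := ih c₁ (hx false).2.1 (hx false).2.2 (le_max_right _ _)
      (fun i hi => by
        have := h4 (i + 1) (by omega)
        rwa [Function.iterate_succ_apply, hstep] at this)
    rw [Function.iterate_succ_apply, hstep]
    refine ⟨?_, ?_, ?_, g4, g5⟩
    · refine .step (K₁ := c₁.ctrl.map (Prog.shift base) ++ K₀) (s₁ := embed base own c₁.store)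
        (fun b => ?_) ?_ g1
      · have := Prog.exec_shift base own s b K K₀ p
        rw [(hx b).1] at this
        exact this
      · rw [space_embed (N := N) (hx false).2.2]
        have : (p.exec false K s).2.space ≤ c₁.peak := le_max_right _ _
        have := c₁.peak_le_iterate t
        omega
    · rw [g2]; simp [hc1]; omega
    · have : c₁.peak ≤ pk + 1 := by
        simp only [hc1, max_le_iff]
        exact ⟨by omega, hle.trans (Nat.add_le_add_right h3 1)⟩
      change _ ≤ pk + (t + 1)
      omega

theorem Cfg.iterate_halted {c : Cfg} (h : c.ctrl = []) (t : ℕ) : (Cfg.step false)^[t] c = c := by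
  induction t with
  | zero => rfl
  | succ t ih => rw [Function.iterate_succ_apply, show c.step false = c by simp [Cfg.step, h], ih]

theorem space_inputStore (l : List (List Bool)) : (inputStore l).space = inputSize l := by
  rw [Store.space_eq_sum (N := l.length)]
  · induction l with
    | nil => rfl
    | cons a l ih =>
      rw [List.length_cons, Finset.sum_range_succ']
      simp only [inputStore, List.getD_cons_succ, List.getD_cons_zero, inputSize, List.map_cons,
        List.sum_cons] at ih ⊢
      rw [ih, add_comm]
  · intro r hr
    simp [inputStore, hr]

theorem Runs.shift {R : Resource} {P : Prog} (hP : P.Deterministic) {N : ℕ} (hN : P.regs ≤ N)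
    {ins : List (List Bool)} (hins : ins.length ≤ N) {out : List Bool} {B : ℕ}
    (h : P.Computes R ins out B) (base : ℕ) (own : Store) :
    ∃ s' : Store, s' 0 = out ∧ (∀ r, N ≤ r → s' r = []) ∧ s'.space ≤ B + inputSize ins ∧
      Runs R (P.shift base) (embed base own (inputStore ins)) (embed base own s')
        (B + inputSize ins) := by
  classical
  obtain ⟨t, ⟨h1, h2⟩, h3⟩ := h
  set c := P.start ins with hc
  have hex : ∃ t, ((Cfg.step false)^[t] c).ctrl = [] := ⟨t, h1⟩
  -- `Computes` allows idle steps after halting, but the simulation stops matching once the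
  -- subroutine has halted and the caller continues; so the first halting time is used.
  set t₀ := Nat.find hex with ht0
  have hfin : ((Cfg.step false)^[t₀] c).ctrl = [] := Nat.find_spec hex
  have heq : (Cfg.step false)^[t] c = (Cfg.step false)^[t₀] c := by
    obtain ⟨d, hd⟩ := Nat.exists_eq_add_of_le (Nat.find_min' hex h1)
    rw [hd, add_comm, Function.iterate_add_apply, Cfg.iterate_halted hfin]
  have hin : ∀ r, N ≤ r → inputStore ins r = [] := by
    intro r hr; simp [inputStore, show ins.length ≤ r by omega]
  have hsp : c.peak = inputSize ins := by simp [hc, Prog.start, space_inputStore]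
  have hsim := fun K₀ => Cfg.simulate (base := base) (N := N) (own := own) K₀ t₀ c
    (by intro p hp; simp only [hc, Prog.start, List.mem_singleton] at hp; subst hp; exact ⟨hP, hN⟩)
    hin le_rfl (fun i hi => Nat.find_min hex hi)
  simp only [hfin, List.map_nil, List.nil_append] at hsim
  rw [heq] at h2 h3
  obtain ⟨-, g2, g3, g4, g5⟩ := hsim []
  have htime : c.time = 0 := rfl
  rw [htime, zero_add] at g2
  -- For space this is the assumption itself; for time it holds because the peak exceeds the input
  -- size by at most the number of steps.
  have hpk : ((Cfg.step false)^[t₀] c).peak ≤ B + inputSize ins := by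
    cases R <;> simp only [Cfg.cost] at h3 <;> omega
  refine ⟨((Cfg.step false)^[t₀] c).store, h2, g5, g4.trans hpk, t₀, ?_, ?_, fun K => ?_⟩
  · rintro rfl; simp only [Cfg.cost] at h3; omega
  · rw [space_embed g5, space_embed hin]; omega
  · refine ((hsim K).1).mono ?_
    rw [space_embed hin]; omega

/-- Empty the registers `a, …, a + n - 1`. -/
def clearRange (a : ℕ) : ℕ → Prog
  | 0 => .nop
  | n + 1 => .seq (clear a) (clearRange (a + 1) n)

theorem Runs.clearRange {R : Resource} (n : ℕ) : ∀ (a : ℕ) (s : Store) (L : ℕ),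
    (∀ r, a ≤ r → (s r).length ≤ L) →
    Runs R (RCI.clearRange a n) s (fun r => if a ≤ r ∧ r < a + n then [] else s r)
      (n * (5 * L + 2) + 1) := by
  induction n with
  | zero =>
    intro a s L _
    refine Runs.nop.cast ?_ (by omega)
    funext r
    simp
  | succ n ih =>
    intro a s L hL
    refine ((Runs.clear a s).seq (ih (a + 1) _ L ?_)).cast ?_ ?_
    · intro r hr
      rw [Function.update_of_ne (by omega)]
      exact hL r (by omega)
    · funext r
      by_cases h : r = a
      · subst h; simp
      · have : (a + 1 ≤ r ∧ r < a + 1 + n) ↔ (a ≤ r ∧ r < a + (n + 1)) := by omega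
        simp only [Function.update_of_ne h, this]
    · have := hL a le_rfl
      have := Nat.add_one_mul n (5 * L + 2)
      omega

/-- The number of registers to be cleared after a call of `P`. -/
def Prog.room (P : Prog) : ℕ := P.regs + 3

/-- Run `P` in the registers from `31` on and clear them except for the output. -/
def callProg (P : Prog) : Prog := .seq (P.shift 31) (clearRange 32 P.room)

/-- The cost of a call, in terms of the cost of the subroutine including the input size. -/
def callCost (P : Prog) (B : ℕ) : ℕ := B + P.room * (5 * B + 2) + 2

/-- The subroutine leaves only registers below `P.room` dirty. The summand 3 in `Prog.room` covers
inputs in registers that `P` does not mention. Clearing starts at register `32`, so the output in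
register `31` survives. -/
theorem Runs.call {R : Resource} {P : Prog} (hP : P.Deterministic)
    {ins : List (List Bool)} (hins : ins.length ≤ 3) {out : List Bool} {B : ℕ}
    (h : P.Computes R ins out B) (own : Store) :
    Runs R (callProg P) (embed 31 own (inputStore ins)) (embed 31 own (inputStore [out]))
      (callCost P (B + inputSize ins)) := by
  obtain ⟨s', h1, h2, h3, h4⟩ := Runs.shift hP (N := P.room) (by unfold Prog.room; omega)
    (by unfold Prog.room; omega) h 31 own
  refine (h4.seq (Runs.clearRange P.room 32 _ (B + inputSize ins) ?_)).cast ?_ ?_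
  · intro r hr
    simp only [embed, show ¬ r < 31 by omega, if_false]
    exact (length_le_space h2 _).trans h3
  · funext r
    by_cases hr : r < 31
    · simp [embed, hr, show ¬ 32 ≤ r by omega]
    · by_cases hr' : r = 31
      · subst hr'; simp [embed, inputStore, h1]
      · have h0 : inputStore [out] (r - 31) = [] := by
          obtain ⟨x, hx⟩ : ∃ x, r - 31 = x + 1 := ⟨r - 32, by omega⟩
          rw [hx]; simp [inputStore]
        by_cases hr2 : r < 32 + P.room
        · simp [hr2, embed, hr, h0, show 32 ≤ r by omega]
        · simp [hr2, embed, hr, h0, h2 (r - 31) (by omega)]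
  · unfold callCost; omega

theorem length_output_le {R : Resource} {P : Prog} (hP : P.Deterministic)
    {ins : List (List Bool)} (hins : ins.length ≤ 3) {out : List Bool} {B : ℕ}
    (h : P.Computes R ins out B) : out.length ≤ B + inputSize ins := by
  obtain ⟨s', rfl, h2, h3, -⟩ := Runs.shift hP (N := P.room) (by unfold Prog.room; omega)
    (by unfold Prog.room; omega) h 31 (fun _ => [])
  exact (length_le_space h2 _).trans h3

/-! ## Calls of the intersection and width algorithms -/

/-- Move the output of a subroutine to register `d`. -/
def fetch (d : ℕ) : Prog := .seq (pour 31 [22]) (.seq (clear d) (pour 22 [d]))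

theorem Runs.fetch {R : Resource} {d M : ℕ} (hd : d < 22) {s : Store} (hs : Clean s)
    (hM : Small M s) (out : List Bool) (hout : out.length ≤ M) :
    Runs R (RCI.fetch d) (embed 31 s (inputStore [out])) (Function.update s d out)
      (19 * M + 5) := by
  set s₀ := embed 31 s (inputStore [out]) with hs0
  have h1 := Runs.pour (R := R) (src := 31) (ds := [22]) (by simp) (by simp) s₀
  set s₁ : Store := fun r => if r = 31 then [] else if r ∈ [22] then (s₀ 31).reverse ++ s₀ r
    else s₀ r with hs1
  have h2 := Runs.clear (R := R) d s₁
  set s₂ := Function.update s₁ d [] with hs2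
  have h3 := Runs.pour (R := R) (src := 22) (ds := [d]) (by simp) (by simp; omega) s₂
  have e31 : s₀ 31 = out := by simp [hs0, embed, inputStore]
  have e1 : ∀ r, r ≠ 22 → s₁ r = s r := by
    intro r hr
    by_cases h31 : r = 31
    · subst h31; simp [hs1, hs 31]
    · by_cases hlt : r < 31
      · simp [hs1, h31, hr, hs0, embed, hlt]
      · obtain ⟨x, hx⟩ : ∃ x, r = 31 + (x + 1) := ⟨r - 32, by omega⟩
        rw [hs r (by omega)]
        simp [hs1, hx, hs0, embed_add, inputStore, show 31 + (x + 1) ≠ 22 by omega]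
  have e22 : s₁ 22 = out.reverse := by
    simp only [hs1, e31]; simp [hs0, embed, hs 22]
  have e22' : s₂ 22 = out.reverse := by
    rw [hs2, Function.update_of_ne (by omega), e22]
  refine (h1.seq (h2.seq h3)).cast ?_ ?_
  · funext r
    rw [e22']
    by_cases h22 : r = 22
    · subst h22; simp [hs 22, show (22 : ℕ) ≠ d by omega]
    · by_cases hr : r = d
      · subst hr; simp [h22, hs2]
      · simp [h22, hr, hs2, e1 r h22]
  · have := hM d
    rw [e31, e22', e1 d (by omega)]
    simp only [List.length_cons, List.length_nil, List.length_reverse]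
    omega

/-- Store the intersection of the specifications in registers `7` and `1` in register `8`. -/
def interProg (P : Prog) : Prog :=
  .seq (copy 7 [31]) (.seq (copy 1 [32]) (.seq (callProg P) (fetch 8)))

theorem Runs.interProg {R : Resource} {P : Prog} (hP : P.Deterministic) {s : Store} {M B : ℕ}
    (hs : Clean s) (hM : Small M s) {out : List Bool}
    (h : P.Computes R [s 7, s 1] out B) (hB : B + inputSize [s 7, s 1] ≤ M) :
    Runs R (RCI.interProg P) s (Function.update s 8 out) (callCost P M + 51 * M + 20) := by
  have hout := (length_output_le hP (by simp) h).trans hB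
  have h1 := Runs.copy (R := R) (x := 7) (ds := [31]) (by omega) (by simp) (by simp) (s := s)
    (hs 22 (by omega))
  set s₁ : Store := fun r => if r ∈ [31] then s 7 ++ s r else s r with hs1
  have h2 := Runs.copy (R := R) (x := 1) (ds := [32]) (by omega) (by simp) (by simp) (s := s₁)
    (by simp [hs1, hs 22])
  have e : (fun r => if r ∈ [32] then s₁ 1 ++ s₁ r else s₁ r)
      = embed 31 s (inputStore [s 7, s 1]) := by
    funext r
    by_cases hlt : r < 31
    · simp [embed, hlt, hs1, show r ≠ 31 by omega, show r ≠ 32 by omega]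
    · obtain ⟨x, rfl⟩ : ∃ x, r = 31 + x := ⟨r - 31, by omega⟩
      have := hs (31 + x) (by omega)
      rcases x with _ | _ | x
      · simp [embed, inputStore, hs1, hs 31]
      · simp [embed, inputStore, hs1, hs 32]
      · simp [embed_add, inputStore, hs1, this, show 31 + (x + 1 + 1) ≠ 32 by omega]
  rw [e] at h2
  refine (h1.seq (h2.seq ((Runs.call hP (by simp) h s).seq
    (Runs.fetch (by omega) hs hM out hout)))).cast rfl ?_
  have := hM 7
  have := hM 1
  have : s₁ 1 = s 1 := by simp [hs1]
  rw [this]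
  have : callCost P (B + inputSize [s 7, s 1]) ≤ callCost P M := by
    unfold callCost
    have := Nat.mul_le_mul_left P.room (show 5 * (B + inputSize [s 7, s 1]) + 2 ≤ 5 * M + 2 by omega)
    omega
  simp only [List.length_cons, List.length_nil]
  omega

/-- Prepare the history that consists of the current one and the current letter as third input of
a subroutine. The code of the current history is stored in register `9` in reverse order, and the
number of the current letter is stored in register `10` in unary. -/
def prepLetter : Prog :=
  .seq (.push 33 false) (.seq (copy 10 [33]) (.seq (pour 9 [22, 33]) (pour 22 [9])))

/-- The history is kept reversed so that a letter is appended to it by pushing. One pour puts it in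
the right order in front of the letter's code and leaves a copy in register `22`, which a second
pour reverses back into register `9`. -/
theorem Runs.prepLetter {R : Resource} {s : Store} {M : ℕ} (hs : Clean s) (hM : Small M s) :
    Runs R RCI.prepLetter s
      (Function.update s 33 ((s 9).reverse ++ s 10 ++ [false])) (32 * M + 20) := by
  have h1 := Runs.push (R := R) (s := s) 33 false
  set s₁ := Function.update s 33 (false :: s 33) with hs1
  have h2 := Runs.copy (R := R) (x := 10) (ds := [33]) (by omega) (by simp) (by simp) (s := s₁)
    (by simp [hs1, hs 22])
  set s₂ : Store := fun r => if r ∈ [33] then s₁ 10 ++ s₁ r else s₁ r with hs2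
  have h3 := Runs.pour (R := R) (src := 9) (ds := [22, 33]) (by simp) (by simp) s₂
  set s₃ : Store := fun r => if r = 9 then [] else if r ∈ [22, 33] then (s₂ 9).reverse ++ s₂ r
    else s₂ r with hs3
  have h4 := Runs.pour (R := R) (src := 22) (ds := [9]) (by simp) (by simp) s₃
  have e10 : s₁ 10 = s 10 := by simp [hs1]
  have e9 : s₂ 9 = s 9 := by simp [hs2, hs1]
  have e22 : s₃ 22 = (s 9).reverse := by
    simp only [hs3, e9]; simp [hs2, hs1, hs 22]
  refine (h1.seq (h2.seq (h3.seq h4))).cast ?_ ?_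
  · funext r
    rw [e22]
    simp only [hs3, e9]
    by_cases h22 : r = 22
    · subst h22; simp [hs 22]
    by_cases h9 : r = 9
    · subst h9; simp
    by_cases h33 : r = 33
    · subst h33; simp [hs2, hs1, hs 33]
    · simp [h22, h9, h33, hs2, hs1]
  · have := hM 10
    have := hM 9
    rw [e22, e10, e9]
    simp only [List.length_cons, List.length_nil, List.length_reverse]
    omega

/-- Compute the width for the specification in register `spec`, the length in register `2` and the
history prepared by `prep`, multiply it with the contents of register `5` and store the result in
register `19`. -/
def capProg (P prep : Prog) (spec : ℕ) : Prog :=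
  .seq prep (.seq (copy spec [31]) (.seq (copy 2 [32]) (.seq (callProg P)
    (.seq (fetch 19) (mulProg 19 5 19)))))

/-- The history enters through `prep` only, so the same program serves for the empty history (with
`nop`) and for the history extended by the current letter (with `prepLetter`). -/
theorem Runs.capProg {R : Resource} {P prep : Prog} (hP : P.Deterministic) {spec : ℕ}
    (hspec : spec < 22) {s : Store} {M B C W : ℕ} {hist : List Bool}
    (hs : Clean s) (hM : Small M s) (hprep : Runs R prep s (Function.update s 33 hist) C)
    (h : P.Computes R [s spec, s 2, hist] W.bits B)
    (hB : B + inputSize [s spec, s 2, hist] ≤ M)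
    (hW : (val (s 5) * W).bits.length ≤ M) :
    Runs R (RCI.capProg P prep spec) s (Function.update s 19 (val (s 5) * W).bits)
      (C + callCost P M + 120 * M * M + 351 * M + 230) := by
  have hout := (length_output_le hP (by simp) h).trans hB
  set s₀ := Function.update s 33 hist with hs0
  have h1 := Runs.copy (R := R) (x := spec) (ds := [31]) (by omega) (by simp; omega) (by simp)
    (s := s₀) (by simp [hs0, hs 22])
  set s₁ : Store := fun r => if r ∈ [31] then s₀ spec ++ s₀ r else s₀ r with hs1
  have h2 := Runs.copy (R := R) (x := 2) (ds := [32]) (by omega) (by simp) (by simp) (s := s₁)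
    (by simp [hs1, hs0, hs 22])
  have espec : s₀ spec = s spec := by simp [hs0, show spec ≠ 33 by omega]
  have e2 : s₁ 2 = s 2 := by simp [hs1, hs0]
  have e : (fun r => if r ∈ [32] then s₁ 2 ++ s₁ r else s₁ r)
      = embed 31 s (inputStore [s spec, s 2, hist]) := by
    funext r
    rw [e2]
    by_cases hlt : r < 31
    · simp [embed, hlt, hs1, hs0, show r ≠ 31 by omega, show r ≠ 32 by omega,
        show r ≠ 33 by omega]
    · obtain ⟨x, rfl⟩ : ∃ x, r = 31 + x := ⟨r - 31, by omega⟩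
      have := hs (31 + x) (by omega)
      rcases x with _ | _ | _ | x
      · simp only [hs1, espec]; simp [embed, inputStore, hs0, hs 31]
      · simp [embed, inputStore, hs1, hs0, hs 32]
      · simp [embed, inputStore, hs1, hs0]
      · simp [embed_add, inputStore, hs1, hs0, this, show 31 + (x + 1 + 1 + 1) ≠ 32 by omega,
          show 31 + (x + 1 + 1 + 1) ≠ 33 by omega]
  rw [e] at h2
  have h5 := Runs.mulProg (R := R) (d := 19) (x := 5) (y := 19) (by omega) (by omega) (by omega)
    (s := Function.update s 19 W.bits) (M := M) (hs.update (by omega) _) (hM.update hout)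
    (by simpa [val_bits] using hW)
  refine (hprep.seq (h1.seq (h2.seq ((Runs.call hP (by simp) h s).seq
    ((Runs.fetch (by omega) hs hM _ hout).seq h5))))).cast ?_ ?_
  · simp [val_bits]
  · have := hM spec
    have := hM 2
    rw [e2, espec]
    have : callCost P (B + inputSize [s spec, s 2, hist]) ≤ callCost P M := by
      unfold callCost
      have := Nat.mul_le_mul_left P.room
        (show 5 * (B + inputSize [s spec, s 2, hist]) + 2 ≤ 5 * M + 2 by omega)
      omega
    simp only [List.length_cons, List.length_nil]
    omega

/-! ## Widths -/

section Width

variable {A : Type*} [Fintype A] {n : ℕ}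

/-- Only the adversary's behaviour on extensions of `h` matters after `h`. This allows adversaries
to be glued together or altered at a single history. -/
theorem condProb_congr {σ τ τ' : Strategy A n} (h w : List A)
    (hτ : ∀ w', τ.prob (h ++ w') = τ'.prob (h ++ w')) : condProb σ τ h w = condProb σ τ' h w := by
  induction w generalizing h with
  | nil => simp [condProb]
  | cons u w ih =>
    have h0 : τ.prob h = τ'.prob h := by simpa using hτ []
    rw [condProb, condProb, h0, ih]
    intro w'
    simpa using hτ (u :: w')

theorem condProb_nonneg (σ τ : Strategy A n) (h w : List A) (hl : h.length + w.length ≤ n) :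
    0 ≤ condProb σ τ h w := by
  induction w generalizing h with
  | nil => simp [condProb]
  | cons u w ih =>
    simp only [List.length_cons] at hl
    rw [condProb]
    refine mul_nonneg ?_ (ih _ (by simp; omega))
    split_ifs
    · exact σ.prob_nonneg _ _ (by omega)
    · exact τ.prob_nonneg _ _ (by omega)

/-- The plays in `X` extending `h` that are possible under `σ` and `τ`. -/
def possible (X : Set (List A)) (σ τ : Strategy A n) (h : List A) : Set (List A) :=
  {w | h ++ w ∈ X ∧ 0 < condProb σ τ h w}

theorem finite_slice (L : Set (List A)) (n : ℕ) : (slice L n).Finite :=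
  (List.finite_length_eq A n).subset fun _ hw => hw.2

theorem finite_extensions (L : Set (List A)) (n : ℕ) (h : List A) :
    {w | h ++ w ∈ slice L n}.Finite :=
  (finite_slice L n).preimage (List.append_right_injective h).injOn

theorem finite_possible (L : Set (List A)) (σ τ : Strategy A n) (h : List A) :
    (possible (slice L n) σ τ h).Finite :=
  (finite_extensions L n h).subset fun _ hw => hw.1

/-- An unbounded supremum in `ℕ` would be 0; here there are only finitely many plays in the slice.
-/
theorem bddAbove_width (L : Set (List A)) (h : List A) :
    BddAbove (Set.range fun σ : Strategy A n => ⨅ τ : Strategy A n,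
      (possible (slice L n) σ τ h).ncard) := by
  refine ⟨{w | h ++ w ∈ slice L n}.ncard, ?_⟩
  rintro _ ⟨σ, rfl⟩
  exact (ciInf_le (OrderBot.bddBelow _) σ).trans
    (Set.ncard_le_ncard (fun w hw => hw.1) (finite_extensions L n h))

/-- Every strategy has an adversary that leaves at most as many plays as the width. -/
theorem exists_adversary (L : Set (List A)) (σ : Strategy A n) (h : List A) :
    ∃ τ : Strategy A n, (possible (slice L n) σ τ h).ncard ≤ width n (slice L n) h := by
  obtain ⟨τ, hτ⟩ := Nat.sInf_mem (s := Set.range fun τ : Strategy A n =>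
    (possible (slice L n) σ τ h).ncard) ⟨_, ⟨σ, rfl⟩⟩
  exact ⟨τ, hτ.le.trans (le_ciSup (bddAbove_width L h) σ)⟩

theorem width_le [Nonempty (Strategy A n)] {X : Set (List A)} {h : List A} {N : ℕ}
    (hN : ∀ σ : Strategy A n, ∃ τ : Strategy A n, (possible X σ τ h).ncard ≤ N) :
    width n X h ≤ N := by
  refine ciSup_le fun σ => ?_
  obtain ⟨τ, hτ⟩ := hN σ
  exact (ciInf_le (OrderBot.bddBelow _) τ).trans hτ

/-- A play from an incomplete history has a first letter, and its remainder is still possible: the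
product is positive and its first factor is nonnegative. -/
theorem possible_subset (L : Set (List A)) (σ τ : Strategy A n) {h : List A} (hl : h.length < n) :
    possible (slice L n) σ τ h ⊆
      ⋃ u, List.cons u '' possible (slice L n) σ τ (h ++ [u]) := by
  intro w hw
  rcases w with _ | ⟨u, w⟩
  · have := hw.1.2
    simp at this
    omega
  · refine Set.mem_iUnion.2 ⟨u, w, ⟨by simpa using hw.1, ?_⟩, rfl⟩
    have h1 := hw.2
    rw [condProb] at h1
    refine pos_of_mul_pos_right h1 ?_
    split_ifs
    · exact σ.prob_nonneg _ _ hl.le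
    · exact τ.prob_nonneg _ _ hl.le

variable [Nonempty A]

instance : Nonempty (Strategy A n) := by
  classical
  refine ⟨⟨fun _ u => if u = Classical.arbitrary A then 1 else 0, ?_, ?_, ?_⟩⟩
  · intros; positivity
  · intros; split_ifs <;> norm_num
  · intros; simp

theorem width_mono {L L' : Set (List A)} (hL : L ⊆ L') (h : List A) :
    width n (slice L n) h ≤ width n (slice L' n) h := by
  refine width_le fun σ => ?_
  obtain ⟨τ, hτ⟩ := exists_adversary L' σ h
  refine ⟨τ, le_trans (Set.ncard_le_ncard ?_ (finite_possible _ _ _ _)) hτ⟩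
  exact fun w hw => ⟨⟨hL hw.1.1, hw.1.2⟩, hw.2⟩

/-- From a complete history only the empty continuation counts, and only if the history itself lies
in the language. The bound 1 yields the randomness constraint, the second part the hard and soft
constraints. -/
theorem width_leaf (L : Set (List A)) {h : List A} (hl : h.length = n) :
    width n (slice L n) h ≤ 1 ∧ (width n (slice L n) h ≠ 0 → h ∈ slice L n) := by
  have key : ∀ σ τ : Strategy A n, possible (slice L n) σ τ h ⊆ {w | w = [] ∧ h ∈ slice L n} := by
    intro σ τ w hw
    have : w = [] := by
      have := hw.1.2
      rw [List.length_append, hl] at this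
      exact List.length_eq_zero_iff.1 (by omega)
    subst this
    exact ⟨rfl, by simpa using hw.1⟩
  have hsub : {w : List A | w = [] ∧ h ∈ slice L n} ⊆ {[]} := fun w hw => hw.1
  constructor
  · refine width_le fun σ => ⟨σ, ?_⟩
    exact (Set.ncard_le_ncard ((key σ σ).trans hsub) (Set.finite_singleton _)).trans
      (Set.ncard_singleton _).le
  · intro h0
    by_contra hh
    refine h0 (Nat.le_zero.1 (width_le fun σ => ⟨σ, ?_⟩))
    have : possible (slice L n) σ σ h = ∅ :=
      Set.eq_empty_of_subset_empty fun w hw => hh (key σ σ hw).2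
    simp [this]

/-- Against a given strategy, take for each next letter an adversary that leaves at most the width
of that successor, and glue them: the letter following `h` reveals which one to imitate. The
possible plays are then counted according to their first letter. The parity of `h` plays no role for
this inequality. -/
theorem width_even (L : Set (List A)) {h : List A} (hl : h.length < n) :
    width n (slice L n) h ≤ ∑ u, width n (slice L n) (h ++ [u]) := by
  classical
  refine width_le fun σ => ?_
  choose τ hτ using fun u => exists_adversary L σ (h ++ [u])
  have ⟨u₀⟩ := ‹Nonempty A›
  -- The entry of `l` at position `h.length` is the letter played after `h`. The default `u₀` is
  -- used on histories too short to have it, which do not affect play after a successor of `h`.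
  let τ' : Strategy A n :=
    { prob := fun l => (τ (l.getD h.length u₀)).prob l
      prob_nonneg := fun l => (τ (l.getD h.length u₀)).prob_nonneg l
      prob_le_one := fun l => (τ (l.getD h.length u₀)).prob_le_one l
      sum_prob := fun l => (τ (l.getD h.length u₀)).sum_prob l }
  have hτ' : ∀ u, possible (slice L n) σ τ' (h ++ [u]) = possible (slice L n) σ (τ u) (h ++ [u]) := by
    intro u
    ext w
    have : condProb σ τ' (h ++ [u]) w = condProb σ (τ u) (h ++ [u]) w :=
      condProb_congr _ _ fun w' => by simp [τ']
    simp only [possible, Set.mem_ofPred_eq, this]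
  refine ⟨τ', ?_⟩
  calc _ ≤ (⋃ u, List.cons u '' possible (slice L n) σ τ' (h ++ [u])).ncard :=
        Set.ncard_le_ncard (possible_subset L σ τ' hl)
          (Set.finite_iUnion fun u => (finite_possible _ _ _ _).image _)
    _ ≤ ∑ u, (List.cons u '' possible (slice L n) σ τ' (h ++ [u])).ncard :=
        Set.ncard_iUnion_le_of_fintype _
    _ ≤ _ := by
        refine Finset.sum_le_sum fun u _ => ?_
        rw [Set.ncard_image_of_injective _ (List.cons_injective), hτ']
        exact hτ u

/-- The adversary may play `u` for sure at `h` and then continue as a good adversary from the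
successor; all plays with another first letter become impossible. -/
theorem width_odd (L : Set (List A)) {h : List A} (hl : h.length < n) (ho : ¬ Even h.length)
    (u : A) : width n (slice L n) h ≤ width n (slice L n) (h ++ [u]) := by
  classical
  refine width_le fun σ => ?_
  obtain ⟨τ, hτ⟩ := exists_adversary L σ (h ++ [u])
  let τ' : Strategy A n :=
    { prob := fun l a => if l = h then (if a = u then 1 else 0) else τ.prob l a
      prob_nonneg := fun l a hl => by
        split_ifs <;> first | exact τ.prob_nonneg l a hl | norm_num
      prob_le_one := fun l a hl => by
        split_ifs <;> first | exact τ.prob_le_one l a hl | norm_num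
      sum_prob := fun l hl => by
        by_cases h' : l = h
        · simp [h']
        · simpa [h'] using τ.sum_prob l hl }
  refine ⟨τ', le_trans ?_ hτ⟩
  rw [← Set.ncard_image_of_injective (possible (slice L n) σ τ (h ++ [u]))
    (List.cons_injective (a := u))]
  refine Set.ncard_le_ncard ?_ ((finite_possible _ _ _ _).image _)
  intro w hw
  obtain ⟨v, w', hw', rfl⟩ := Set.mem_iUnion.1 (possible_subset L σ τ' hl hw)
  have hv : v = u := by
    by_contra hne
    have := hw.2
    rw [condProb, if_neg ho] at this
    simp [τ', hne] at this
  subst hv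
  refine ⟨w', ⟨hw'.1, ?_⟩, rfl⟩
  have := hw'.2
  rwa [condProb_congr (τ' := τ)] at this
  intro w''
  funext a
  have : h ++ [v] ++ w'' ≠ h := fun hh => by
    have := congrArg List.length hh
    simp at this
  simp only [τ', this, if_false]

end Width

/-! ## Sums over words -/

section WordSum

variable {A : Type*} [Fintype A]

/-- Sum over all words of length `m`. -/
def wordSum : ℕ → (List A → ℝ) → ℝ
  | 0, f => f []
  | m + 1, f => ∑ u, wordSum m fun w => f (u :: w)

/-- Replaces the sum over functions in the definition of `setProb` by one that unfolds letter by
letter, as `condProb` does. -/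
theorem sum_ofFn (m : ℕ) (f : List A → ℝ) :
    ∑ w : Fin m → A, f (List.ofFn w) = wordSum m f := by
  induction m generalizing f with
  | zero => simp [wordSum]
  | succ m ih =>
    rw [wordSum, ← (Fin.consEquiv fun _ => A).sum_comp, Fintype.sum_prod_type]
    refine Finset.sum_congr rfl fun u _ => ?_
    rw [← ih]
    simp [Fin.consEquiv, List.ofFn_succ]

theorem wordSum_mul_left (m : ℕ) (c : ℝ) (f : List A → ℝ) :
    wordSum m (fun w => c * f w) = c * wordSum m f := by
  induction m generalizing f with
  | zero => rfl
  | succ m ih => simp only [wordSum, ih, Finset.mul_sum]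

open Classical in
/-- The probability of reaching `X` from the history `h` in `m` more moves. -/
noncomputable def reach {n : ℕ} (σ τ : Strategy A n) (X : Set (List A)) (m : ℕ) (h : List A) : ℝ :=
  wordSum m fun w => if h ++ w ∈ X then condProb σ τ h w else 0

theorem setProb_eq_reach {n : ℕ} (σ τ : Strategy A n) (X : Set (List A)) :
    setProb σ τ X = reach σ τ X n [] := by
  classical
  simp only [setProb, reach, ← sum_ofFn]
  rfl

theorem reach_zero {n : ℕ} (σ τ : Strategy A n) (X : Set (List A)) (h : List A) [Decidable (h ∈ X)] :
    reach σ τ X 0 h = if h ∈ X then 1 else 0 := by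
  simp [reach, wordSum, condProb]

theorem reach_succ {n : ℕ} (σ τ : Strategy A n) (X : Set (List A)) (m : ℕ) (h : List A) :
    reach σ τ X (m + 1) h =
      ∑ u, (if Even h.length then σ.prob h u else τ.prob h u) * reach σ τ X m (h ++ [u]) := by
  classical
  simp only [reach, wordSum, condProb]
  refine Finset.sum_congr rfl fun u _ => ?_
  rw [← wordSum_mul_left]
  congr 1
  funext w
  simp

/-- If all plays in `X` have probability at most `ρ`, the probability of `X` is at most `ρ` times
the number of its possible plays. -/
theorem setProb_le {n : ℕ} (σ τ : Strategy A n) (L : Set (List A)) (ρ : ℝ)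
    (h : ∀ w ∈ slice L n, playProb σ τ w ≤ ρ) :
    setProb σ τ (slice L n) ≤ (possible (slice L n) σ τ []).ncard * ρ := by
  classical
  have hinj : Function.Injective (List.ofFn : (Fin n → A) → List A) := List.ofFn_injective
  set F := Finset.univ.filter fun w : Fin n → A => List.ofFn w ∈ possible (slice L n) σ τ []
  have hF : (possible (slice L n) σ τ []).ncard = F.card := by
    rw [← Finset.card_image_of_injective F hinj, ← Set.ncard_coe_finset]
    congr 1
    ext w
    simp only [Finset.coe_image, Set.mem_image, Finset.mem_coe, F, Finset.mem_filter,
      Finset.mem_univ, true_and]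
    constructor
    · intro hw
      have hl : w.length = n := by simpa using hw.1.2
      subst hl
      exact ⟨w.get, by simpa using hw, by simp⟩
    · rintro ⟨v, hv, rfl⟩; exact hv
  rw [hF, setProb, ← nsmul_eq_mul, ← Finset.sum_const, Finset.sum_filter]
  refine Finset.sum_le_sum fun w _ => ?_
  by_cases hw : List.ofFn w ∈ slice L n
  · have h0 : 0 ≤ playProb σ τ (List.ofFn w) := condProb_nonneg _ _ _ _ (by simp)
    rcases h0.eq_or_lt with h0 | h0
    · have : ¬ List.ofFn w ∈ possible (slice L n) σ τ [] := fun hh =>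
        absurd hh.2 (by rw [playProb] at h0; rw [← h0]; exact lt_irrefl _)
      simp [hw, ← h0, this]
    · have : List.ofFn w ∈ possible (slice L n) σ τ [] := ⟨by simpa using hw, h0⟩
      simp only [hw, if_true, this]
      exact h _ hw
  · have : ¬ List.ofFn w ∈ possible (slice L n) σ τ [] := fun hh => hw (by simpa using hh.1)
    simp [hw, this]

end WordSum

/-! ## Greedy allocation -/

/-- The part of the masses `s.1 ≤ s.2` that is left over when a letter with capacities `x ≤ y`
takes as much as it can. -/
def restStep (x y : ℕ) (s : ℕ × ℕ) : ℕ × ℕ :=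
  (s.1 - x, s.2 - (s.2 - (s.1 - x) - (s.2 - (s.1 - x) - y)))

/-- The part of the masses `s` that a letter with capacities `x`, `y` takes. -/
def takeStep (x y : ℕ) (s : ℕ × ℕ) : ℕ × ℕ :=
  (s.1 - (s.1 - x), s.2 - (s.1 - x) - (s.2 - (s.1 - x) - y))

/-- What is left over for the letters from number `j` on. -/
def rest (x y : ℕ → ℕ) (s : ℕ × ℕ) : ℕ → ℕ × ℕ
  | 0 => s
  | j + 1 => restStep (x j) (y j) (rest x y s j)

/-- What letter number `j` takes. -/
def take (x y : ℕ → ℕ) (s : ℕ × ℕ) (j : ℕ) : ℕ × ℕ := takeStep (x j) (y j) (rest x y s j)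

/-- The letter takes `min s.1 x` of the first mass. Of the second it takes as much as `y` permits,
but leaves at least the remaining first mass, so that the order of the two masses persists on both
sides. The remainders fit into the capacities `sx ≤ sy` of the later letters: if the second part
stops short of `y`, what remains of the second mass equals the remaining first mass, at most `sx ≤
sy`. -/
theorem allocate_step {x y sx sy : ℕ} {s : ℕ × ℕ} (hxy : x ≤ y) (hs : s.1 ≤ s.2)
    (hsum : sx ≤ sy) (h1 : s.1 ≤ x + sx) (h2 : s.2 ≤ y + sy) :
    (takeStep x y s).1 ≤ (takeStep x y s).2 ∧ (takeStep x y s).1 ≤ x ∧ (takeStep x y s).2 ≤ y ∧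
    (restStep x y s).1 ≤ (restStep x y s).2 ∧ (restStep x y s).1 ≤ sx ∧ (restStep x y s).2 ≤ sy ∧
    (takeStep x y s).1 + (restStep x y s).1 = s.1 ∧
    (takeStep x y s).2 + (restStep x y s).2 = s.2 := by
  simp only [takeStep, restStep]
  omega

/-- The invariant of the greedy procedure: what is left fits into the capacities of the letters not
yet considered, and no mass is lost. At `j = k` no capacity is left, so everything has been
distributed. -/
theorem allocate {k : ℕ} {x y : ℕ → ℕ} {s : ℕ × ℕ} (hxy : ∀ i, x i ≤ y i) (hs : s.1 ≤ s.2)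
    (h1 : s.1 ≤ ∑ i ∈ Finset.range k, x i) (h2 : s.2 ≤ ∑ i ∈ Finset.range k, y i) (j : ℕ)
    (hj : j ≤ k) :
    (rest x y s j).1 ≤ (rest x y s j).2 ∧
    (rest x y s j).1 ≤ ∑ i ∈ Finset.Ico j k, x i ∧
    (rest x y s j).2 ≤ ∑ i ∈ Finset.Ico j k, y i ∧
    ∑ i ∈ Finset.range j, (take x y s i).1 + (rest x y s j).1 = s.1 ∧
    ∑ i ∈ Finset.range j, (take x y s i).2 + (rest x y s j).2 = s.2 := by
  induction j with
  | zero =>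
    rw [Finset.range_eq_Ico] at h1 h2
    exact ⟨hs, h1, h2, by simp [rest], by simp [rest]⟩
  | succ j ih =>
    obtain ⟨g1, g2, g3, g4, g5⟩ := ih (by omega)
    rw [Finset.sum_eq_sum_Ico_succ_bot (by omega)] at g2 g3
    have hsum : ∑ i ∈ Finset.Ico (j + 1) k, x i ≤ ∑ i ∈ Finset.Ico (j + 1) k, y i :=
      Finset.sum_le_sum fun i _ => hxy i
    obtain ⟨-, -, -, f4, f5, f6, f7, f8⟩ := allocate_step (hxy j) g1 hsum g2 g3
    refine ⟨f4, f5, f6, ?_, ?_⟩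
    · rw [Finset.sum_range_succ]; simp only [take, rest] at g4 ⊢; omega
    · rw [Finset.sum_range_succ]; simp only [take, rest] at g5 ⊢; omega

theorem take_le {k : ℕ} {x y : ℕ → ℕ} {s : ℕ × ℕ} (hxy : ∀ i, x i ≤ y i) (hs : s.1 ≤ s.2)
    (h1 : s.1 ≤ ∑ i ∈ Finset.range k, x i) (h2 : s.2 ≤ ∑ i ∈ Finset.range k, y i) {j : ℕ}
    (hj : j < k) :
    (take x y s j).1 ≤ (take x y s j).2 ∧ (take x y s j).1 ≤ x j ∧ (take x y s j).2 ≤ y j := by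
  obtain ⟨g1, g2, g3, -, -⟩ := allocate hxy hs h1 h2 j hj.le
  rw [Finset.sum_eq_sum_Ico_succ_bot hj] at g2 g3
  obtain ⟨f1, f2, f3, -⟩ := allocate_step (hxy j) g1 (Finset.sum_le_sum fun i _ => hxy i) g2 g3
  exact ⟨f1, f2, f3⟩

theorem sum_take {k : ℕ} {x y : ℕ → ℕ} {s : ℕ × ℕ} (hxy : ∀ i, x i ≤ y i) (hs : s.1 ≤ s.2)
    (h1 : s.1 ≤ ∑ i ∈ Finset.range k, x i) (h2 : s.2 ≤ ∑ i ∈ Finset.range k, y i) :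
    ∑ i ∈ Finset.range k, (take x y s i).1 = s.1 ∧
    ∑ i ∈ Finset.range k, (take x y s i).2 = s.2 := by
  obtain ⟨-, g2, g3, g4, g5⟩ := allocate hxy hs h1 h2 k le_rfl
  simp only [Finset.Ico_self, Finset.sum_empty, Nat.le_zero] at g2 g3
  exact ⟨by omega, by omega⟩

theorem rest_le (x y : ℕ → ℕ) (s : ℕ × ℕ) (j : ℕ) :
    (rest x y s j).1 ≤ s.1 ∧ (rest x y s j).2 ≤ s.2 := by
  induction j with
  | zero => exact ⟨le_rfl, le_rfl⟩
  | succ j ih => simp only [rest, restStep]; omega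

/-! ### The strategy induced by the allocation -/

section Strategy

variable {A : Type*} {k : ℕ} (e : A ≃ Fin k)

/-- The capacity of the successor of `h` by letter number `i`. -/
def capOf (w : List A → ℕ) (h : List A) (i : ℕ) : ℕ :=
  if hi : i < k then w (h ++ [e.symm ⟨i, hi⟩]) else 0

theorem capOf_val (w : List A → ℕ) (h : List A) (u : A) :
    capOf e w h (e u) = w (h ++ [u]) := by
  simp [capOf]

theorem sum_capOf [Fintype A] (w : List A → ℕ) (h : List A) :
    ∑ i ∈ Finset.range k, capOf e w h i = ∑ u, w (h ++ [u]) := by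
  rw [Finset.sum_range, ← e.sum_comp]
  exact Finset.sum_congr rfl fun u _ => capOf_val e w h u

variable (wA wI : List A → ℕ)

/-- The masses after one more letter. -/
def nextMass (h : List A) (s : ℕ × ℕ) (u : A) : ℕ × ℕ :=
  if Even h.length then take (capOf e wA h) (capOf e wI h) s (e u) else s

/-- The masses allotted to a history, when `s` is allotted to the empty one. -/
def mass (s : ℕ × ℕ) (h : List A) : ℕ × ℕ :=
  (h.foldl (fun (p : List A × (ℕ × ℕ)) u => (p.1 ++ [u], nextMass e wA wI p.1 p.2 u)) ([], s)).2

theorem mass_nil (s : ℕ × ℕ) : mass e wA wI s [] = s := rfl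

/-- The fold carries the prefix read so far because the capacities depend on it; `h1` identifies
this component. -/
theorem mass_append (s : ℕ × ℕ) (h : List A) (u : A) :
    mass e wA wI s (h ++ [u]) = nextMass e wA wI h (mass e wA wI s h) u := by
  have h1 : ∀ h : List A, (h.foldl (fun (p : List A × (ℕ × ℕ)) u =>
      (p.1 ++ [u], nextMass e wA wI p.1 p.2 u)) ([], s)).1 = h := by
    intro h
    induction h using List.reverseRecOn with
    | nil => rfl
    | append_singleton h u ih => rw [List.foldl_append]; simp [ih]
  rw [mass, List.foldl_append]
  simp only [List.foldl_cons, List.foldl_nil]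
  rw [h1]
  rfl

/-- Masses never grow along a history, whether or not they fit the widths. The numbers in the
machine are therefore no longer than the denominator of `ρ`. -/
theorem mass_le {s : ℕ × ℕ} {a c : ℕ} (hs1 : s.1 ≤ a) (hs2 : s.2 ≤ c) (h : List A) :
    (mass e wA wI s h).1 ≤ a ∧ (mass e wA wI s h).2 ≤ c := by
  induction h using List.reverseRecOn with
  | nil => exact ⟨hs1, hs2⟩
  | append_singleton h u ih =>
    rw [mass_append, nextMass]
    split_ifs
    · have := rest_le (capOf e wA h) (capOf e wI h) (mass e wA wI s h) (e u)
      simp only [take, takeStep]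
      omega
    · exact ih

/-- The properties of the (scaled) widths of two sets of plays of length `n` that are needed to
follow the greedy allocation. -/
structure Widths [Fintype A] (n : ℕ) : Prop where
  le : ∀ h, wA h ≤ wI h
  even_left : ∀ h : List A, h.length < n → wA h ≤ ∑ u, wA (h ++ [u])
  even_right : ∀ h : List A, h.length < n → wI h ≤ ∑ u, wI (h ++ [u])
  odd_left : ∀ h : List A, h.length < n → ¬ Even h.length → ∀ u, wA h ≤ wA (h ++ [u])
  odd_right : ∀ h : List A, h.length < n → ¬ Even h.length → ∀ u, wI h ≤ wI (h ++ [u])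

/-- The masses `s` are compatible with the history `h`. -/
def Fits (h : List A) (s : ℕ × ℕ) : Prop := s.1 ≤ s.2 ∧ s.1 ≤ wA h ∧ s.2 ≤ wI h

variable {e wA wI} [Fintype A] {n : ℕ}

theorem Widths.capOf_le (hw : Widths wA wI n) (h : List A) (i : ℕ) :
    capOf e wA h i ≤ capOf e wI h i := by
  unfold capOf; split_ifs
  · exact hw.le _
  · exact le_rfl

theorem Widths.sum_take (hw : Widths wA wI n) {h : List A} (hl : h.length < n)
    {s : ℕ × ℕ} (hs : Fits wA wI h s) :
    ∑ u, (take (capOf e wA h) (capOf e wI h) s (e u)).1 = s.1 ∧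
    ∑ u, (take (capOf e wA h) (capOf e wI h) s (e u)).2 = s.2 := by
  have := RCI.sum_take (k := k) (hw.capOf_le (e := e) h) hs.1
    (by rw [sum_capOf]; exact hs.2.1.trans (hw.even_left h hl))
    (by rw [sum_capOf]; exact hs.2.2.trans (hw.even_right h hl))
  rwa [Finset.sum_range, Finset.sum_range, ← e.sum_comp, ← e.sum_comp] at this

/-- On our turn the greedy allocation respects the capacities; on the adversary's turn the masses
stay the same while the widths do not decrease. -/
theorem Widths.fits_next (hw : Widths wA wI n) {h : List A} (hl : h.length < n)
    {s : ℕ × ℕ} (hs : Fits wA wI h s) (u : A) :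
    Fits wA wI (h ++ [u]) (nextMass e wA wI h s u) := by
  unfold nextMass
  split_ifs with hev
  · have := take_le (k := k) (hw.capOf_le (e := e) h) hs.1
      (by rw [sum_capOf]; exact hs.2.1.trans (hw.even_left h hl))
      (by rw [sum_capOf]; exact hs.2.2.trans (hw.even_right h hl)) (e u).2
    rwa [capOf_val, capOf_val] at this
  · exact ⟨hs.1, hs.2.1.trans (hw.odd_left h hl hev u), hs.2.2.trans (hw.odd_right h hl hev u)⟩

theorem Widths.fits_mass (hw : Widths wA wI n) {s : ℕ × ℕ} (hs : Fits wA wI [] s) (h : List A)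
    (hl : h.length ≤ n) : Fits wA wI h (mass e wA wI s h) := by
  induction h using List.reverseRecOn with
  | nil => exact hs
  | append_singleton h u ih =>
    simp only [List.length_append, List.length_singleton] at hl
    rw [mass_append]
    exact hw.fits_next (by omega) (ih (by omega)) u

open Classical in
/-- The probability of the letter `u` after the history `h`: proportional to the mass allotted to
it when it is our turn; the first letter is chosen in all irrelevant situations. -/
noncomputable def moveProb (e : A ≃ Fin k) (wA wI : List A → ℕ) (n : ℕ) (s : ℕ × ℕ) (h : List A)
    (u : A) : ℝ :=
  if Even h.length ∧ h.length < n ∧ (mass e wA wI s h).2 ≠ 0 then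
    ((mass e wA wI s (h ++ [u])).2 : ℝ) / (mass e wA wI s h).2
  else if (e u : ℕ) = 0 then 1 else 0

/-- The strategy that follows the greedy allocation. -/
noncomputable def Widths.strategy [Nonempty A] (e : A ≃ Fin k) (hw : Widths wA wI n) {s : ℕ × ℕ}
    (hs : Fits wA wI [] s) : Strategy A n :=
  have h0 : ∀ h u, 0 ≤ moveProb e wA wI n s h u := fun h u => by
    unfold moveProb; split_ifs <;> positivity
  have h1 : ∀ h : List A, h.length ≤ n → ∑ u, moveProb e wA wI n s h u = 1 := by
    intro h hl
    by_cases hc : Even h.length ∧ h.length < n ∧ (mass e wA wI s h).2 ≠ 0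
    · have hsum := (hw.sum_take (e := e) hc.2.1 (hw.fits_mass (e := e) hs h hl)).2
      simp only [moveProb, if_pos hc, mass_append, nextMass, if_pos hc.1]
      rw [← Finset.sum_div, ← Nat.cast_sum, hsum, div_self (by exact_mod_cast hc.2.2)]
    · simp only [moveProb, if_neg hc]
      have hk : 0 < k := (e (Classical.arbitrary A)).pos
      rw [Finset.sum_eq_single (e.symm ⟨0, hk⟩)]
      · simp
      · intro u _ hu
        rw [if_neg]
        intro h0
        apply hu
        rw [Equiv.eq_symm_apply]
        exact Fin.ext h0
      · simp
  { prob := moveProb e wA wI n s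
    prob_nonneg := fun h u _ => h0 h u
    prob_le_one := fun h u hl =>
      (Finset.single_le_sum (fun v _ => h0 h v) (Finset.mem_univ u)).trans (h1 h hl).le
    sum_prob := fun h hl => h1 h hl.le }

variable [Nonempty A]

theorem Widths.strategy_prob (hw : Widths wA wI n) {s : ℕ × ℕ} (hs : Fits wA wI [] s)
    (h : List A) (u : A) : (hw.strategy e hs).prob h u = moveProb e wA wI n s h u := rfl

theorem Widths.strategy_mul (hw : Widths wA wI n) {s : ℕ × ℕ} (hs : Fits wA wI [] s)
    {h : List A} (hl : h.length < n) (hev : Even h.length) (h0 : (mass e wA wI s h).2 ≠ 0) (u : A) :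
    (hw.strategy e hs).prob h u * (mass e wA wI s h).2 = (mass e wA wI s (h ++ [u])).2 := by
  rw [hw.strategy_prob, moveProb, if_pos ⟨hev, hl, h0⟩]
  field_simp

/-- On our turn the probability of a letter times the mass of `h` is exactly the mass of the
successor; on the adversary's turn the mass is unchanged and the factor is at most 1. At mass 0,
where the strategy is arbitrary, the left side vanishes. -/
theorem Widths.condProb_mul_le (hw : Widths wA wI n) {s : ℕ × ℕ} (hs : Fits wA wI [] s)
    (τ : Strategy A n) (w : List A) : ∀ h : List A, h.length + w.length ≤ n →
    condProb (hw.strategy e hs) τ h w * (mass e wA wI s h).2 ≤ (mass e wA wI s (h ++ w)).2 := by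
  induction w with
  | nil => intro h _; simp [condProb]
  | cons u w ih =>
    intro h hl
    simp only [List.length_cons] at hl
    by_cases h0 : (mass e wA wI s h).2 = 0
    · simp [h0]
    have ih' := ih (h ++ [u]) (by simp; omega)
    rw [List.append_assoc, List.singleton_append] at ih'
    refine le_trans ?_ ih'
    rw [condProb]
    have hnn := condProb_nonneg (hw.strategy e hs) τ (h ++ [u]) w (by simp; omega)
    split_ifs with hev
    · rw [mul_right_comm, hw.strategy_mul hs (by omega) hev h0, mul_comm]
    · have : (mass e wA wI s (h ++ [u])).2 = (mass e wA wI s h).2 := by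
        rw [mass_append, nextMass, if_neg hev]
      rw [this]
      refine mul_le_mul_of_nonneg_right ?_ (Nat.cast_nonneg _)
      exact mul_le_of_le_one_left hnn (τ.prob_le_one h u (by omega))

/-- The play never leaves the histories of nonzero second mass: our letters of mass 0 have
probability 0, and the adversary cannot change the mass. At a leaf, nonzero mass forces nonzero
width. -/
theorem Widths.reach_right (hw : Widths wA wI n) {s : ℕ × ℕ} (hs : Fits wA wI [] s)
    (τ : Strategy A n) {X : Set (List A)} (hX : ∀ h : List A, h.length = n → wI h ≠ 0 → h ∈ X)
    (m : ℕ) : ∀ h : List A, h.length + m = n → (mass e wA wI s h).2 ≠ 0 →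
    reach (hw.strategy e hs) τ X m h = 1 := by
  classical
  induction m with
  | zero =>
    intro h hl h0
    have := (hw.fits_mass (e := e) hs h (by omega)).2.2
    rw [reach_zero, if_pos (hX h (by omega) (by omega))]
  | succ m ih =>
    intro h hl h0
    rw [reach_succ]
    by_cases hev : Even h.length
    · rw [← (hw.strategy e hs).sum_prob h (by omega)]
      refine Finset.sum_congr rfl fun u _ => ?_
      rw [if_pos hev]
      by_cases hu : (mass e wA wI s (h ++ [u])).2 = 0
      · have := hw.strategy_mul hs (by omega) hev h0 u
        rw [hu, Nat.cast_zero] at this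
        rw [(mul_eq_zero.1 this).resolve_right (by exact_mod_cast h0), zero_mul]
      · rw [ih _ (by simp; omega) hu, mul_one]
    · rw [← τ.sum_prob h (by omega)]
      refine Finset.sum_congr rfl fun u _ => ?_
      rw [if_neg hev, ih _ (by simp; omega), mul_one]
      rwa [mass_append, nextMass, if_neg hev]

/-- Multiplying by the second mass makes the claim additive. On our turn the inequalities of the
successors sum up to that of `h`, as the first masses add up; on the adversary's turn one takes
their average. -/
theorem Widths.le_reach_left (hw : Widths wA wI n) {s : ℕ × ℕ} (hs : Fits wA wI [] s)
    (τ : Strategy A n) {X : Set (List A)} (hX : ∀ h : List A, h.length = n → wA h ≠ 0 → h ∈ X)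
    (m : ℕ) : ∀ h : List A, h.length + m = n →
    ((mass e wA wI s h).1 : ℝ) ≤
      reach (hw.strategy e hs) τ X m h * (mass e wA wI s h).2 := by
  classical
  induction m with
  | zero =>
    intro h hl
    have hf := hw.fits_mass (e := e) hs h (by omega)
    rw [reach_zero]
    by_cases hx : h ∈ X
    · simpa [hx] using hf.1
    · have : wA h = 0 := by by_contra h0; exact hx (hX h (by omega) h0)
      have := hf.2.1
      simp [hx]; omega
  | succ m ih =>
    intro h hl
    have hf := hw.fits_mass (e := e) hs h (by omega)
    rw [reach_succ, Finset.sum_mul]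
    by_cases h0 : (mass e wA wI s h).2 = 0
    · have : (mass e wA wI s h).1 = 0 := by have := hf.1; omega
      simp [this, h0]
    by_cases hev : Even h.length
    · have hsum := (hw.sum_take (e := e) (by omega) hf).1
      rw [← hsum, Nat.cast_sum]
      refine Finset.sum_le_sum fun u _ => ?_
      rw [if_pos hev, mul_right_comm, hw.strategy_mul hs (by omega) hev h0, mul_comm]
      have := ih (h ++ [u]) (by simp; omega)
      refine le_trans (le_of_eq ?_) this
      rw [mass_append, nextMass, if_pos hev]
    · have h1 := τ.sum_prob h (by omega)
      calc ((mass e wA wI s h).1 : ℝ) = ∑ u, τ.prob h u * (mass e wA wI s h).1 := by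
            rw [← Finset.sum_mul, h1, one_mul]
        _ ≤ _ := by
            refine Finset.sum_le_sum fun u _ => ?_
            rw [if_neg hev, mul_assoc]
            refine mul_le_mul_of_nonneg_left ?_ (τ.prob_nonneg h u (by omega))
            have := ih (h ++ [u]) (by simp; omega)
            rwa [mass_append, nextMass, if_neg hev] at this

end Strategy

/-! ## Realizability -/

section Realizability

variable {A : Type*} [Fintype A] [Nonempty A] {𝒮 : SpecClass A} (C : Instance 𝒮 𝒮)

/-- The numerator of `ρ`. -/
def Instance.rhoNum : ℕ := C.ρ.num.toNat

/-- The numerator of `ε`. -/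
def Instance.epsNum : ℕ := C.ε.num.toNat

/-- The width of the set of improvisations, multiplied with the numerator of `ρ`. -/
noncomputable def Instance.widthHard (h : List A) : ℕ :=
  C.rhoNum * width C.n (slice (𝒮.lang C.hard) C.n) h

/-- The width of the set of admissible improvisations, multiplied with the numerator of `ρ`. -/
noncomputable def Instance.widthSoft (h : List A) : ℕ :=
  C.rhoNum * width C.n (slice (𝒮.lang C.hard ∩ 𝒮.lang C.soft) C.n) h

/-- The masses allotted to the empty history. -/
noncomputable def Instance.initial : ℕ × ℕ :=
  (C.ρ.den - (C.ρ.den - C.widthSoft []), C.ρ.den)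

/-- The criterion for realizability. -/
def Instance.Feasible : Prop :=
  C.ρ.den - C.widthHard [] = 0 ∧
    (C.ε.den - C.epsNum) * C.ρ.den - C.ε.den * C.initial.1 = 0

theorem Instance.widths : Widths C.widthSoft C.widthHard C.n where
  le h := Nat.mul_le_mul_left _ (width_mono Set.inter_subset_left h)
  even_left h hl := by
    unfold Instance.widthSoft
    rw [← Finset.mul_sum]; exact Nat.mul_le_mul_left _ (width_even _ hl)
  even_right h hl := by
    unfold Instance.widthHard
    rw [← Finset.mul_sum]; exact Nat.mul_le_mul_left _ (width_even _ hl)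
  odd_left h hl ho u := Nat.mul_le_mul_left _ (width_odd _ hl ho u)
  odd_right h hl ho u := Nat.mul_le_mul_left _ (width_odd _ hl ho u)

theorem Instance.rho_mul_den : (C.ρ : ℝ) * C.ρ.den = C.rhoNum := by
  have h1 : (C.ρ.num.toNat : ℤ) = C.ρ.num := Int.toNat_of_nonneg (Rat.num_nonneg.2 C.ρ_nonneg)
  have h2 : C.ρ * C.ρ.den = C.ρ.num := Rat.mul_den_eq_num _
  have h3 : C.ρ * C.ρ.den = (C.ρ.num.toNat : ℚ) := by
    rw [h2]; exact_mod_cast (congrArg (Int.cast (R := ℚ)) h1).symm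
  unfold Instance.rhoNum
  exact_mod_cast h3

theorem Instance.eps_mul_den : (C.ε : ℝ) * C.ε.den = C.epsNum := by
  have h1 : (C.ε.num.toNat : ℤ) = C.ε.num := Int.toNat_of_nonneg (Rat.num_nonneg.2 C.ε_nonneg)
  have h2 : C.ε * C.ε.den = C.ε.num := Rat.mul_den_eq_num _
  have h3 : C.ε * C.ε.den = (C.ε.num.toNat : ℚ) := by
    rw [h2]; exact_mod_cast (congrArg (Int.cast (R := ℚ)) h1).symm
  unfold Instance.epsNum
  exact_mod_cast h3

theorem Instance.admissible_eq :
    C.admissible = slice (𝒮.lang C.hard ∩ 𝒮.lang C.soft) C.n := by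
  ext w
  simp only [Instance.admissible, Instance.improvisations, slice, Set.mem_ofPred_eq, Set.mem_inter_iff]
  tauto

theorem Instance.fits (hC : C.Feasible) : Fits C.widthSoft C.widthHard [] C.initial := by
  have := hC.1
  simp only [Fits, Instance.initial]
  omega

theorem Instance.epsNum_le : C.epsNum ≤ C.ε.den := by
  have h1 := C.eps_mul_den
  have h2 : (C.ε : ℝ) ≤ 1 := by exact_mod_cast C.ε_le_one
  have h3 : (C.epsNum : ℝ) ≤ C.ε.den := by
    rw [← h1]; exact mul_le_of_le_one_left (Nat.cast_nonneg _) h2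
  exact_mod_cast h3

/-- Two adversaries are used, one leaving few improvisations and one leaving few admissible ones.
Counting with probability at most `ρ` per play and multiplying by the denominator of `ρ` gives the
two conditions. -/
theorem Instance.feasible_of_improvising {σ : Strategy A C.n} (hσ : C.IsImprovising σ) :
    C.Feasible := by
  have hq : (0 : ℝ) < C.ρ.den := by exact_mod_cast C.ρ.pos
  have hd : (0 : ℝ) < C.ε.den := by exact_mod_cast C.ε.pos
  have hρ : (0 : ℝ) ≤ C.ρ := by exact_mod_cast C.ρ_nonneg
  have hI : (C.ρ.den : ℝ) ≤ C.widthHard [] := by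
    obtain ⟨τ, hτ⟩ := exists_adversary (𝒮.lang C.hard) σ []
    have h1 := hσ.hard_constraint τ
    have h2 := setProb_le σ τ (𝒮.lang C.hard) C.ρ (hσ.randomness τ)
    rw [Instance.improvisations] at h1
    rw [h1] at h2
    unfold Instance.widthHard
    rw [Nat.cast_mul, ← C.rho_mul_den]
    have h3 : (1 : ℝ) ≤ width C.n (slice (𝒮.lang C.hard) C.n) [] * C.ρ :=
      h2.trans (mul_le_mul_of_nonneg_right (by exact_mod_cast hτ) hρ)
    nlinarith
  have hA : (1 - (C.ε : ℝ)) * C.ρ.den ≤ C.widthSoft [] := by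
    obtain ⟨τ, hτ⟩ := exists_adversary (𝒮.lang C.hard ∩ 𝒮.lang C.soft) σ []
    have h1 := hσ.soft_constraint τ
    rw [C.admissible_eq] at h1
    have h2 := setProb_le σ τ (𝒮.lang C.hard ∩ 𝒮.lang C.soft) C.ρ
      (fun w hw => hσ.randomness τ w ⟨hw.1.1, hw.2⟩)
    unfold Instance.widthSoft
    rw [Nat.cast_mul, ← C.rho_mul_den]
    have h3 : 1 - (C.ε : ℝ) ≤ width C.n (slice (𝒮.lang C.hard ∩ 𝒮.lang C.soft) C.n) [] * C.ρ :=
      (h1.trans h2).trans (mul_le_mul_of_nonneg_right (by exact_mod_cast hτ) hρ)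
    nlinarith
  have hI' : C.ρ.den ≤ C.widthHard [] := by exact_mod_cast hI
  refine ⟨by omega, ?_⟩
  have hmin : C.initial.1 = min C.ρ.den (C.widthSoft []) := by
    simp only [Instance.initial]; omega
  rw [Nat.sub_eq_zero_iff_le]
  have h1 : ((C.ε.den - C.epsNum : ℕ) : ℝ) = (1 - C.ε) * C.ε.den := by
    rw [Nat.cast_sub C.epsNum_le, ← C.eps_mul_den]; ring
  have h2 : ((C.ε.den - C.epsNum : ℕ) : ℝ) * C.ρ.den ≤ C.ε.den * (C.initial.1 : ℝ) := by
    rw [h1, hmin, Nat.cast_min]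
    have hε : (0 : ℝ) ≤ C.ε := by exact_mod_cast C.ε_nonneg
    -- The mass of the admissible plays is capped at the total mass; the cap costs nothing since `1
    -- - ε ≤ 1`.
    have : (1 - (C.ε : ℝ)) * C.ρ.den ≤ min (C.ρ.den : ℝ) (C.widthSoft []) :=
      le_min (by nlinarith) hA
    nlinarith
  exact_mod_cast h2

/-- The three mass estimates are read off at the empty history, where the second mass is the
denominator `q` of `ρ`. For the randomness constraint, the mass of a complete play is at most its
scaled width, hence at most `ρ * q`. -/
theorem Instance.improvising_strategy (hC : C.Feasible) {k : ℕ} (e : A ≃ Fin k) :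
    C.IsImprovising (C.widths.strategy e (C.fits hC)) := by
  have hq : (0 : ℝ) < C.ρ.den := by exact_mod_cast C.ρ.pos
  have hd : (0 : ℝ) < C.ε.den := by exact_mod_cast C.ε.pos
  refine ⟨fun τ => ?_, fun τ => ?_, fun τ w hw => ?_⟩
  · rw [setProb_eq_reach]
    refine C.widths.reach_right (C.fits hC) τ ?_ _ [] (by simp) C.ρ.den_nz
    intro h hl h0
    refine (width_leaf _ hl).2 fun h1 => h0 ?_
    rw [Instance.widthHard, h1, mul_zero]
  · rw [setProb_eq_reach]
    have h1 := C.widths.le_reach_left (e := e) (C.fits hC) τ (X := C.admissible) ?_ C.n [] (by simp)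
    · rw [mass_nil] at h1
      have h2 := Nat.sub_eq_zero_iff_le.1 hC.2
      have h3 : ((C.ε.den - C.epsNum : ℕ) : ℝ) * C.ρ.den ≤ C.ε.den * (C.initial.1 : ℝ) := by
        exact_mod_cast h2
      rw [Nat.cast_sub C.epsNum_le, ← C.eps_mul_den] at h3
      have h4 : (1 - (C.ε : ℝ)) * C.ρ.den ≤ C.initial.1 := by
        refine le_of_mul_le_mul_left ?_ hd
        linarith
      exact le_of_mul_le_mul_right (h4.trans h1) hq
    · intro h hl h0
      rw [C.admissible_eq]
      refine (width_leaf _ hl).2 fun h1 => h0 ?_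
      rw [Instance.widthSoft, h1, mul_zero]
  · have hl : w.length = C.n := hw.2
    have h1 := C.widths.condProb_mul_le (e := e) (C.fits hC) τ w [] (by simp [hl])
    have h2 := (C.widths.fits_mass (e := e) (C.fits hC) w hl.le).2.2
    have h3 : C.widthHard w ≤ C.rhoNum := by
      unfold Instance.widthHard
      exact (Nat.mul_le_mul_left _ (width_leaf _ hl).1).trans (mul_one _).le
    have h4 : ((mass e C.widthSoft C.widthHard C.initial w).2 : ℝ) ≤ C.rhoNum := by
      exact_mod_cast h2.trans h3
    rw [mass_nil, List.nil_append] at h1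
    have h5 := h1.trans h4
    rw [← C.rho_mul_den] at h5
    exact le_of_mul_le_mul_right h5 hq

theorem Instance.realizable_iff : C.Realizable ↔ C.Feasible :=
  ⟨fun ⟨_, hσ⟩ => C.feasible_of_improvising hσ, fun hC =>
    ⟨_, C.improvising_strategy hC (Fintype.equivFin A)⟩⟩

end Realizability

/-! ## Processing a history -/

theorem update_inputStore {l : List (List Bool)} {i : ℕ} (hi : i < l.length) (v : List Bool) :
    Function.update (inputStore l) i v = inputStore (l.set i v) := by
  funext r
  by_cases h : r = i
  · subst h; simp [inputStore, hi]
  · simp [inputStore, h, List.getElem?_set_ne (Ne.symm h)]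

theorem clean_inputStore {l : List (List Bool)} (h : l.length ≤ 22) : Clean (inputStore l) := by
  intro r hr
  simp [inputStore, show l.length ≤ r by omega]

theorem small_inputStore {l : List (List Bool)} {M : ℕ} (h : ∀ x ∈ l, x.length ≤ M) :
    Small M (inputStore l) := by
  intro r
  by_cases hr : r < l.length
  · simpa [inputStore, hr] using h _ (List.getElem_mem hr)
  · simp [inputStore, show l.length ≤ r by omega]

/-- Divide the masses in registers `13` and `14` between the current letter and the later ones:
registers `16` and `17` receive the part of the current letter, registers `15` and `18` the
remaining part. -/
def allocProg (P : Prog) : Prog :=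
  .seq (capProg P prepLetter 8) (.seq (subProg 15 13 19) (.seq (subProg 16 13 15)
    (.seq (subProg 17 14 15) (.seq (capProg P prepLetter 7) (.seq (subProg 19 17 19)
      (.seq (subProg 17 17 19) (.seq (subProg 18 14 17) (clear 19))))))))

section

variable {A : Type*} {k : ℕ} (e : A ≃ Fin k)

theorem wordCode_append (h : List A) (u : A) :
    wordCode e (h ++ [u]) = wordCode e h ++ List.replicate (e u) true ++ [false] := by
  simp [wordCode, letterCode, unaryCode]

theorem length_wordCode_le (h : List A) : (wordCode e h).length ≤ k * h.length := by
  induction h with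
  | nil => simp [wordCode]
  | cons u h ih =>
    have := (e u).2
    simp only [wordCode, List.flatMap_cons, List.length_append, letterCode, unaryCode,
      List.length_replicate, List.length_cons, List.length_nil] at ih ⊢
    rw [Nat.mul_add]
    omega

variable [Fintype A] {𝒮 : SpecClass A}

/-- The assumptions under which the subprograms are analysed: `P` is an algorithm for the width,
`Z` is the intersection of the specifications, and `M` bounds the lengths of all registers. -/
structure Setting (R : Resource) (C : Instance 𝒮 𝒮) (P : Prog) (Z : 𝒮.Spec) (M : ℕ) : Prop where
  det : P.Deterministic
  hard : ∀ h : List A, h.length ≤ C.n → ∃ B,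
    P.Computes R [𝒮.code C.hard, List.replicate C.n true, wordCode e h]
      (width C.n (slice (𝒮.lang C.hard) C.n) h).bits B ∧
    B + inputSize [𝒮.code C.hard, List.replicate C.n true, wordCode e h] ≤ M
  soft : ∀ h : List A, h.length ≤ C.n → ∃ B,
    P.Computes R [𝒮.code Z, List.replicate C.n true, wordCode e h]
      (width C.n (slice (𝒮.lang C.hard ∩ 𝒮.lang C.soft) C.n) h).bits B ∧
    B + inputSize [𝒮.code Z, List.replicate C.n true, wordCode e h] ≤ M
  widthHard : ∀ h : List A, h.length ≤ C.n → (C.widthHard h).bits.length ≤ M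
  widthSoft : ∀ h : List A, h.length ≤ C.n → (C.widthSoft h).bits.length ≤ M
  codeHard : (𝒮.code C.hard).length ≤ M
  codeSoft : (𝒮.code C.soft).length ≤ M
  codeInter : (𝒮.code Z).length ≤ M
  length : C.n ≤ M
  word : ∀ h : List A, h.length ≤ C.n → (wordCode e h).length ≤ M
  letters : k ≤ M
  rhoNum : C.rhoNum.bits.length ≤ M
  rhoDen : C.ρ.den.bits.length ≤ M
  epsNum : C.epsNum.bits.length ≤ M
  epsDen : C.ε.den.bits.length ≤ M

/-- A bound for the cost of `capProg`. -/
def capCost (P : Prog) (M : ℕ) : ℕ := callCost P M + 120 * M * M + 383 * M + 250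

/-- A bound for the cost of `allocProg`. -/
def allocCost (P : Prog) (M : ℕ) : ℕ := 2 * capCost P M + 725 * M + 729

variable {e} {R : Resource} {C : Instance 𝒮 𝒮} {P : Prog} {Z : 𝒮.Spec} {M : ℕ}

/-- With capacities `x`, `y` and masses `m`, the registers successively become `15 := m.1 - x`, `16
:= m.1 - (m.1 - x)`, `17 := w` with `w = m.2 - (m.1 - x)`, then `17 := w - (w - y)` and `18 := m.2 -
(w - (w - y))`. Truncated subtraction computes all the minima involved. -/
theorem Setting.runs_alloc (S : Setting e R C P Z M) {s : Store} (hs : Clean s)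
    (hM : Small M s) {h : List A} (hl : h.length < C.n) {j : ℕ} (hj : j < k) {m : ℕ × ℕ}
    (h2 : s 2 = List.replicate C.n true) (h5 : s 5 = C.rhoNum.bits) (h7 : s 7 = 𝒮.code C.hard)
    (h8 : s 8 = 𝒮.code Z) (h9 : s 9 = (wordCode e h).reverse) (h10 : s 10 = List.replicate j true)
    (h13 : s 13 = m.1.bits) (h14 : s 14 = m.2.bits) :
    Runs R (allocProg P) s (fun r =>
        if r = 15 then (restStep (capOf e C.widthSoft h j) (capOf e C.widthHard h j) m).1.bits
        else if r = 16 then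
          (takeStep (capOf e C.widthSoft h j) (capOf e C.widthHard h j) m).1.bits
        else if r = 17 then
          (takeStep (capOf e C.widthSoft h j) (capOf e C.widthHard h j) m).2.bits
        else if r = 18 then
          (restStep (capOf e C.widthSoft h j) (capOf e C.widthHard h j) m).2.bits
        else if r = 19 then [] else s r)
      (allocCost P M) := by
  set u := e.symm ⟨j, hj⟩ with hu
  have hcapS : capOf e C.widthSoft h j = C.widthSoft (h ++ [u]) := by simp [capOf, hj, hu]
  have hcapH : capOf e C.widthHard h j = C.widthHard (h ++ [u]) := by simp [capOf, hj, hu]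
  have hhist : (wordCode e h).reverse.reverse ++ List.replicate j true ++ [false]
      = wordCode e (h ++ [u]) := by
    rw [wordCode_append]; simp [hu]
  have hlu : (h ++ [u]).length ≤ C.n := by simp; omega
  rw [hcapS, hcapH]
  set x := C.widthSoft (h ++ [u]) with hx
  set y := C.widthHard (h ++ [u]) with hy
  obtain ⟨B, hB, hB'⟩ := S.soft _ hlu
  obtain ⟨B₂, hB₂, hB₂'⟩ := S.hard _ hlu
  have hm1 : m.1.bits.length ≤ M := by rw [← h13]; exact hM 13
  have hm2 : m.2.bits.length ≤ M := by rw [← h14]; exact hM 14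
  have sub1 : ∀ {a b : ℕ}, a ≤ b → b.bits.length ≤ M → a.bits.length ≤ M :=
    fun h h' => (length_bits_mono h).trans h'
  have c1 := Runs.capProg (R := R) S.det (spec := 8) (by omega) hs hM (Runs.prepLetter hs hM)
    (W := width C.n (slice (𝒮.lang C.hard ∩ 𝒮.lang C.soft) C.n) (h ++ [u])) (B := B)
    (by rw [h8, h2, h9, h10, hhist]; exact hB) (by rw [h8, h2, h9, h10, hhist]; exact hB')
    (by rw [h5, val_bits]; exact S.widthSoft _ hlu)
  rw [h5, val_bits] at c1
  change Runs R _ s (Function.update s 19 x.bits) _ at c1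
  have hs1 := hs.update (d := 19) (by omega) x.bits
  have hM1 := hM.update (d := 19) (S.widthSoft _ hlu)
  rw [← hx] at hM1
  set s1 := Function.update s 19 x.bits with es1
  have c2 := Runs.subProg (R := R) (d := 15) (x := 13) (y := 19) (by omega) (by omega) (by omega)
    (fun r hr _ => hs1 r hr) hM1
  rw [show s1 13 = m.1.bits by simp [es1, h13], show s1 19 = x.bits by simp [es1], val_bits,
    val_bits] at c2
  have hs2 := hs1.update (d := 15) (by omega) (m.1 - x).bits
  have hM2 := hM1.update (d := 15) (sub1 (Nat.sub_le m.1 x) hm1)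
  set s2 := Function.update s1 15 (m.1 - x).bits with es2
  have c3 := Runs.subProg (R := R) (d := 16) (x := 13) (y := 15) (by omega) (by omega) (by omega)
    (fun r hr _ => hs2 r hr) hM2
  rw [show s2 13 = m.1.bits by simp [es2, es1, h13], show s2 15 = (m.1 - x).bits by simp [es2],
    val_bits, val_bits] at c3
  have hs3 := hs2.update (d := 16) (by omega) (m.1 - (m.1 - x)).bits
  have hM3 := hM2.update (d := 16) (sub1 (Nat.sub_le m.1 (m.1 - x)) hm1)
  set s3 := Function.update s2 16 (m.1 - (m.1 - x)).bits with es3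
  have c4 := Runs.subProg (R := R) (d := 17) (x := 14) (y := 15) (by omega) (by omega) (by omega)
    (fun r hr _ => hs3 r hr) hM3
  rw [show s3 14 = m.2.bits by simp [es3, es2, es1, h14],
    show s3 15 = (m.1 - x).bits by simp [es3, es2], val_bits, val_bits] at c4
  have hs4 := hs3.update (d := 17) (by omega) (m.2 - (m.1 - x)).bits
  have hM4 := hM3.update (d := 17) (sub1 (Nat.sub_le m.2 (m.1 - x)) hm2)
  set w := m.2 - (m.1 - x) with hw
  set s4 := Function.update s3 17 w.bits with es4
  have o4 : ∀ r < 15, s4 r = s r := by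
    intro r hr
    simp [es4, es3, es2, es1, show r ≠ 15 by omega, show r ≠ 16 by omega, show r ≠ 17 by omega,
      show r ≠ 19 by omega]
  have c5 := Runs.capProg (R := R) S.det (spec := 7) (by omega) hs4 hM4 (Runs.prepLetter hs4 hM4)
    (W := width C.n (slice (𝒮.lang C.hard) C.n) (h ++ [u])) (B := B₂)
    (by rw [o4 7 (by omega), o4 2 (by omega), o4 9 (by omega), o4 10 (by omega), h7, h2, h9, h10,
          hhist]; exact hB₂)
    (by rw [o4 7 (by omega), o4 2 (by omega), o4 9 (by omega), o4 10 (by omega), h7, h2, h9, h10,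
          hhist]; exact hB₂')
    (by rw [o4 5 (by omega), h5, val_bits]; exact S.widthHard _ hlu)
  rw [o4 5 (by omega), h5, val_bits] at c5
  change Runs R _ s4 (Function.update s4 19 y.bits) _ at c5
  have hs5 := hs4.update (d := 19) (by omega) y.bits
  have hM5 := hM4.update (d := 19) (S.widthHard _ hlu)
  rw [← hy] at hM5
  set s5 := Function.update s4 19 y.bits with es5
  have c6 := Runs.subProg (R := R) (d := 19) (x := 17) (y := 19) (by omega) (by omega) (by omega)
    (fun r hr _ => hs5 r hr) hM5
  rw [show s5 17 = w.bits by simp [es5, es4], show s5 19 = y.bits by simp [es5], val_bits,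
    val_bits] at c6
  have hw2 : w.bits.length ≤ M := sub1 (Nat.sub_le m.2 (m.1 - x)) hm2
  have hs6 := hs5.update (d := 19) (by omega) (w - y).bits
  have hM6 := hM5.update (d := 19) (sub1 (Nat.sub_le w y) hw2)
  set s6 := Function.update s5 19 (w - y).bits with es6
  have c7 := Runs.subProg (R := R) (d := 17) (x := 17) (y := 19) (by omega) (by omega) (by omega)
    (fun r hr _ => hs6 r hr) hM6
  rw [show s6 17 = w.bits by simp [es6, es5, es4], show s6 19 = (w - y).bits by simp [es6],
    val_bits, val_bits] at c7
  have hs7 := hs6.update (d := 17) (by omega) (w - (w - y)).bits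
  have hM7 := hM6.update (d := 17) (sub1 (Nat.sub_le w (w - y)) hw2)
  set s7 := Function.update s6 17 (w - (w - y)).bits with es7
  have c8 := Runs.subProg (R := R) (d := 18) (x := 14) (y := 17) (by omega) (by omega) (by omega)
    (fun r hr _ => hs7 r hr) hM7
  rw [show s7 14 = m.2.bits by
      rw [← h14, ← o4 14 (by omega)]; simp [es7, es6, es5], show s7 17 = (w - (w - y)).bits by simp [es7], val_bits,
    val_bits] at c8
  set s8 := Function.update s7 18 (m.2 - (w - (w - y))).bits with es8
  have c9 := Runs.clear (R := R) 19 s8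
  refine (c1.seq (c2.seq (c3.seq (c4.seq (c5.seq (c6.seq (c7.seq (c8.seq c9)))))))).cast ?_ ?_
  · funext r
    simp only [restStep, takeStep, ← hw]
    by_cases h19 : r = 19
    · subst h19; simp
    by_cases h18 : r = 18
    · subst h18; simp [es8]
    by_cases h17 : r = 17
    · subst h17; simp [es8, es7]
    by_cases h16 : r = 16
    · subst h16; simp [es8, es7, es6, es5, es4, es3]
    by_cases h15 : r = 15
    · subst h15; simp [es8, es7, es6, es5, es4, es3, es2]
    simp [es8, es7, es6, es5, es4, es3, es2, es1, h15, h16, h17, h18, h19]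
  · have : (s8 19).length ≤ M := by
      have : s8 19 = (w - y).bits := by simp [es8, es7, es6]
      rw [this]; exact sub1 (Nat.sub_le w y) hw2
    unfold allocCost capCost
    omega

/-- Replace the masses by the parts that are found in registers `x` and `y` after an allocation. -/
def adoptProg (P : Prog) (x y : ℕ) : Prog :=
  .seq (allocProg P) (.seq (subProg 13 x 30) (.seq (subProg 14 y 30)
    (.seq (clear 15) (.seq (clear 16) (.seq (clear 17) (clear 18))))))

/-- The constant part of the store. -/
structure Data where
  X : List Bool
  Y : List Bool
  N : List Bool
  EN : List Bool
  ED : List Bool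
  P : List Bool
  Q : List Bool
  Z : List Bool

/-- The store, with empty temporary registers. -/
def Data.store (d : Data) (H D U T N A C S F : List Bool) : Store :=
  inputStore [H, d.Y, d.N, d.EN, d.ED, d.P, d.Q, d.X, d.Z, D, U, T, N, A, C, [], [], [], [], [], S, F]

/-- The constant part of the store for the instance `C`. -/
def Instance.data (C : Instance 𝒮 𝒮) (EN ED : List Bool) (Z : 𝒮.Spec) : Data :=
  ⟨𝒮.code C.hard, 𝒮.code C.soft, List.replicate C.n true, EN, ED, C.rhoNum.bits, C.ρ.den.bits,
    𝒮.code Z⟩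

theorem Data.store_def (d : Data) (H D U T N A C S F : List Bool) :
    d.store H D U T N A C S F = inputStore [H, d.Y, d.N, d.EN, d.ED, d.P, d.Q, d.X, d.Z, D, U, T, N,
      A, C, [], [], [], [], [], S, F] := rfl

/-- The store after an allocation. -/
def Data.allocated (d : Data) (H D U T N A C r s t v S F : List Bool) : Store :=
  inputStore [H, d.Y, d.N, d.EN, d.ED, d.P, d.Q, d.X, d.Z, D, U, T, N, A, C, r, s, t, v, [], S, F]

theorem Data.clean (d : Data) (H D U T N A C S F : List Bool) :
    Clean (d.store H D U T N A C S F) := clean_inputStore (by simp)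

theorem Data.allocated_eq (d : Data) (H D U T N A C r s t v S F : List Bool) :
    (fun i => if i = 15 then r else if i = 16 then s else if i = 17 then t else if i = 18 then v
      else if i = 19 then [] else d.store H D U T N A C S F i)
      = d.allocated H D U T N A C r s t v S F := by
  funext i
  rcases i with _|_|_|_|_|_|_|_|_|_|_|_|_|_|_|_|_|_|_|_|i <;>
    simp [inputStore, Data.store, Data.allocated]

theorem Setting.runs_alloc_store (S : Setting e R C P Z M) {EN ED H D U T N S₀ F : List Bool}
    (hM : ∀ m : ℕ × ℕ, m.1 ≤ C.ρ.den → m.2 ≤ C.ρ.den → Small M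
      ((C.data EN ED Z).store H D U T N m.1.bits m.2.bits S₀ F))
    {h : List A} (hl : h.length < C.n) {j : ℕ} (hj : j < k) {m : ℕ × ℕ}
    (hm1 : m.1 ≤ C.ρ.den) (hm2 : m.2 ≤ C.ρ.den)
    (hD : D = (wordCode e h).reverse) (hU : U = List.replicate j true) :
    Runs R (allocProg P) ((C.data EN ED Z).store H D U T N m.1.bits m.2.bits S₀ F)
      ((C.data EN ED Z).allocated H D U T N m.1.bits m.2.bits
        (restStep (capOf e C.widthSoft h j) (capOf e C.widthHard h j) m).1.bits
        (takeStep (capOf e C.widthSoft h j) (capOf e C.widthHard h j) m).1.bits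
        (takeStep (capOf e C.widthSoft h j) (capOf e C.widthHard h j) m).2.bits
        (restStep (capOf e C.widthSoft h j) (capOf e C.widthHard h j) m).2.bits S₀ F)
      (allocCost P M) := by
  subst hD hU
  refine (S.runs_alloc (m := m) (Data.clean _ _ _ _ _ _ _ _ _ _) (hM m hm1 hm2) hl hj rfl rfl rfl
    rfl rfl rfl rfl rfl).cast ?_ le_rfl
  exact Data.allocated_eq _ _ _ _ _ _ _ _ _ _ _ _ _ _

/-- A bound for the cost of `adoptProg`. -/
def adoptCost (P : Prog) (M : ℕ) : ℕ := allocCost P M + 260 * M + 250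

/-- Registers `15` and `18` hold what is left when a letter is skipped, registers `16` and `17` what
the letter gets when it is accepted. Subtracting the empty register `30` copies the chosen pair. -/
theorem Setting.runs_adopt (S : Setting e R C P Z M) {EN ED H D U T N S₀ F : List Bool}
    (hM : ∀ m : ℕ × ℕ, m.1 ≤ C.ρ.den → m.2 ≤ C.ρ.den → Small M
      ((C.data EN ED Z).store H D U T N m.1.bits m.2.bits S₀ F))
    {h : List A} (hl : h.length < C.n) {j : ℕ} (hj : j < k) {m v : ℕ × ℕ}
    (hm1 : m.1 ≤ C.ρ.den) (hm2 : m.2 ≤ C.ρ.den)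
    (hD : D = (wordCode e h).reverse) (hU : U = List.replicate j true) {x y : ℕ}
    (hv : (x = 15 ∧ y = 18 ∧
        v = restStep (capOf e C.widthSoft h j) (capOf e C.widthHard h j) m) ∨
      (x = 16 ∧ y = 17 ∧ v = takeStep (capOf e C.widthSoft h j) (capOf e C.widthHard h j) m)) :
    Runs R (adoptProg P x y) ((C.data EN ED Z).store H D U T N m.1.bits m.2.bits S₀ F)
      ((C.data EN ED Z).store H D U T N v.1.bits v.2.bits S₀ F) (adoptCost P M) := by
  have h1 := S.runs_alloc_store hM hl hj hm1 hm2 hD hU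
  set rs := restStep (capOf e C.widthSoft h j) (capOf e C.widthHard h j) m with hrs
  set tk := takeStep (capOf e C.widthSoft h j) (capOf e C.widthHard h j) m with htk
  set d := C.data EN ED Z with hd
  have hle : rs.1 ≤ C.ρ.den ∧ rs.2 ≤ C.ρ.den ∧ tk.1 ≤ C.ρ.den ∧ tk.2 ≤ C.ρ.den := by
    simp only [hrs, htk, restStep, takeStep]; omega
  have hb : ∀ {a : ℕ}, a ≤ C.ρ.den → a.bits.length ≤ M :=
    fun h => (length_bits_mono h).trans S.rhoDen
  set s1 := d.allocated H D U T N m.1.bits m.2.bits rs.1.bits tk.1.bits tk.2.bits rs.2.bits S₀ F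
    with hs1
  have hM1 : Small M s1 := by
    rw [hs1, ← Data.allocated_eq]
    intro i
    have := hM m hm1 hm2 i
    simp only []
    split_ifs
    · exact hb hle.1
    · exact hb hle.2.2.1
    · exact hb hle.2.2.2
    · exact hb hle.2.1
    · simp
    · exact this
  have hc1 : Clean s1 := clean_inputStore (by simp)
  have hv1 : v.1 ≤ C.ρ.den ∧ v.2 ≤ C.ρ.den ∧ s1 x = v.1.bits ∧ s1 y = v.2.bits ∧ x < 22 ∧ y < 22 ∧
      x ≠ 13 ∧ y ≠ 13 := by
    rcases hv with ⟨rfl, rfl, rfl⟩ | ⟨rfl, rfl, rfl⟩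
    · exact ⟨hle.1, hle.2.1, rfl, rfl, by omega, by omega, by omega, by omega⟩
    · exact ⟨hle.2.2.1, hle.2.2.2, rfl, rfl, by omega, by omega, by omega, by omega⟩
  obtain ⟨g1, g2, g3, g4, g5, g6, g7, g8⟩ := hv1
  have h2 := Runs.subProg (R := R) (d := 13) (x := x) (y := 30) (by omega) (by omega) (by omega)
    (fun r hr _ => hc1 r hr) hM1
  rw [g3, hc1 30 (by omega), val_bits, val, Nat.sub_zero] at h2
  have hc2 := hc1.update (d := 13) (by omega) v.1.bits
  have hM2 := hM1.update (d := 13) (hb g1)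
  set s2 := Function.update s1 13 v.1.bits with hs2
  have h3 := Runs.subProg (R := R) (d := 14) (x := y) (y := 30) (by omega) (by omega) (by omega)
    (fun r hr _ => hc2 r hr) hM2
  rw [show s2 y = v.2.bits by rw [hs2, Function.update_of_ne g8, g4], hc2 30 (by omega), val_bits,
    val, Nat.sub_zero] at h3
  have hM3 := hM2.update (d := 14) (hb g2)
  set s3 := Function.update s2 14 v.2.bits with hs3
  have h4 := Runs.clear (R := R) 15 s3
  have hM4 := hM3.update (d := 15) (l := []) (by simp)
  set s4 := Function.update s3 15 [] with hs4
  have h5 := Runs.clear (R := R) 16 s4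
  have hM5 := hM4.update (d := 16) (l := []) (by simp)
  set s5 := Function.update s4 16 [] with hs5
  have h6 := Runs.clear (R := R) 17 s5
  have hM6 := hM5.update (d := 17) (l := []) (by simp)
  set s6 := Function.update s5 17 [] with hs6
  have h7 := Runs.clear (R := R) 18 s6
  refine (h1.seq (h2.seq (h3.seq (h4.seq (h5.seq (h6.seq h7)))))).cast ?_ ?_
  · simp [hs6, hs5, hs4, hs3, hs2, hs1, Data.allocated, Data.store, update_inputStore]
  · have := hM3 15
    have := hM4 16
    have := hM5 17
    have := hM6 18
    unfold adoptCost
    omega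

/-- The bits that represent whose turn it is after a history. -/
def turnBits (h : List A) : List Bool := if Even h.length then [] else [true]

/-- The store while the letter following the history `h` is being read: `H` is the remaining
input, `j` the number of skipped letters and `m` the remaining masses. -/
def Instance.reading (C : Instance 𝒮 𝒮) (e : A ≃ Fin k) (EN ED : List Bool) (Z : 𝒮.Spec)
    (H : List Bool) (h : List A) (j : ℕ) (m : ℕ × ℕ) (S F : List Bool) : Store :=
  (C.data EN ED Z).store H (wordCode e h).reverse (List.replicate j true) (turnBits h)
    (List.replicate (C.n - h.length) true) m.1.bits m.2.bits S F

theorem Setting.small_reading (S : Setting e R C P Z M) {EN ED H S₀ F : List Bool} {h : List A}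
    {j : ℕ} {m : ℕ × ℕ} (hEN : EN.length ≤ M) (hED : ED.length ≤ M) (hH : H.length ≤ M)
    (hh : h.length ≤ C.n) (hj : j ≤ k) (hm1 : m.1 ≤ C.ρ.den) (hm2 : m.2 ≤ C.ρ.den)
    (hS : S₀.length ≤ M) (hF : F.length ≤ M) (hM : 1 ≤ M) :
    Small M (C.reading e EN ED Z H h j m S₀ F) := by
  have hb : ∀ {a : ℕ}, a ≤ C.ρ.den → a.bits.length ≤ M :=
    fun h => (length_bits_mono h).trans S.rhoDen
  have ht : (turnBits h).length ≤ M := by unfold turnBits; split_ifs <;> simp [hM]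
  have := S.word h hh
  have := S.length
  have := S.letters
  have := hb hm1
  have := hb hm2
  have := S.codeHard
  have := S.codeSoft
  have := S.codeInter
  have := S.rhoNum
  have := S.rhoDen
  refine small_inputStore ?_
  simp only [Instance.data, List.forall_mem_cons, List.length_nil, List.length_reverse,
    List.length_replicate, List.not_mem_nil, false_imp_iff, implies_true, and_true]
  and_intros <;> omega

/-- Skip the current letter. -/
def skipProg (P : Prog) : Prog :=
  .seq (.branch 11 (adoptProg P 15 18) .nop .nop) (.push 10 true)

/-- Append the current letter to the history. -/
def acceptProg (P : Prog) : Prog :=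
  .seq (.branch 11 (adoptProg P 16 17) .nop .nop) (.seq (pour 10 [9]) (.seq (.push 9 false)
    (.seq (.pop 12) (.branch 11 (.push 11 true) (.pop 11) (.pop 11)))))

/-- Read the input in register `0`. -/
def readProg (P : Prog) : Prog :=
  .loop 0 (readBit 0 fun b => if b then skipProg P else acceptProg P)

/-- A bound for the cost of one iteration of `readProg`. -/
def readCost (P : Prog) (M : ℕ) : ℕ := adoptCost P M + 8 * M + 30

theorem reading_def (C : Instance 𝒮 𝒮) (e : A ≃ Fin k) (EN ED : List Bool) (Z : 𝒮.Spec)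
    (H : List Bool) (h : List A) (j : ℕ) (m : ℕ × ℕ) (S F : List Bool) :
    C.reading e EN ED Z H h j m S F = (C.data EN ED Z).store H (wordCode e h).reverse
      (List.replicate j true) (turnBits h) (List.replicate (C.n - h.length) true)
      m.1.bits m.2.bits S F := rfl

/-- Register `11` is empty exactly on our turn; otherwise no allocation takes place and the masses
are passed on. -/
theorem Setting.runs_turn (S : Setting e R C P Z M) {EN ED H S₀ F : List Bool} {h : List A}
    {j : ℕ} {m v : ℕ × ℕ} (hEN : EN.length ≤ M) (hED : ED.length ≤ M) (hH : H.length ≤ M)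
    (hl : h.length < C.n) (hj : j < k) (hm1 : m.1 ≤ C.ρ.den) (hm2 : m.2 ≤ C.ρ.den)
    (hS : S₀.length ≤ M) (hF : F.length ≤ M) (hM : 1 ≤ M) {x y : ℕ}
    (hv : (x = 15 ∧ y = 18 ∧
        v = restStep (capOf e C.widthSoft h j) (capOf e C.widthHard h j) m) ∨
      (x = 16 ∧ y = 17 ∧ v = takeStep (capOf e C.widthSoft h j) (capOf e C.widthHard h j) m)) :
    Runs R (.branch 11 (adoptProg P x y) .nop .nop) (C.reading e EN ED Z H h j m S₀ F)
      (C.reading e EN ED Z H h j (if Even h.length then v else m) S₀ F) (adoptCost P M + 1) := by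
  by_cases hev : Even h.length
  · rw [if_pos hev]
    refine .branch_nil ?_ (S.runs_adopt (fun m h1 h2 => ?_) hl hj hm1 hm2 rfl rfl hv)
    · change turnBits h = []
      simp [turnBits, hev]
    · exact S.small_reading (m := m) hEN hED hH hl.le hj.le h1 h2 hS hF hM
  · rw [if_neg hev]
    refine (Runs.branch_true (l := []) ?_ Runs.nop).mono (by unfold adoptCost; omega)
    change turnBits h = [true]
    simp [turnBits, hev]

theorem Setting.runs_skip (S : Setting e R C P Z M) {EN ED H S₀ F : List Bool} {h : List A}
    {j : ℕ} {m : ℕ × ℕ} (hEN : EN.length ≤ M) (hED : ED.length ≤ M) (hH : H.length ≤ M)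
    (hl : h.length < C.n) (hj : j < k) (hm1 : m.1 ≤ C.ρ.den) (hm2 : m.2 ≤ C.ρ.den)
    (hS : S₀.length ≤ M) (hF : F.length ≤ M) (hM : 1 ≤ M) :
    Runs R (skipProg P) (C.reading e EN ED Z H h j m S₀ F)
      (C.reading e EN ED Z H h (j + 1) (if Even h.length then
        restStep (capOf e C.widthSoft h j) (capOf e C.widthHard h j) m else m) S₀ F)
      (adoptCost P M + 3) := by
  refine ((S.runs_turn hEN hED hH hl hj hm1 hm2 hS hF hM (Or.inl ⟨rfl, rfl, rfl⟩)).seq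
    (Runs.push 10 true)).cast ?_ (by omega)
  rw [reading_def, reading_def, Data.store_def, Data.store_def, update_inputStore (by simp)]
  rfl

theorem Setting.runs_accept (S : Setting e R C P Z M) {EN ED H S₀ F : List Bool} {h : List A}
    {u : A} {m : ℕ × ℕ} (hEN : EN.length ≤ M) (hED : ED.length ≤ M) (hH : H.length ≤ M)
    (hl : h.length < C.n) (hm1 : m.1 ≤ C.ρ.den) (hm2 : m.2 ≤ C.ρ.den)
    (hS : S₀.length ≤ M) (hF : F.length ≤ M) (hM : 1 ≤ M) :
    Runs R (acceptProg P) (C.reading e EN ED Z H h (e u) m S₀ F)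
      (C.reading e EN ED Z H (h ++ [u]) 0 (if Even h.length then
        takeStep (capOf e C.widthSoft h (e u)) (capOf e C.widthHard h (e u)) m else m) S₀ F)
      (adoptCost P M + 7 * M + 20) := by
  have h1 := S.runs_turn hEN hED hH hl (e u).2 hm1 hm2 hS hF hM (Or.inr ⟨rfl, rfl, rfl⟩)
  set v := if Even h.length then
        takeStep (capOf e C.widthSoft h (e u)) (capOf e C.widthHard h (e u)) m else m with hv
  set d := C.data EN ED Z with hd
  set N := List.replicate (C.n - h.length) true with hN
  set D := (wordCode e h).reverse with hD
  set U := List.replicate (e u : ℕ) true with hU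
  have h2 : Runs R (pour 10 [9]) (C.reading e EN ED Z H h (e u) v S₀ F)
      (d.store H (U ++ D) [] (turnBits h) N v.1.bits v.2.bits S₀ F) (7 * M + 1) := by
    refine (Runs.pour (by simp) (by simp) _).cast ?_ ?_
    · rw [reading_def, Data.store_def, Data.store_def]
      funext i
      rcases i with _|_|_|_|_|_|_|_|_|_|_|i <;> simp [inputStore, hU, hD, hd]
      rfl
    · have : (C.reading e EN ED Z H h (e u) v S₀ F 10).length ≤ M := by
        change U.length ≤ M
        have := (e u).2
        have := S.letters
        rw [hU, List.length_replicate]; omega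
      simp only [List.length_cons, List.length_nil]
      omega
  have h3 := Runs.push (R := R) (s := d.store H (U ++ D) [] (turnBits h) N v.1.bits v.2.bits S₀ F)
    9 false
  have h4 := Runs.pop (R := R) (s := d.store H (false :: (U ++ D)) [] (turnBits h) N
    v.1.bits v.2.bits S₀ F) 12
  have e3 : Function.update (d.store H (U ++ D) [] (turnBits h) N v.1.bits v.2.bits S₀ F) 9
      (false :: (d.store H (U ++ D) [] (turnBits h) N v.1.bits v.2.bits S₀ F) 9)
      = d.store H (false :: (U ++ D)) [] (turnBits h) N v.1.bits v.2.bits S₀ F := by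
    rw [Data.store_def, update_inputStore (by simp)]; rfl
  have e4 : Function.update (d.store H (false :: (U ++ D)) [] (turnBits h) N v.1.bits v.2.bits S₀ F)
      12 ((d.store H (false :: (U ++ D)) [] (turnBits h) N v.1.bits v.2.bits S₀ F) 12).tail
      = d.store H (false :: (U ++ D)) [] (turnBits h) N.tail v.1.bits v.2.bits S₀ F := by
    rw [Data.store_def, update_inputStore (by simp)]; rfl
  rw [e3] at h3
  rw [e4] at h4
  have h5 : Runs R (.branch 11 (.push 11 true) (.pop 11) (.pop 11))
      (d.store H (false :: (U ++ D)) [] (turnBits h) N.tail v.1.bits v.2.bits S₀ F)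
      (d.store H (false :: (U ++ D)) [] (turnBits (h ++ [u])) N.tail v.1.bits v.2.bits S₀ F) 2 := by
    by_cases hev : Even h.length
    · refine (Runs.branch_nil ?_ (Runs.push 11 true)).cast ?_ le_rfl
      · change turnBits h = []
        simp [turnBits, hev]
      · rw [Data.store_def, update_inputStore (by simp)]
        simp [turnBits, hev, Nat.even_add_one, Data.store_def, inputStore]
    · refine (Runs.branch_cons ?_ (Runs.pop 11)).cast ?_ le_rfl
      · change turnBits h ≠ []
        simp [turnBits, hev]
      · rw [Data.store_def, update_inputStore (by simp)]
        simp [turnBits, hev, Nat.even_add_one, Data.store_def, inputStore]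
  refine (h1.seq (h2.seq (h3.seq (h4.seq h5)))).cast ?_ (by omega)
  rw [reading_def]
  congr 1
  · rw [wordCode_append]; simp [hU, hD]
  · simp [hN, Nat.sub_sub]

/-- In the unary code of a letter, each `true` means that one more letter is skipped in the greedy
allocation, and the final `false` that the current one is accepted. So reading the code performs the
allocation up to this letter; `j` letters have been skipped and `i` are still to be skipped. -/
theorem Setting.runs_read_letter (S : Setting e R C P Z M) {EN ED H S₀ F : List Bool} {h : List A}
    {u : A} {m : ℕ × ℕ} (hEN : EN.length ≤ M) (hED : ED.length ≤ M)
    (hl : h.length < C.n) (hm1 : m.1 ≤ C.ρ.den) (hm2 : m.2 ≤ C.ρ.den)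
    (hS : S₀.length ≤ M) (hF : F.length ≤ M) (hM : 1 ≤ M) {s' : Store} {B i j : ℕ}
    (hij : j + i = e u) (hH : i + 1 + H.length ≤ M)
    (hrest : Runs R (readProg P) (C.reading e EN ED Z H (h ++ [u]) 0
      (nextMass e C.widthSoft C.widthHard h m u) S₀ F) s' B) :
    Runs R (readProg P) (C.reading e EN ED Z (List.replicate i true ++ false :: H) h j
      (if Even h.length then rest (capOf e C.widthSoft h) (capOf e C.widthHard h) m j else m) S₀ F)
      s' ((i + 1) * (readCost P M + 1) + B) := by
  have hrle := rest_le (capOf e C.widthSoft h) (capOf e C.widthHard h) m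
  induction i generalizing j with
  | zero =>
    obtain rfl : j = e u := by omega
    set v := if Even h.length then rest (capOf e C.widthSoft h) (capOf e C.widthHard h) m (e u)
      else m with hv
    have hv1 : v.1 ≤ C.ρ.den ∧ v.2 ≤ C.ρ.den := by
      have := hrle (e u)
      rw [hv]; split_ifs <;> omega
    have h1 := S.runs_accept (u := u) (H := H) hEN hED (by omega) hl hv1.1 hv1.2 hS hF hM
    have hnext : (if Even h.length then
        takeStep (capOf e C.widthSoft h (e u)) (capOf e C.widthHard h (e u)) v else v)
        = nextMass e C.widthSoft C.widthHard h m u := by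
      unfold nextMass take
      by_cases hev : Even h.length <;> simp [hev, hv]
    rw [hnext] at h1
    have h2 : Runs R (readBit 0 fun b => if b then skipProg P else acceptProg P)
        (C.reading e EN ED Z (List.replicate 0 true ++ false :: H) h (e u) v S₀ F)
        (C.reading e EN ED Z H (h ++ [u]) 0 (nextMass e C.widthSoft C.widthHard h m u) S₀ F)
        (adoptCost P M + 7 * M + 20 + 3) := by
      refine Runs.readBit ?_
      rw [reading_def, Data.store_def, update_inputStore (by simp)]
      exact h1
    refine (Runs.loop_cons ?_ h2 hrest).mono ?_
    · exact List.cons_ne_nil _ _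
    · unfold readCost; omega
  | succ i ih =>
    set v := if Even h.length then rest (capOf e C.widthSoft h) (capOf e C.widthHard h) m j
      else m with hv
    have hv1 : v.1 ≤ C.ρ.den ∧ v.2 ≤ C.ρ.den := by
      have := hrle j
      rw [hv]; split_ifs <;> omega
    have h1 := S.runs_skip (j := j) (H := List.replicate i true ++ false :: H) hEN hED
      (by simp; omega) hl (by have := (e u).2; omega) hv1.1 hv1.2 hS hF hM
    have hnext : (if Even h.length then
        restStep (capOf e C.widthSoft h j) (capOf e C.widthHard h j) v else v)
        = if Even h.length then rest (capOf e C.widthSoft h) (capOf e C.widthHard h) m (j + 1)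
          else m := by
      by_cases hev : Even h.length <;> simp [hev, hv, rest]
    rw [hnext] at h1
    have h2 : Runs R (readBit 0 fun b => if b then skipProg P else acceptProg P)
        (C.reading e EN ED Z (List.replicate (i + 1) true ++ false :: H) h j v S₀ F)
        (C.reading e EN ED Z (List.replicate i true ++ false :: H) h (j + 1)
          (if Even h.length then rest (capOf e C.widthSoft h) (capOf e C.widthHard h) m (j + 1)
            else m) S₀ F) (adoptCost P M + 3 + 3) := by
      refine Runs.readBit ?_
      rw [reading_def, Data.store_def, update_inputStore (by simp)]
      exact h1
    refine (Runs.loop_cons ?_ h2 (ih (by omega) (by omega))).mono ?_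
    · exact List.cons_ne_nil _ _
    · have := Nat.add_one_mul (i + 1) (readCost P M + 1)
      have : adoptCost P M + 3 + 3 ≤ readCost P M := by unfold readCost; omega
      omega

theorem Setting.runs_read (S : Setting e R C P Z M) {EN ED S₀ F : List Bool} {m : ℕ × ℕ}
    (hEN : EN.length ≤ M) (hED : ED.length ≤ M) (hm1 : m.1 ≤ C.ρ.den) (hm2 : m.2 ≤ C.ρ.den)
    (hS : S₀.length ≤ M) (hF : F.length ≤ M) (hM : 1 ≤ M) (w : List A) :
    ∀ h : List A, h.length + w.length ≤ C.n →
    Runs R (readProg P)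
      (C.reading e EN ED Z (wordCode e w) h 0 (mass e C.widthSoft C.widthHard m h) S₀ F)
      (C.reading e EN ED Z [] (h ++ w) 0 (mass e C.widthSoft C.widthHard m (h ++ w)) S₀ F)
      ((wordCode e w).length * (readCost P M + 1) + 1) := by
  have hmle := fun h => mass_le e C.widthSoft C.widthHard hm1 hm2 h
  induction w with
  | nil =>
    intro h _
    refine (Runs.loop_nil ?_).cast ?_ (by omega)
    · rfl
    · simp [wordCode]
  | cons u w ih =>
    intro h hl
    simp only [List.length_cons] at hl
    have h1 := ih (h ++ [u]) (by simp; omega)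
    rw [mass_append] at h1
    have hlen : (wordCode e (u :: w)).length = e u + 1 + (wordCode e w).length := by
      simp [wordCode, letterCode, unaryCode]; omega
    have h2 := S.runs_read_letter (H := wordCode e w) (i := e u) (j := 0) hEN hED
      (show h.length < C.n by omega) (hmle h).1 (hmle h).2 hS hF hM (by omega)
      (by rw [← hlen]; exact S.word _ (by simp; omega)) h1
    have h3 : wordCode e (u :: w) = List.replicate (e u) true ++ false :: wordCode e w := by
      simp [wordCode, letterCode, unaryCode]
    have h4 : (if Even h.length then rest (capOf e C.widthSoft h) (capOf e C.widthHard h)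
        (mass e C.widthSoft C.widthHard m h) 0 else mass e C.widthSoft C.widthHard m h)
        = mass e C.widthSoft C.widthHard m h := by split_ifs <;> rfl
    rw [h4, ← h3] at h2
    refine h2.cast ?_ ?_
    · simp
    · rw [hlen, Nat.add_mul (e u + 1)]
      omega

end

/-! ## The improvisation scheme -/

/-- Compute the intersection of the specifications and the masses allotted to the empty history. -/
def initProg (I P : Prog) : Prog :=
  .seq (copy 2 [12]) (.seq (interProg I) (.seq (capProg P .nop 8) (.seq (subProg 15 6 19)
    (.seq (subProg 13 6 15) (.seq (subProg 14 6 30) (.seq (clear 15) (clear 19)))))))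

/-- A bound for the cost of `initProg`. -/
def initCost (I P : Prog) (M : ℕ) : ℕ := callCost I M + capCost P M + 440 * M + 410

/-- Push the word `l` on register `r`. -/
def pushList (r : ℕ) : List Bool → Prog
  | [] => .nop
  | b :: l => .seq (pushList r l) (.push r b)

theorem Runs.pushList {R : Resource} (r : ℕ) (l : List Bool) (s : Store) :
    Runs R (RCI.pushList r l) s (Function.update s r (l ++ s r)) (2 * l.length + 1) := by
  induction l with
  | nil => refine Runs.nop.cast ?_ (by omega); simp
  | cons b l ih =>
    refine (ih.seq (Runs.push r b)).cast ?_ (by simp only [List.length_cons]; omega)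
    simp

/-- The program that pushes the word `l` on register `r` and continues with `p`. -/
def loadProg (r : ℕ) : List Bool → Prog → Prog
  | [], p => p
  | b :: l, p => loadProg r l (.seq (.push r b) p)

/-- Given the code of `p` in register `0`, replace it by the code of the program that loads the
contents of register `r` and continues with `p`. -/
def emitProg (r : ℕ) : Prog :=
  .loop r (readBit r fun b =>
    pushList 0 ([true, false, false] ++ ([false, false, true, b] ++ unaryCode r)))

/-- The code of `seq (push r b) p` is a fixed prefix followed by the code of `p`, so wrapping a
program amounts to pushing `r + 8` bits. The bits of the register are taken from the top, as in
`loadProg`, so the emitted program pushes the bottom bit first. -/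
theorem Runs.emitProg {R : Resource} {r : ℕ} (hr : r ≠ 0) {s : Store} {p : Prog}
    (h0 : s 0 = p.encode) :
    Runs R (RCI.emitProg r) s
      (Function.update (Function.update s r []) 0 (loadProg r (s r) p).encode)
      ((s r).length * (2 * r + 21) + 1) := by
  generalize hl : s r = l
  induction l generalizing s p with
  | nil =>
    refine (Runs.loop_nil hl).cast ?_ (by omega)
    rw [loadProg, ← h0, ← hl, Function.update_eq_self, Function.update_eq_self]
  | cons b l ih =>
    have h1 := Runs.pushList (R := R) 0
      ([true, false, false] ++ ([false, false, true, b] ++ unaryCode r)) (Function.update s r l)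
    have h2 := Runs.readBit (R := R) (r := r) (k := fun b =>
      RCI.pushList 0 ([true, false, false] ++ ([false, false, true, b] ++ unaryCode r))) (s := s)
      (by simpa [hl] using h1)
    refine (Runs.loop_cons (by simp [hl]) h2 (ih (p := .seq (.push r b) p) ?_ ?_)).cast ?_ ?_
    · simp [hr.symm, h0, Prog.encode]
    · simp [hr]
    · funext x
      by_cases h0 : x = 0
      · subst h0; simp [loadProg]
      · by_cases hx : x = r <;> simp [h0, hx, hr]
    · have := Nat.add_one_mul l.length (2 * r + 21)
      simp only [List.length_cons, List.length_append, List.length_nil, unaryCode,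
        List.length_replicate] at *
      omega

/-- Output the code of the improviser that loads the instance and continues with `F`. -/
def outputProg (F : Prog) : Prog :=
  .seq (pushList 0 F.encode) (.seq (emitProg 7) (.seq (emitProg 1) (.seq (emitProg 2)
    (.seq (emitProg 5) (.seq (emitProg 6) (.push 0 true))))))

/-- The improvisation scheme that uses the algorithms `I` and `P` for intersection and width
measurement; its improvisers load the instance and continue with `F`. -/
def schemeProg (I P F : Prog) : Prog :=
  .seq (pour 0 [22]) (.seq (pour 22 [7]) (.seq (initProg I P) (.seq (capProg P .nop 7)
    (.seq (subProg 15 6 19) (.seq (subProg 16 4 3) (.seq (mulProg 16 16 6) (.seq (mulProg 17 4 13)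
      (.seq (subProg 16 16 17) (.branch 15 (.branch 16 (outputProg F) (.push 0 false)
        (.push 0 false)) (.push 0 false) (.push 0 false))))))))))

section

variable {A : Type*} {k : ℕ} {e : A ≃ Fin k} [Fintype A] {𝒮 : SpecClass A}
  {R : Resource} {C : Instance 𝒮 𝒮} {P : Prog} {Z : 𝒮.Spec} {M : ℕ}

/-- The store that contains the instance only. -/
def Instance.loaded (C : Instance 𝒮 𝒮) (H EN ED : List Bool) : Store :=
  inputStore [H, 𝒮.code C.soft, List.replicate C.n true, EN, ED, C.rhoNum.bits, C.ρ.den.bits,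
    𝒮.code C.hard]

/-- The improviser for `C` that continues with `F` after loading the instance. -/
def Instance.improviser (C : Instance 𝒮 𝒮) (F : Prog) : Prog :=
  loadProg 6 C.ρ.den.bits (loadProg 5 C.rhoNum.bits (loadProg 2 (List.replicate C.n true)
    (loadProg 1 (𝒮.code C.soft) (loadProg 7 (𝒮.code C.hard) F))))

theorem Setting.runs_init (S : Setting e R C P Z M) {I : Prog} (hI : I.Deterministic) {B : ℕ}
    (hZ : I.Computes R [𝒮.code C.hard, 𝒮.code C.soft] (𝒮.code Z) B)
    (hB : B + inputSize [𝒮.code C.hard, 𝒮.code C.soft] ≤ M) {H EN ED : List Bool}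
    (hH : H.length ≤ M) (hEN : EN.length ≤ M) (hED : ED.length ≤ M) :
    Runs R (initProg I P) (C.loaded H EN ED) (C.reading e EN ED Z H [] 0 C.initial [] [])
      (initCost I P M) := by
  have hb : ∀ {a : ℕ}, a ≤ C.ρ.den → a.bits.length ≤ M :=
    fun h => (length_bits_mono h).trans S.rhoDen
  have hsmall : ∀ Z' N A₀ C₀ r₁ r₂ : List Bool, Z'.length ≤ M → N.length ≤ M → A₀.length ≤ M →
      C₀.length ≤ M → r₁.length ≤ M → r₂.length ≤ M →
      Small M (inputStore [H, 𝒮.code C.soft, List.replicate C.n true, EN, ED, C.rhoNum.bits,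
        C.ρ.den.bits, 𝒮.code C.hard, Z', [], [], [], N, A₀, C₀, r₁, [], [], [], r₂]) := by
    intro Z' N A₀ C₀ r₁ r₂ h1 h2 h3 h4 h5 h6
    have := S.length
    have := S.codeHard
    have := S.codeSoft
    have := S.rhoNum
    have := S.rhoDen
    refine small_inputStore ?_
    simp only [List.forall_mem_cons, List.length_nil,
      List.length_replicate, List.not_mem_nil, false_imp_iff, implies_true, and_true]
    and_intros <;> omega
  have hclean : ∀ Z' N A₀ C₀ r₁ r₂ : List Bool,
      Clean (inputStore [H, 𝒮.code C.soft, List.replicate C.n true, EN, ED, C.rhoNum.bits,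
        C.ρ.den.bits, 𝒮.code C.hard, Z', [], [], [], N, A₀, C₀, r₁, [], [], [], r₂]) :=
    fun _ _ _ _ _ _ => clean_inputStore (by simp)
  set st : List Bool → List Bool → List Bool → List Bool → List Bool → List Bool → Store :=
    fun Z' N A₀ C₀ r₁ r₂ => inputStore [H, 𝒮.code C.soft, List.replicate C.n true, EN, ED,
      C.rhoNum.bits, C.ρ.den.bits, 𝒮.code C.hard, Z', [], [], [], N, A₀, C₀, r₁, [], [], [], r₂]
    with hst
  have hN : (List.replicate C.n true).length ≤ M := by simpa using S.length
  have hload : C.loaded H EN ED = st [] [] [] [] [] [] := by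
    funext i
    rcases i with _|_|_|_|_|_|_|_|_|_|_|_|_|_|_|_|_|_|_|_|_|i <;> simp [hst, inputStore, Instance.loaded]
  have h1 : Runs R (copy 2 [12]) (C.loaded H EN ED) (st [] (List.replicate C.n true) [] [] [] [])
      (16 * M + 3) := by
    rw [hload]
    refine (Runs.copy (by omega) (by simp) (by simp) rfl).cast ?_ ?_
    · funext i
      rcases i with _|_|_|_|_|_|_|_|_|_|_|_|_|_|_|_|_|_|_|_|_|i <;> simp [hst, inputStore]
    · have : (st [] [] [] [] [] [] 2).length ≤ M := hN
      simp only [List.length_cons, List.length_nil]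
      omega
  set s1 := st [] (List.replicate C.n true) [] [] [] [] with hs1
  have h2 := Runs.interProg (R := R) (P := I) hI (s := s1) (M := M) (hclean _ _ _ _ _ _)
    (hsmall _ _ _ _ _ _ (by simp) hN (by simp) (by simp) (by simp) (by simp)) hZ hB
  have e2 : Function.update s1 8 (𝒮.code Z)
      = st (𝒮.code Z) (List.replicate C.n true) [] [] [] [] := by
    simp only [hs1, hst]; rw [update_inputStore (by simp)]; rfl
  rw [e2] at h2
  set s2 := st (𝒮.code Z) (List.replicate C.n true) [] [] [] [] with hs2
  have hM2 : Small M s2 := hsmall _ _ _ _ _ _ S.codeInter hN (by simp) (by simp) (by simp) (by simp)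
  obtain ⟨B', hB', hB''⟩ := S.soft [] (by simp)
  have h3 := Runs.capProg (R := R) S.det (prep := .nop) (spec := 8) (by omega) (s := s2) (M := M)
    (hist := []) (C := 1) (hclean _ _ _ _ _ _) hM2
    (Runs.nop.cast (by
      have : s2 33 = [] := rfl
      rw [← this, Function.update_eq_self]) le_rfl) hB' hB''
    (by change (val C.rhoNum.bits * _).bits.length ≤ M
        rw [val_bits]; exact S.widthSoft [] (by simp))
  have e3 : Function.update s2 19 (val (s2 5) *
      width C.n (slice (𝒮.lang C.hard ∩ 𝒮.lang C.soft) C.n) []).bits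
      = st (𝒮.code Z) (List.replicate C.n true) [] [] [] (C.widthSoft []).bits := by
    change Function.update s2 19 (val C.rhoNum.bits * _).bits = _
    rw [val_bits]
    simp only [hs2, hst]; rw [update_inputStore (by simp)]; rfl
  rw [e3] at h3
  set w := C.widthSoft [] with hw
  set q := C.ρ.den with hq
  have hM3 : Small M (st (𝒮.code Z) (List.replicate C.n true) [] [] [] w.bits) :=
    hsmall _ _ _ _ _ _ S.codeInter hN (by simp) (by simp) (by simp) (S.widthSoft [] (by simp))
  have h4 := Runs.subProg (R := R) (d := 15) (x := 6) (y := 19) (by omega) (by omega) (by omega)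
    (fun r hr _ => hclean (𝒮.code Z) (List.replicate C.n true) [] [] [] w.bits r hr) hM3
  have e4 : Function.update (st (𝒮.code Z) (List.replicate C.n true) [] [] [] w.bits) 15
      (val (st (𝒮.code Z) (List.replicate C.n true) [] [] [] w.bits 6) -
        val (st (𝒮.code Z) (List.replicate C.n true) [] [] [] w.bits 19)).bits
      = st (𝒮.code Z) (List.replicate C.n true) [] [] (q - w).bits w.bits := by
    change Function.update (_ : Store) 15 (val q.bits - val w.bits).bits = _
    rw [val_bits, val_bits]
    simp only [hst]; rw [update_inputStore (by simp)]; rfl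
  rw [e4] at h4
  have hM4 : Small M (st (𝒮.code Z) (List.replicate C.n true) [] [] (q - w).bits w.bits) :=
    hsmall _ _ _ _ _ _ S.codeInter hN (by simp) (by simp) (hb (Nat.sub_le _ _))
      (S.widthSoft [] (by simp))
  have h5 := Runs.subProg (R := R) (d := 13) (x := 6) (y := 15) (by omega) (by omega) (by omega)
    (fun r hr _ => hclean (𝒮.code Z) (List.replicate C.n true) [] [] (q - w).bits w.bits r hr) hM4
  have e5 : Function.update (st (𝒮.code Z) (List.replicate C.n true) [] [] (q - w).bits w.bits) 13
      (val (st (𝒮.code Z) (List.replicate C.n true) [] [] (q - w).bits w.bits 6) -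
        val (st (𝒮.code Z) (List.replicate C.n true) [] [] (q - w).bits w.bits 15)).bits
      = st (𝒮.code Z) (List.replicate C.n true) (q - (q - w)).bits [] (q - w).bits w.bits := by
    change Function.update (_ : Store) 13 (val q.bits - val (q - w).bits).bits = _
    rw [val_bits, val_bits]
    simp only [hst]; rw [update_inputStore (by simp)]; rfl
  rw [e5] at h5
  set a := q - (q - w) with ha
  have hM5 : Small M (st (𝒮.code Z) (List.replicate C.n true) a.bits [] (q - w).bits w.bits) :=
    hsmall _ _ _ _ _ _ S.codeInter hN (hb (Nat.sub_le _ _)) (by simp) (hb (Nat.sub_le _ _))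
      (S.widthSoft [] (by simp))
  have h6 := Runs.subProg (R := R) (d := 14) (x := 6) (y := 30) (by omega) (by omega) (by omega)
    (fun r hr _ => hclean (𝒮.code Z) (List.replicate C.n true) a.bits [] (q - w).bits w.bits r hr)
    hM5
  have e6 : Function.update (st (𝒮.code Z) (List.replicate C.n true) a.bits [] (q - w).bits w.bits)
      14 (val (st (𝒮.code Z) (List.replicate C.n true) a.bits [] (q - w).bits w.bits 6) -
        val (st (𝒮.code Z) (List.replicate C.n true) a.bits [] (q - w).bits w.bits 30)).bits
      = st (𝒮.code Z) (List.replicate C.n true) a.bits q.bits (q - w).bits w.bits := by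
    change Function.update (_ : Store) 14 (val q.bits - 0).bits = _
    rw [val_bits, Nat.sub_zero]
    simp only [hst]; rw [update_inputStore (by simp)]; rfl
  rw [e6] at h6
  have h7 := Runs.clear (R := R) 15
    (st (𝒮.code Z) (List.replicate C.n true) a.bits q.bits (q - w).bits w.bits)
  have e7 : Function.update
      (st (𝒮.code Z) (List.replicate C.n true) a.bits q.bits (q - w).bits w.bits) 15 []
      = st (𝒮.code Z) (List.replicate C.n true) a.bits q.bits [] w.bits := by
    simp only [hst]; rw [update_inputStore (by simp)]; rfl
  rw [e7] at h7
  have h8 := Runs.clear (R := R) 19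
    (st (𝒮.code Z) (List.replicate C.n true) a.bits q.bits [] w.bits)
  refine (h1.seq (h2.seq (h3.seq (h4.seq (h5.seq (h6.seq (h7.seq h8))))))).cast ?_ ?_
  · simp only [hst]
    rw [update_inputStore (by simp)]
    funext i
    rcases i with _|_|_|_|_|_|_|_|_|_|_|_|_|_|_|_|_|_|_|_|_|_|i <;>
      simp [inputStore, Instance.reading, Instance.data, Data.store, wordCode, turnBits,
        Instance.initial, ha, hq, hw]
  · have l1 : (st (𝒮.code Z) (List.replicate C.n true) a.bits q.bits (q - w).bits w.bits 15).length
        ≤ M := hb (Nat.sub_le q w)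
    have l2 : (st (𝒮.code Z) (List.replicate C.n true) a.bits q.bits [] w.bits 19).length
        ≤ M := S.widthSoft [] (by simp)
    unfold initCost capCost
    omega

/-- A bound for the cost of `outputProg`, where `L` is the length of the code of `F`. -/
def outputCost (L M : ℕ) : ℕ := 2 * L + 160 * M + 20

theorem Instance.runs_output {s : Store} (F : Prog) (hM : Small M s)
    (h0 : s 0 = []) (h1 : s 1 = 𝒮.code C.soft) (h2 : s 2 = List.replicate C.n true)
    (h5 : s 5 = C.rhoNum.bits) (h6 : s 6 = C.ρ.den.bits) (h7 : s 7 = 𝒮.code C.hard) :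
    ∃ s', s' 0 = encodeResult (some (C.improviser F)) ∧
      Runs R (outputProg F) s s' (outputCost F.encode.length M) := by
  have r1 := Runs.pushList (R := R) 0 F.encode s
  rw [h0, List.append_nil] at r1
  set s1 := Function.update s 0 F.encode with hs1
  have r2 := Runs.emitProg (R := R) (r := 7) (by omega) (s := s1) (p := F) (by simp [hs1])
  have x2 : s1 7 = 𝒮.code C.hard := by simp [hs1, h7]
  rw [x2] at r2
  set F2 := loadProg 7 (𝒮.code C.hard) F with hF2
  set s2 := Function.update (Function.update s1 7 []) 0 F2.encode with hs2
  have r3 := Runs.emitProg (R := R) (r := 1) (by omega) (s := s2) (p := F2) (by simp [hs2])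
  have x3 : s2 1 = 𝒮.code C.soft := by simp [hs2, hs1, h1]
  rw [x3] at r3
  set F3 := loadProg 1 (𝒮.code C.soft) F2 with hF3
  set s3 := Function.update (Function.update s2 1 []) 0 F3.encode with hs3
  have r4 := Runs.emitProg (R := R) (r := 2) (by omega) (s := s3) (p := F3) (by simp [hs3])
  have x4 : s3 2 = List.replicate C.n true := by simp [hs3, hs2, hs1, h2]
  rw [x4] at r4
  set F4 := loadProg 2 (List.replicate C.n true) F3 with hF4
  set s4 := Function.update (Function.update s3 2 []) 0 F4.encode with hs4
  have r5 := Runs.emitProg (R := R) (r := 5) (by omega) (s := s4) (p := F4) (by simp [hs4])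
  have x5 : s4 5 = C.rhoNum.bits := by simp [hs4, hs3, hs2, hs1, h5]
  rw [x5] at r5
  set F5 := loadProg 5 C.rhoNum.bits F4 with hF5
  set s5 := Function.update (Function.update s4 5 []) 0 F5.encode with hs5
  have r6 := Runs.emitProg (R := R) (r := 6) (by omega) (s := s5) (p := F5) (by simp [hs5])
  have x6 : s5 6 = C.ρ.den.bits := by simp [hs5, hs4, hs3, hs2, hs1, h6]
  rw [x6] at r6
  have r7 := Runs.push (R := R) (s := Function.update (Function.update s5 6 []) 0
    (loadProg 6 C.ρ.den.bits F5).encode) 0 true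
  refine ⟨_, ?_, (r1.seq (r2.seq (r3.seq (r4.seq (r5.seq (r6.seq r7)))))).mono ?_⟩
  · simp [encodeResult, Instance.improviser, hF5, hF4, hF3, hF2]
  · have l1 := hM 1
    have l2 := hM 2
    have l5 := hM 5
    have l6 := hM 6
    have l7 := hM 7
    rw [h1] at l1
    rw [h2] at l2
    rw [h5] at l5
    rw [h6] at l6
    rw [h7] at l7
    unfold outputCost
    omega

open Classical in
/-- The function computed by the scheme. -/
noncomputable def Instance.result (C : Instance 𝒮 𝒮) (F : Prog) : Option Prog :=
  if C.Feasible then some (C.improviser F) else none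

/-- A bound for the cost of `schemeProg`. -/
def schemeCost (I P : Prog) (L M : ℕ) : ℕ :=
  initCost I P M + capCost P M + outputCost L M + 240 * M * M + 1000 * M + 900

theorem inputs_eq (C : Instance 𝒮 𝒮) : C.inputs = [𝒮.code C.hard, 𝒮.code C.soft,
    List.replicate C.n true, C.epsNum.bits, C.ε.den.bits, C.rhoNum.bits, C.ρ.den.bits] := rfl

theorem Setting.runs_scheme (S : Setting e R C P Z M) {I : Prog} (hI : I.Deterministic) {B : ℕ}
    (hZ : I.Computes R [𝒮.code C.hard, 𝒮.code C.soft] (𝒮.code Z) B)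
    (hB : B + inputSize [𝒮.code C.hard, 𝒮.code C.soft] ≤ M)
    (hprod : C.ε.den.bits.length + C.ρ.den.bits.length ≤ M) (hM1 : 1 ≤ M) (F : Prog) :
    ∃ s', s' 0 = encodeResult (C.result F) ∧
      Runs R (schemeProg I P F) (inputStore C.inputs) s' (schemeCost I P F.encode.length M) := by
  have hb : ∀ {a : ℕ}, a ≤ C.ρ.den → a.bits.length ≤ M :=
    fun h => (length_bits_mono h).trans S.rhoDen
  -- The code of the hard specification moves from register `0` to register `7`, because register
  -- `0` is reserved for the history in the improvisers and for the output. Two pours preserve its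
  -- order.
  have r1 := Runs.pour (R := R) (src := 0) (ds := [22]) (by simp) (by simp) (inputStore C.inputs)
  set s1 : Store := fun r => if r = 0 then [] else if r ∈ [22] then
    (inputStore C.inputs 0).reverse ++ inputStore C.inputs r else inputStore C.inputs r with hs1
  have r2 := Runs.pour (R := R) (src := 22) (ds := [7]) (by simp) (by simp) s1
  have e2 : (fun r => if r = 22 then [] else if r ∈ [7] then (s1 22).reverse ++ s1 r else s1 r)
      = C.loaded [] C.epsNum.bits C.ε.den.bits := by
    rw [hs1, inputs_eq]
    funext i
    rcases i with _|_|_|_|_|_|_|_|i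
    · rfl
    · rfl
    · rfl
    · rfl
    · rfl
    · rfl
    · rfl
    · simp [inputStore, Instance.loaded]
    · simp only [inputStore, Instance.loaded]
      simp
      try omega
  rw [e2] at r2
  have l22 : (s1 22).length ≤ M := by
    have : s1 22 = (𝒮.code C.hard).reverse := by simp [hs1, inputs_eq, inputStore]
    rw [this, List.length_reverse]; exact S.codeHard
  have l0 : (inputStore C.inputs 0).length ≤ M := S.codeHard
  have r3 := S.runs_init hI hZ hB (H := []) (by simp) S.epsNum S.epsDen
  set s3 := C.reading e C.epsNum.bits C.ε.den.bits Z [] [] 0 C.initial [] [] with hs3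
  have hinit : C.initial.1 ≤ C.ρ.den ∧ C.initial.2 ≤ C.ρ.den := by simp [Instance.initial]
  have hM3 : Small M s3 := S.small_reading S.epsNum S.epsDen (by simp) (by simp) (by simp) hinit.1
    hinit.2 (by simp) (by simp) hM1
  have hc3 : Clean s3 := Data.clean _ _ _ _ _ _ _ _ _ _
  have s3_3 : s3 3 = C.epsNum.bits := rfl
  have s3_4 : s3 4 = C.ε.den.bits := rfl
  have s3_5 : s3 5 = C.rhoNum.bits := rfl
  have s3_6 : s3 6 = C.ρ.den.bits := rfl
  have s3_13 : s3 13 = C.initial.1.bits := rfl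
  obtain ⟨B', hB', hB''⟩ := S.hard [] (by simp)
  have r4 := Runs.capProg (R := R) S.det (prep := .nop) (spec := 7) (by omega) (s := s3) (M := M)
    (hist := []) (C := 1) hc3 hM3
    (Runs.nop.cast (by
      have : s3 33 = [] := rfl
      rw [← this, Function.update_eq_self]) le_rfl) hB' hB''
    (by rw [s3_5, val_bits]; exact S.widthHard [] (by simp))
  rw [s3_5, val_bits] at r4
  change Runs R _ s3 (Function.update s3 19 (C.widthHard []).bits) _ at r4
  set w := C.widthHard [] with hw
  have hM4 := hM3.update (d := 19) (S.widthHard [] (by simp))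
  have hc4 := hc3.update (d := 19) (by omega) w.bits
  rw [← hw] at hM4
  set s4 := Function.update s3 19 w.bits with hs4
  have r5 := Runs.subProg (R := R) (d := 15) (x := 6) (y := 19) (by omega) (by omega) (by omega)
    (fun r hr _ => hc4 r hr) hM4
  rw [show s4 6 = C.ρ.den.bits by simp [hs4, s3_6], show s4 19 = w.bits by simp [hs4], val_bits,
    val_bits] at r5
  have hM5 := hM4.update (d := 15) (hb (Nat.sub_le C.ρ.den w))
  have hc5 := hc4.update (d := 15) (by omega) (C.ρ.den - w).bits
  set s5 := Function.update s4 15 (C.ρ.den - w).bits with hs5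
  have r6 := Runs.subProg (R := R) (d := 16) (x := 4) (y := 3) (by omega) (by omega) (by omega)
    (fun r hr _ => hc5 r hr) hM5
  rw [show s5 4 = C.ε.den.bits by simp [hs5, hs4, s3_4],
    show s5 3 = C.epsNum.bits by simp [hs5, hs4, s3_3], val_bits, val_bits] at r6
  set x := C.ε.den - C.epsNum with hx
  have lx : x.bits.length ≤ C.ε.den.bits.length := length_bits_mono (Nat.sub_le _ _)
  have hM6 := hM5.update (d := 16) (lx.trans S.epsDen)
  have hc6 := hc5.update (d := 16) (by omega) x.bits
  set s6 := Function.update s5 16 x.bits with hs6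
  -- Here `hprod` is needed: both sides of the soft criterion are products of numbers bounded by the
  -- two denominators.
  have lxq : (x * C.ρ.den).bits.length ≤ M := (length_bits_mul_le _ _).trans (by omega)
  have s6_16 : s6 16 = x.bits := by simp [hs6]
  have s6_6 : s6 6 = C.ρ.den.bits := by simp [hs6, hs5, hs4, s3_6]
  have r7 := Runs.mulProg (R := R) (d := 16) (x := 16) (y := 6) (by omega) (by omega) (by omega)
    hc6 hM6 (by rw [s6_16, s6_6, val_bits, val_bits]; exact lxq)
  rw [s6_16, s6_6, val_bits, val_bits] at r7
  have hM7 := hM6.update (d := 16) lxq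
  have hc7 := hc6.update (d := 16) (by omega) (x * C.ρ.den).bits
  set s7 := Function.update s6 16 (x * C.ρ.den).bits with hs7
  have ly : (C.ε.den * C.initial.1).bits.length ≤ M :=
    (length_bits_mul_le _ _).trans (by have := length_bits_mono hinit.1; omega)
  have s7_4 : s7 4 = C.ε.den.bits := by simp [hs7, hs6, hs5, hs4, s3_4]
  have s7_13 : s7 13 = C.initial.1.bits := by simp [hs7, hs6, hs5, hs4, s3_13]
  have r8 := Runs.mulProg (R := R) (d := 17) (x := 4) (y := 13) (by omega) (by omega) (by omega)
    hc7 hM7 (by rw [s7_4, s7_13, val_bits, val_bits]; exact ly)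
  rw [s7_4, s7_13, val_bits, val_bits] at r8
  have hM8 := hM7.update (d := 17) ly
  have hc8 := hc7.update (d := 17) (by omega) (C.ε.den * C.initial.1).bits
  set s8 := Function.update s7 17 (C.ε.den * C.initial.1).bits with hs8
  have r9 := Runs.subProg (R := R) (d := 16) (x := 16) (y := 17) (by omega) (by omega) (by omega)
    (fun r hr _ => hc8 r hr) hM8
  rw [show s8 16 = (x * C.ρ.den).bits by simp [hs8, hs7],
    show s8 17 = (C.ε.den * C.initial.1).bits by simp [hs8], val_bits, val_bits] at r9
  have hM9 := hM8.update (d := 16) ((length_bits_mono (Nat.sub_le (x * C.ρ.den)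
    (C.ε.den * C.initial.1))).trans lxq)
  set z := x * C.ρ.den - C.ε.den * C.initial.1 with hz
  set s9 := Function.update s8 16 z.bits with hs9
  have o9 : ∀ r < 15, s9 r = s3 r := by
    intro r hr
    simp [hs9, hs8, hs7, hs6, hs5, hs4, show r ≠ 16 by omega, show r ≠ 17 by omega,
      show r ≠ 15 by omega, show r ≠ 19 by omega]
  have s9_15 : s9 15 = (C.ρ.den - w).bits := by simp [hs9, hs8, hs7, hs6, hs5]
  have s9_16 : s9 16 = z.bits := by simp [hs9]
  have hfeas : C.Feasible ↔ C.ρ.den - w = 0 ∧ z = 0 := Iff.rfl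
  obtain ⟨s', hs', r10⟩ : ∃ s', s' 0 = encodeResult (C.result F) ∧
      Runs R (.branch 15 (.branch 16 (outputProg F) (.push 0 false)
        (.push 0 false)) (.push 0 false) (.push 0 false)) s9 s' (outputCost F.encode.length M + 2) := by
    have hfail : ¬ C.Feasible → Function.update s9 0 (false :: s9 0) 0 = encodeResult (C.result F) := by
      intro h
      rw [Instance.result, if_neg h, o9 0 (by omega)]
      rfl
    by_cases hw0 : C.ρ.den - w = 0
    · by_cases hz0 : z = 0
      · obtain ⟨s', h1, h2⟩ := Instance.runs_output (R := R) (C := C) (s := s9) F hM9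
          (o9 0 (by omega)) (o9 1 (by omega)) (o9 2 (by omega)) (o9 5 (by omega))
          (o9 6 (by omega)) (o9 7 (by omega))
        refine ⟨s', ?_, (Runs.branch_nil ?_ (Runs.branch_nil ?_ h2)).mono (by omega)⟩
        · rw [h1, Instance.result, if_pos (hfeas.2 ⟨hw0, hz0⟩)]
        · rw [s9_15, hw0]; rfl
        · rw [s9_16, hz0]; rfl
      · refine ⟨_, hfail fun h => hz0 (hfeas.1 h).2, (Runs.branch_nil ?_ (Runs.branch_cons ?_
          (Runs.push 0 false))).mono (by unfold outputCost; omega)⟩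
        · rw [s9_15, hw0]; rfl
        · rw [s9_16, ne_eq, bits_eq_nil]; exact hz0
    · refine ⟨_, hfail fun h => hw0 (hfeas.1 h).1, (Runs.branch_cons ?_
          (Runs.push 0 false)).mono (by unfold outputCost; omega)⟩
      rw [s9_15, ne_eq, bits_eq_nil]; exact hw0
  refine ⟨s', hs', (r1.seq (r2.seq (r3.seq (r4.seq (r5.seq (r6.seq (r7.seq (r8.seq
    (r9.seq r10))))))))).mono ?_⟩
  simp only [List.length_cons, List.length_nil]
  have h240 : 240 * M * M = 120 * M * M + 120 * M * M := by ring
  unfold schemeCost capCost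
  omega

end

/-! ## Analysis of probabilistic runs -/

/-- The expectation of `g` after `t` steps from `c`. -/
noncomputable def expect (g : Cfg → ℝ≥0∞) (t : ℕ) (c : Cfg) : ℝ≥0∞ := ∑' c', c.runDist t c' * g c'

theorem expect_zero (g : Cfg → ℝ≥0∞) (c : Cfg) : expect g 0 c = g c := by
  unfold expect Cfg.runDist
  rw [tsum_eq_single c (fun c' h => by simp [PMF.pure_apply, h])]
  simp

/-- First-step analysis: every step, whether or not it looks at its coin, averages over both
outcomes. -/
theorem expect_succ (g : Cfg → ℝ≥0∞) (t : ℕ) (c : Cfg) :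
    expect g (t + 1) c = (expect g t (c.step false) + expect g t (c.step true)) / 2 := by
  have h : ∀ c', c.runDist (t + 1) c' * g c' =
      ((c.step false).runDist t c' * g c' + (c.step true).runDist t c' * g c') / 2 := by
    intro c'
    simp only [Cfg.runDist, PMF.bind_apply, PMF.uniformOfFintype_apply, tsum_fintype,
      Fintype.sum_bool, Fintype.card_bool, ENNReal.div_eq_inv_mul]
    push_cast
    ring
  unfold expect
  simp_rw [h, ENNReal.div_eq_inv_mul]
  rw [ENNReal.tsum_mul_left, ENNReal.tsum_add]

theorem expect_halted (g : Cfg → ℝ≥0∞) (t : ℕ) {c : Cfg} (hc : c.ctrl = []) :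
    expect g t c = g c := by
  induction t with
  | zero => exact expect_zero g c
  | succ t ih =>
    have h : ∀ b, c.step b = c := fun b => by simp [Cfg.step, hc]
    rw [expect_succ, h, h, ih, ← two_mul, mul_comm, ENNReal.mul_div_cancel_right] <;> simp

/-- The expectation within `t` steps of the sum of `γ` over the stores that are passed and of `f`
at the store in which the machine has halted. -/
noncomputable def accrue (γ f : Store → ℝ≥0∞) : ℕ → List Prog → Store → ℝ≥0∞
  | _, [], s => f s
  | 0, _ :: _, _ => 0
  | t + 1, p :: K, s =>
      ((γ (p.exec false K s).2 + accrue γ f t (p.exec false K s).1 (p.exec false K s).2) +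
        (γ (p.exec true K s).2 + accrue γ f t (p.exec true K s).1 (p.exec true K s).2)) / 2

theorem accrue_nil (γ f : Store → ℝ≥0∞) (t : ℕ) (s : Store) : accrue γ f t [] s = f s := by
  cases t <;> rfl

theorem half_add_half (a : ℝ≥0∞) : (a + a) / 2 = a := by
  rw [← two_mul, mul_comm, ENNReal.mul_div_cancel_right] <;> simp

theorem expect_time (t : ℕ) : ∀ (K : List Prog) (s : Store) (τ pk : ℕ),
    expect (fun c => (c.time : ℝ≥0∞)) t ⟨K, s, τ, pk⟩ = τ + accrue 1 0 t K s := by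
  induction t with
  | zero => intro K s τ pk; rw [expect_zero]; cases K <;> simp [accrue]
  | succ t ih =>
    intro K s τ pk
    rcases K with _ | ⟨p, K⟩
    · rw [expect_halted _ _ rfl, accrue_nil]; simp
    · rw [expect_succ]
      simp only [Cfg.step, ih, accrue, Pi.one_apply, Nat.cast_add_one]
      conv_rhs => rw [← half_add_half (τ : ℝ≥0∞), ← ENNReal.add_div]
      ring_nf

theorem expect_haltedWith (out : List Bool) (t : ℕ) : ∀ (K : List Prog) (s : Store) (τ pk : ℕ),
    expect (Set.indicator {c | c.HaltedWith out} 1) t ⟨K, s, τ, pk⟩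
      = accrue 0 (Set.indicator {s | s 0 = out} 1) t K s := by
  induction t with
  | zero =>
    intro K s τ pk
    rw [expect_zero]
    cases K <;> simp [accrue, Set.indicator, Cfg.HaltedWith]
  | succ t ih =>
    intro K s τ pk
    rcases K with _ | ⟨p, K⟩
    · rw [expect_halted _ _ rfl, accrue_nil]; simp [Set.indicator, Cfg.HaltedWith]
    · rw [expect_succ]
      simp [Cfg.step, ih, accrue]

/-- The maximum over the run is not additive, but it exceeds the threshold `B` by at most the sum of
the excesses of all stores passed. For a program that stays within `B` this sum vanishes. -/
theorem expect_peak (B t : ℕ) : ∀ (K : List Prog) (s : Store) (τ pk : ℕ),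
    expect (fun c => (c.peak : ℝ≥0∞)) t ⟨K, s, τ, pk⟩
      ≤ (max pk B : ℕ) + accrue (fun s => (s.space - B : ℕ)) 0 t K s := by
  induction t with
  | zero =>
    intro K s τ pk
    rw [expect_zero]
    exact le_add_right (by simp)
  | succ t ih =>
    intro K s τ pk
    rcases K with _ | ⟨p, K⟩
    · rw [expect_halted _ _ rfl]
      exact le_add_right (by simp)
    · rw [expect_succ]
      have key : ∀ b, expect (fun c => (c.peak : ℝ≥0∞)) t (Cfg.step b ⟨p :: K, s, τ, pk⟩) ≤
          (max pk B : ℕ) + (((p.exec b K s).2.space - B : ℕ) +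
            accrue (fun s => (s.space - B : ℕ)) 0 t (p.exec b K s).1 (p.exec b K s).2) := by
        intro b
        refine (ih _ _ _ _).trans ?_
        rw [← add_assoc, ← Nat.cast_add]
        gcongr
        simp only
        omega
      calc _ ≤ _ := ENNReal.div_le_div_right (add_le_add (key false) (key true)) 2
        _ = _ := by
          rw [accrue, ← half_add_half ((max pk B : ℕ) : ℝ≥0∞), ← ENNReal.add_div, half_add_half]
          congr 1
          ring

theorem accrue_mono (γ f : Store → ℝ≥0∞) (t : ℕ) : ∀ (K : List Prog) (s : Store),
    accrue γ f t K s ≤ accrue γ f (t + 1) K s := by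
  induction t with
  | zero => intro K s; cases K <;> simp [accrue]
  | succ t ih =>
    intro K s
    rcases K with _ | ⟨p, K⟩
    · simp [accrue]
    · rw [accrue, accrue]
      gcongr <;> exact ih _ _

theorem accrue_ne_top {γ f : Store → ℝ≥0∞} (hγ : ∀ s, γ s ≠ ⊤) (hf : ∀ s, f s ≠ ⊤) (t : ℕ) :
    ∀ (K : List Prog) (s : Store), accrue γ f t K s ≠ ⊤ := by
  induction t with
  | zero => intro K s; cases K <;> simp [accrue, hf]
  | succ t ih =>
    intro K s
    rcases K with _ | ⟨p, K⟩
    · simp [accrue, hf]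
    · rw [accrue]
      refine ENNReal.div_ne_top ?_ (by simp)
      simp [hγ, ih]

/-- A quantity attached to configurations that in a step which does not lead out of space `m`
decreases by at most `δ` on average. -/
structure Potential (m : ℕ) (δ : ℝ≥0∞) (J : List Prog → Store → ℝ≥0∞) : Prop where
  step : ∀ (p : Prog) (K : List Prog) (s : Store), (∀ b, (p.exec b K s).2.space ≤ m) →
    J (p :: K) s ≤ δ + (J (p.exec false K s).1 (p.exec false K s).2 +
      J (p.exec true K s).1 (p.exec true K s).2) / 2
  ne_top : ∀ K s, J K s ≠ ⊤

/-- With the same time horizon on both sides the recursion becomes an inequality, since one more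
step can only increase the accrued value. The fixed horizon keeps the value finite, as the treatment
of rejection loops requires. -/
theorem potential_accrue {γ f : Store → ℝ≥0∞} (hγ : ∀ s, γ s ≠ ⊤) (hf : ∀ s, f s ≠ ⊤) {m : ℕ}
    {δ : ℝ≥0∞} (h : ∀ s : Store, s.space ≤ m → γ s ≤ δ) (t : ℕ) :
    Potential m δ (accrue γ f t) where
  step p K s hs := by
    rcases t with _ | t
    · simp [accrue]
    · rw [accrue]
      calc _ ≤ ((δ + accrue γ f (t + 1) (p.exec false K s).1 (p.exec false K s).2) +
            (δ + accrue γ f (t + 1) (p.exec true K s).1 (p.exec true K s).2)) / 2 := by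
            gcongr
            · exact h _ (hs false)
            · exact accrue_mono _ _ _ _ _
            · exact h _ (hs true)
            · exact accrue_mono _ _ _ _ _
        _ = _ := by
          conv_rhs => rw [← half_add_half δ, ← ENNReal.add_div]
          congr 1
          ring
  ne_top := accrue_ne_top hγ hf t

/-- Potentials give upper bounds only; applied to the complement of the limit value, they give lower
bounds for output probabilities. Truncated subtraction from 1 makes it finite without assuming that
the value is at most 1. -/
theorem potential_one_sub (f : Store → ℝ≥0∞) (m : ℕ) :
    Potential m 0 (fun K s => 1 - ⨆ t, accrue 0 f t K s) where
  step p K s _ := by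
    have h2 : ((⨆ t, accrue 0 f t (p.exec false K s).1 (p.exec false K s).2) +
        ⨆ t, accrue 0 f t (p.exec true K s).1 (p.exec true K s).2) / 2
        ≤ ⨆ t, accrue 0 f t (p :: K) s := by
      rw [ENNReal.iSup_add_iSup_of_monotone (monotone_nat_of_le_succ fun t => accrue_mono _ _ t _ _)
        (monotone_nat_of_le_succ fun t => accrue_mono _ _ t _ _), ENNReal.iSup_div]
      refine iSup_le fun t => le_trans ?_ (le_iSup _ (t + 1))
      rw [accrue]
      simp
    rw [zero_add]
    refine (tsub_le_tsub_left h2 1).trans ?_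
    generalize (⨆ t, accrue 0 f t (p.exec false K s).1 (p.exec false K s).2) = a
    generalize (⨆ t, accrue 0 f t (p.exec true K s).1 (p.exec true K s).2) = b
    rw [tsub_le_iff_right, ← ENNReal.add_div, add_add_add_comm]
    refine (half_add_half 1).symm.le.trans (ENNReal.div_le_div_right ?_ 2)
    exact add_le_add le_tsub_add le_tsub_add
  ne_top K s := by simp

/-! ## Programs that reach uniformly distributed stores -/

/-- The mean of the first `c` values of `g`. -/
noncomputable def mean (c : ℕ) (g : ℕ → ℝ≥0∞) : ℝ≥0∞ := (∑ v ∈ Finset.range c, g v) / c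

theorem mean_mono {c : ℕ} {g g' : ℕ → ℝ≥0∞} (h : ∀ v < c, g v ≤ g' v) : mean c g ≤ mean c g' :=
  ENNReal.div_le_div_right (Finset.sum_le_sum fun v hv => h v (Finset.mem_range.1 hv)) _

theorem mean_const {c : ℕ} (hc : 0 < c) (a : ℝ≥0∞) : mean c (fun _ => a) = a := by
  rw [mean, Finset.sum_const, Finset.card_range, nsmul_eq_mul, mul_comm,
    ENNReal.mul_div_cancel_right (by exact_mod_cast hc.ne') (by simp)]

theorem mean_add (c : ℕ) (g g' : ℕ → ℝ≥0∞) :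
    mean c (fun v => g v + g' v) = mean c g + mean c g' := by
  rw [mean, Finset.sum_add_distrib, ENNReal.add_div]; rfl

/-- A uniform number of `n + 1` digits is a uniform number of `n` digits together with a fair
leading digit. -/
theorem mean_two_pow_succ (n : ℕ) (g : ℕ → ℝ≥0∞) :
    mean (2 ^ (n + 1)) g = (mean (2 ^ n) g + mean (2 ^ n) fun v => g (2 ^ n + v)) / 2 := by
  rw [mean, mean, mean, ← ENNReal.add_div, pow_succ, mul_two, Finset.sum_range_add, ← mul_two]
  push_cast
  rw [ENNReal.div_eq_inv_mul, ENNReal.div_eq_inv_mul, ENNReal.div_eq_inv_mul,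
    ENNReal.mul_inv (by simp) (by simp)]
  ring

theorem DRun.potential {m t : ℕ} {K K' : List Prog} {s s' : Store} (h : DRun m t K s K' s')
    {m' : ℕ} {δ : ℝ≥0∞} {J : List Prog → Store → ℝ≥0∞} (hJ : Potential m' δ J) (hm : m ≤ m') :
    J K s ≤ t * δ + J K' s' := by
  induction h with
  | refl => simp
  | @step p K K₁ K' s s₁ s' t he hs _ ih =>
    refine (hJ.step p K s fun b => by rw [he b]; exact hs.trans hm).trans ?_
    rw [he, he, half_add_half]
    push_cast
    rw [add_one_mul, add_comm _ δ, add_assoc]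
    gcongr

/-- From the store `s`, `p` reaches each of the stores `f 0, …, f (c - 1)` with the same
probability. It increases the occupied space by at most `B` meanwhile and, if the resource is time,
takes at most `B` steps on average. -/
def Spreads (R : Resource) (p : Prog) (s : Store) (c : ℕ) (f : ℕ → Store) (B : ℕ) : Prop :=
  ∃ D : ℕ, (R = .time → D ≤ B) ∧ (∀ v < c, (f v).space ≤ s.space + B) ∧
    ∀ (m : ℕ) (δ : ℝ≥0∞) (J : List Prog → Store → ℝ≥0∞), Potential m δ J → s.space + B ≤ m →
      ∀ K, J (p :: K) s ≤ D * δ + mean c fun v => J K (f v)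

section

variable {R : Resource} {p q : Prog} {s s' : Store} {c : ℕ} {f f' : ℕ → Store} {B B₁ B₂ : ℕ}

theorem Runs.spreads (h : Runs R p s s' B) (hc : 0 < c) : Spreads R p s c (fun _ => s') B := by
  obtain ⟨t, h1, h2, h3⟩ := h
  refine ⟨t, h1, fun _ _ => h2, fun m δ J hJ hm K => ?_⟩
  rw [mean_const hc]
  exact (h3 K).potential hJ hm

theorem Spreads.mono {B' : ℕ} (h : Spreads R p s c f B) (hB : B ≤ B') : Spreads R p s c f B' := by
  obtain ⟨D, h1, h2, h3⟩ := h
  exact ⟨D, fun h => (h1 h).trans hB, fun v hv => (h2 v hv).trans (by omega),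
    fun m δ J hJ hm => h3 m δ J hJ (by omega)⟩

theorem Spreads.of_step (he : ∀ b K, p.exec b K s = (q :: K, s)) (h : Spreads R q s c f B) :
    Spreads R p s c f (B + 1) := by
  obtain ⟨D, h1, h2, h3⟩ := h
  refine ⟨D + 1, fun h => by have := h1 h; omega, fun v hv => (h2 v hv).trans (by omega),
    fun m δ J hJ hm K => ?_⟩
  refine (hJ.step p K s fun b => by rw [he b]; simp only; omega).trans ?_
  rw [he, he, half_add_half]
  push_cast
  rw [add_one_mul, add_comm _ δ, add_assoc]
  gcongr
  exact h3 m δ J hJ (by omega) K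

theorem Spreads.branch_nil {pe pf pt : Prog} {r : ℕ} (hr : s r = []) (h : Spreads R pe s c f B) :
    Spreads R (.branch r pe pf pt) s c f (B + 1) :=
  .of_step (fun b K => by simp [Prog.exec, hr]) h

theorem Spreads.branch_cons {pe : Prog} {r : ℕ} (hr : s r ≠ []) (h : Spreads R p s c f B) :
    Spreads R (.branch r pe p p) s c f (B + 1) := by
  refine .of_step (fun b K => ?_) h
  rcases hl : s r with _ | ⟨_ | _, l⟩
  · exact absurd hl hr
  · simp [Prog.exec, hl]
  · simp [Prog.exec, hl]

theorem Runs.seq_spreads (h : Runs R p s s' B₁) (h' : Spreads R q s' c f B₂) :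
    Spreads R (.seq p q) s c f (B₁ + B₂ + 1) := by
  obtain ⟨t, h1, h2, h3⟩ := h
  obtain ⟨D, h1', h2', h3'⟩ := h'
  refine ⟨t + D + 1, fun h => by have := h1 h; have := h1' h; omega,
    fun v hv => (h2' v hv).trans (by omega), fun m δ J hJ hm K => ?_⟩
  refine (hJ.step _ K s fun b => by simp only [Prog.exec]; omega).trans ?_
  simp only [Prog.exec]
  rw [half_add_half]
  refine (add_le_add_right ((h3 (q :: K)).potential hJ (by omega)) δ).trans ?_
  refine (add_le_add_right (add_le_add_right (h3' m δ J hJ (by omega) K) _) δ).trans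
    (le_of_eq ?_)
  push_cast
  ring

/-- If the resource is space, nothing in `Runs` bounds the number of steps in terms of `B`; a common
bound for all starting stores exists because there are finitely many. -/
theorem Runs.exists_uniform {ι : Type*} {S : Set ι} (hS : S.Finite) {g g' : ι → Store}
    (h : ∀ v ∈ S, Runs R p (g v) (g' v) B) :
    ∃ D : ℕ, (R = .time → D ≤ B) ∧ ∀ v ∈ S, ∀ (m : ℕ) (δ : ℝ≥0∞)
      (J : List Prog → Store → ℝ≥0∞), Potential m δ J → (g v).space + B ≤ m →
      ∀ K, J (p :: K) (g v) ≤ D * δ + J K (g' v) := by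
  induction S, hS using Set.Finite.induction_on with
  | empty => exact ⟨0, fun _ => Nat.zero_le _, by simp⟩
  | @insert a S _ _ ih =>
    obtain ⟨D, h1, h2⟩ := ih fun v hv => h v (Set.mem_insert_of_mem _ hv)
    obtain ⟨t, h1', h2', h3'⟩ := h a (Set.mem_insert _ _)
    refine ⟨max D t, fun h => max_le (h1 h) (h1' h), ?_⟩
    rintro v (rfl | hv) m δ J hJ hm K
    · refine ((h3' K).potential hJ hm).trans ?_
      gcongr
      exact le_max_right _ _
    · refine (h2 v hv m δ J hJ hm K).trans ?_
      gcongr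
      exact le_max_left _ _

theorem Spreads.seq_runs (h : Spreads R p s c f B₁) (hc : 0 < c)
    (h' : ∀ v < c, Runs R q (f v) (f' v) B₂) : Spreads R (.seq p q) s c f' (B₁ + B₂ + 1) := by
  obtain ⟨D, h1, h2, h3⟩ := h
  obtain ⟨D', h1', h3'⟩ := Runs.exists_uniform (Set.finite_lt_nat c) h'
  refine ⟨D + D' + 1, fun h => by have := h1 h; have := h1' h; omega, fun v hv => ?_,
    fun m δ J hJ hm K => ?_⟩
  · obtain ⟨-, -, h4, -⟩ := h' v hv
    have := h2 v hv
    omega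
  refine (hJ.step _ K s fun b => by simp only [Prog.exec]; omega).trans ?_
  simp only [Prog.exec]
  rw [half_add_half]
  refine (add_le_add_right (h3 m δ J hJ (by omega) (q :: K)) δ).trans ?_
  have : mean c (fun v => J (q :: K) (f v)) ≤ D' * δ + mean c fun v => J K (f' v) := by
    rw [← mean_const hc (D' * δ), ← mean_add]
    refine mean_mono fun v hv => ?_
    exact h3' v hv m δ J hJ (by have := h2 v hv; omega) K
  refine (add_le_add_right (add_le_add_right this _) δ).trans (le_of_eq ?_)
  push_cast
  ring

/-- Each bit costs the two steps of a `seq` and a `push`; the last bit of the word is pushed first,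
so the word ends up in its own order. -/
theorem Spreads.loadProg (r : ℕ) (l : List Bool)
    (h : Spreads R p (Function.update s r (l ++ s r)) c f B) :
    Spreads R (RCI.loadProg r l p) s c f (B + 2 * l.length) := by
  induction l generalizing p B with
  | nil => simpa [RCI.loadProg] using h
  | cons b l ih =>
    refine (ih ((Runs.push r b).seq_spreads (B₂ := B) ?_)).mono (by
      simp only [List.length_cons]; omega)
    simpa using h

/-- The number `D` in `Spreads` is finite for both resources. Hence the expected time is finite also
when only the space is bounded by `B`. -/
theorem Spreads.expectedCost_time_lt_top {P : Prog} {ins : List (List Bool)} (hc : 0 < c)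
    (h : Spreads R P (inputStore ins) c f B) : P.expectedCost .time ins < ⊤ := by
  obtain ⟨D, -, -, h3⟩ := h
  refine lt_of_le_of_lt (b := (D : ℝ≥0∞)) (iSup_le fun t => ?_) (by simp)
  refine (expect_time t [P] _ 0 _).le.trans ?_
  have hJ : Potential ((inputStore ins).space + B) 1 (accrue 1 0 t) :=
    potential_accrue (by simp) (by simp) (by simp) t
  refine (add_le_add_right (h3 _ _ _ hJ le_rfl []) _).trans ?_
  simp [accrue_nil, mean_const hc]

/-- For time, the potential accrues 1 per step. For space, it accrues the excess over the allowed
space, which is 0 for every store admitted by `Potential`, so `δ = 0` and only the threshold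
remains. -/
theorem Spreads.expectedCost_le {P : Prog} {ins : List (List Bool)} (hc : 0 < c)
    (h : Spreads R P (inputStore ins) c f B) : P.expectedCost R ins ≤ (inputSize ins + B : ℕ) := by
  obtain ⟨D, h1, -, h3⟩ := h
  refine iSup_le fun t => ?_
  cases R
  · refine (expect_time t [P] _ 0 _).le.trans ?_
    have hJ : Potential ((inputStore ins).space + B) 1 (accrue 1 0 t) :=
      potential_accrue (by simp) (by simp) (by simp) t
    refine (add_le_add_right (h3 _ _ _ hJ le_rfl []) _).trans ?_
    have := h1 rfl
    simp only [accrue_nil, mean_const hc, Pi.zero_apply, mul_one, Nat.cast_zero, zero_add, add_zero]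
    exact_mod_cast this.trans (Nat.le_add_left _ _)
  · refine (expect_peak ((inputStore ins).space + B) t [P] _ 0 _).trans ?_
    have hJ : Potential ((inputStore ins).space + B) 0
        (accrue (fun s => (s.space - ((inputStore ins).space + B) : ℕ)) 0 t) :=
      potential_accrue (by simp) (by simp) (fun s hs => by simp [Nat.sub_eq_zero_of_le hs]) t
    refine (add_le_add_right (h3 _ _ _ hJ le_rfl []) _).trans ?_
    simp only [accrue_nil, mean_const hc, Pi.zero_apply, mul_zero, add_zero, space_inputStore]
    exact_mod_cast max_le (Nat.le_add_right _ _) le_rfl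

/-- Both inequalities use `δ = 0`: the value accrued up to a finite time gives the upper bound, and
the complement of the limit gives the lower one, which in particular excludes losing probability to
infinite runs. -/
theorem Spreads.outputProb_eq {P : Prog} {ins : List (List Bool)} (hc : 0 < c)
    (h : Spreads R P (inputStore ins) c f B) (out : List Bool) :
    P.outputProb ins out = mean c fun v => if f v 0 = out then 1 else 0 := by
  obtain ⟨D, -, -, h3⟩ := h
  set g : Store → ℝ≥0∞ := Set.indicator {s | s 0 = out} 1 with hg
  have hg1 : ∀ s, g s ≤ 1 := fun s => by
    rw [hg, Set.indicator_apply]; split_ifs <;> simp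
  have hV : P.outputProb ins out = ⨆ t, accrue 0 g t [P] (inputStore ins) := by
    refine iSup_congr fun t => ?_
    rw [← expect_haltedWith out t [P] (inputStore ins) 0 (inputStore ins).space,
      PMF.toOuterMeasure_apply]
    refine tsum_congr fun c => ?_
    by_cases hc : c.HaltedWith out <;> simp [hc, Prog.start]
  have hmean : mean c (fun v => if f v 0 = out then 1 else 0) = mean c fun v => g (f v) := by
    simp only [hg, Set.indicator_apply, Set.mem_ofPred_eq, Pi.one_apply]
  rw [hV, hmean]
  refine le_antisymm (iSup_le fun t => ?_) ?_
  · have hJ : Potential ((inputStore ins).space + B) 0 (accrue 0 g t) :=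
      potential_accrue (by simp) (fun s => ne_top_of_le_ne_top ENNReal.one_ne_top (hg1 s))
        (by simp) t
    simpa [accrue_nil] using h3 _ _ _ hJ le_rfl []
  · have h4 := h3 _ _ _ (potential_one_sub g ((inputStore ins).space + B)) le_rfl []
    simp only [accrue_nil, mul_zero, zero_add, ciSup_const] at h4
    set V := ⨆ t, accrue 0 g t [P] (inputStore ins) with hVdef
    have hfin : mean c (fun v => 1 - g (f v)) ≠ ⊤ :=
      ne_top_of_le_ne_top ENNReal.one_ne_top
        ((mean_mono fun v _ => tsub_le_self).trans (mean_const hc 1).le)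
    have h5 : mean c (fun v => 1 - g (f v)) + mean c (fun v => g (f v)) = 1 := by
      rw [← mean_add, ← mean_const hc 1]
      congr 1
      funext v
      rw [mean_const hc]
      exact tsub_add_cancel_of_le (hg1 _)
    refine (ENNReal.add_le_add_iff_left hfin).1 ?_
    rw [h5]
    exact le_tsub_add.trans (add_le_add_left h4 V)

/-! ## Sampling -/

/-- Push a random bit on register `20` for each bit of register `23`. -/
def tossProg : Prog := .loop 23 (.seq (.pop 23) (.flip 20))

/-- The first coin ends up at the bottom as the most significant digit, so conditioning on it splits
the mean into two halves. A round takes four steps (loop test, `seq`, `pop`, `flip`), and leaving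
the loop takes one more. -/
theorem tossProg_potential {m : ℕ} {δ : ℝ≥0∞} {J : List Prog → Store → ℝ≥0∞}
    (hJ : Potential m δ J) (K : List Prog) (n : ℕ) : ∀ (s : Store) (G : ℕ → ℝ≥0∞),
    (s 23).length = n → s.space + n ≤ m →
    (∀ l : List Bool, l.length = n →
      J K (Function.update (Function.update s 23 []) 20 (l ++ s 20)) ≤ G (val l)) →
    J (tossProg :: K) s ≤ (4 * n + 1 : ℕ) * δ + mean (2 ^ n) G := by
  induction n with
  | zero =>
    intro s G hn hm hG
    rw [List.length_eq_zero_iff] at hn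
    refine (hJ.step _ _ _ fun b => by simp [tossProg, Prog.exec, hn]; omega).trans ?_
    simp only [tossProg, Prog.exec, hn, half_add_half]
    have := hG [] rfl
    have he : Function.update s 23 [] = s := by rw [← hn, Function.update_eq_self]
    rw [List.nil_append, he, Function.update_eq_self] at this
    simpa [mean, val] using add_le_add_right this δ
  | succ n ih =>
    intro s G hn hm hG
    obtain ⟨x, y, hxy⟩ : ∃ x y, s 23 = x :: y := List.exists_cons_of_length_eq_add_one hn
    have hy : y.length = n := by simpa [hxy] using hn
    set s₁ : Store := Function.update s 23 y with hs1
    have hs1' : s₁.space ≤ s.space := (Store.space_update_le s 23 y 0 (by simp [hxy])).trans (by omega)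
    have hs2 : ∀ b, Store.space (Function.update s₁ 20 (b :: s₁ 20)) ≤ s.space + 1 := fun b =>
      (Store.space_update_le s₁ 20 _ 1 (by simp)).trans (by omega)
    have h1 : J (tossProg :: K) s ≤ δ + J (.seq (.pop 23) (.flip 20) :: tossProg :: K) s := by
      refine (hJ.step _ _ _ fun b => by simp [tossProg, Prog.exec, hxy]; omega).trans ?_
      simp [tossProg, Prog.exec, hxy, half_add_half]
    have h2 : J (.seq (.pop 23) (.flip 20) :: tossProg :: K) s
        ≤ δ + J (.pop 23 :: .flip 20 :: tossProg :: K) s := by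
      refine (hJ.step _ _ _ fun b => by simp [Prog.exec]; omega).trans ?_
      simp [Prog.exec, half_add_half]
    have h3 : J (.pop 23 :: .flip 20 :: tossProg :: K) s ≤ δ + J (.flip 20 :: tossProg :: K) s₁ := by
      refine (hJ.step _ _ _ fun b => by
        simp only [Prog.exec, hxy, List.tail_cons]; rw [← hs1]; omega).trans ?_
      simp [Prog.exec, half_add_half, hxy, hs1]
    have h4 := hJ.step (.flip 20) (tossProg :: K) s₁ fun b => by
      simp only [Prog.exec]; have := hs2 b; omega
    have h5 : ∀ b : Bool, J (tossProg :: K) (Function.update s₁ 20 (b :: s₁ 20)) ≤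
        (4 * n + 1 : ℕ) * δ + mean (2 ^ n) fun v => G (v + 2 ^ n * b.toNat) := by
      intro b
      refine ih _ _ (by simp [hs1, hy]) (by have := hs2 b; omega) fun l hl => ?_
      have := hG (l ++ [b]) (by simp [hl])
      rw [val_append, hl] at this
      have hb : val [b] = b.toNat := by cases b <;> simp [val]
      rw [hb] at this
      refine le_trans (le_of_eq ?_) this
      congr 1
      funext r
      by_cases h20 : r = 20
      · subst h20; simp [hs1]
      · by_cases h23 : r = 23 <;> simp [h20, h23, hs1]
    calc J (tossProg :: K) s ≤ δ + (δ + (δ + (δ + (((4 * n + 1 : ℕ) * δ +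
            mean (2 ^ n) fun v => G (v + 2 ^ n * false.toNat)) + ((4 * n + 1 : ℕ) * δ +
            mean (2 ^ n) fun v => G (v + 2 ^ n * true.toNat))) / 2))) := by
          refine h1.trans (add_le_add_right (h2.trans (add_le_add_right (h3.trans
            (add_le_add_right (h4.trans ?_) _)) _)) _)
          gcongr
          · exact h5 false
          · exact h5 true
      _ = _ := by
          rw [mean_two_pow_succ, add_add_add_comm, ENNReal.add_div, half_add_half]
          simp only [Bool.toNat_false, Bool.toNat_true, mul_zero, add_zero, mul_one,
            add_comm _ (2 ^ n)]
          push_cast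
          ring

end

/-- Multiplied by `N`, the hypothesis contains `N - c` copies of `X` on the right, which may be
cancelled because `X` is finite. What remains is `c * X ≤ N * a + ∑ Y`, and `N / c ≤ 2` is the
expected number of rounds. -/
theorem le_of_rejection {N c : ℕ} (hc : 0 < c) (hcN : c ≤ N) (hN : N ≤ 2 * c) {X a : ℝ≥0∞}
    (hX : X ≠ ⊤) {Y : ℕ → ℝ≥0∞} (h : X ≤ a + mean N fun v => if v < c then Y v else X) :
    X ≤ 2 * a + mean c Y := by
  have hN0 : (N : ℝ≥0∞) ≠ 0 := by exact_mod_cast (by omega : N ≠ 0)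
  have hc0 : (c : ℝ≥0∞) ≠ 0 := by exact_mod_cast hc.ne'
  obtain ⟨d, rfl⟩ := Nat.exists_eq_add_of_le hcN
  have hsum : ∑ v ∈ Finset.range (c + d), (if v < c then Y v else X)
      = ∑ v ∈ Finset.range c, Y v + d * X := by
    rw [Finset.sum_range_add]
    congr 1
    · exact Finset.sum_congr rfl fun v hv => if_pos (Finset.mem_range.1 hv)
    · simp
  rw [mean, hsum] at h
  have h1 : ((c + d : ℕ) : ℝ≥0∞) * X ≤
      (c + d : ℕ) * a + ∑ v ∈ Finset.range c, Y v + d * X := by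
    calc ((c + d : ℕ) : ℝ≥0∞) * X ≤ (c + d : ℕ) * (a + (∑ v ∈ Finset.range c, Y v + d * X) /
          (c + d : ℕ)) := by gcongr
      _ = _ := by
        rw [mul_add, ENNReal.mul_div_cancel hN0 (by simp)]
        ring
  rw [Nat.cast_add, add_mul, ← Nat.cast_add] at h1
  have h2 := (ENNReal.add_le_add_iff_right (ENNReal.mul_ne_top (by simp) hX)).1 h1
  have h3 : (c : ℝ≥0∞) * X ≤ c * (2 * a + mean c Y) := by
    refine h2.trans ?_
    rw [mul_add, mean, ENNReal.mul_div_cancel hc0 (by simp), ← mul_assoc]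
    gcongr
    rw [mul_comm]
    exact_mod_cast hN
  exact (ENNReal.mul_le_mul_iff_right hc0 (by simp)).1 h3

/-- Accept the number in register `20` if it is smaller than the one in register `14`. -/
def decideProg : Prog :=
  .seq (subProg 15 14 20) (.branch 15 (clear 20)
    (.seq (clear 15) (.seq (subProg 20 20 30) (.pop 21)))
    (.seq (clear 15) (.seq (subProg 20 20 30) (.pop 21))))

/-- Store a random number that is smaller than the one in register `14` in register `20`. -/
def sampleProg : Prog :=
  .seq (.push 21 true) (.loop 21 (.seq (copy 14 [23]) (.seq tossProg decideProg)))

section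

variable {R : Resource} {M c : ℕ} {s : Store}

/-- The difference in register `15` is empty exactly when the sample is too large. Then the sample
is cleared, so that the next round starts from the same store; otherwise leading zeros are removed
and the flag in register `21`, which keeps the loop running, is taken away. -/
theorem runs_decide (hs : Clean s) (hM : Small M s) (hM1 : 1 ≤ M) (h14 : s 14 = c.bits)
    (h15 : s 15 = []) (h20 : s 20 = []) (h21 : s 21 = []) {l : List Bool} (hl : l.length ≤ M) :
    Runs R decideProg (Function.update (Function.update s 21 [true]) 20 l)
      (if val l < c then Function.update s 20 (val l).bits else Function.update s 21 [true])
      (245 * M + 260) := by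
  have c1 : Clean (Function.update (Function.update s 21 [true]) 20 l) :=
    (hs.update (by omega) _).update (by omega) _
  have M1 : Small M (Function.update (Function.update s 21 [true]) 20 l) :=
    (hM.update (by simpa using hM1)).update hl
  set s1 := Function.update (Function.update s 21 [true]) 20 l with hs1
  have r1 := Runs.subProg (R := R) (d := 15) (x := 14) (y := 20) (by omega) (by omega) (by omega)
    (fun r hr _ => c1 r hr) M1
  rw [show s1 14 = c.bits by simp [hs1, h14], show s1 20 = l by simp [hs1], val_bits] at r1
  have hb : (c - val l).bits.length ≤ M :=
    (length_bits_mono (Nat.sub_le _ _)).trans (h14 ▸ hM 14)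
  have c2 := c1.update (d := 15) (by omega) (c - val l).bits
  have M2 := M1.update (d := 15) hb
  by_cases hlt : val l < c
  · rw [if_pos hlt]
    set s2 := Function.update s1 15 (c - val l).bits with hs2
    have r2 := Runs.clear (R := R) 15 s2
    have c3 := c2.update (d := 15) (by omega) []
    have M3 := M2.update (d := 15) (l := []) (by simp)
    set s3 := Function.update s2 15 [] with hs3
    have r3 := Runs.subProg (R := R) (d := 20) (x := 20) (y := 30) (by omega) (by omega) (by omega)
      (fun r hr _ => c3 r hr) M3
    rw [show s3 20 = l by simp [hs3, hs2, hs1], c3 30 (by omega), val, Nat.sub_zero] at r3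
    have r4 := Runs.pop (R := R) (s := Function.update s3 20 (val l).bits) 21
    refine (r1.seq (Runs.branch_cons ?_ (r2.seq (r3.seq r4)))).cast ?_ ?_
    · rw [hs2, Function.update_self, ne_eq, bits_eq_nil]
      omega
    · funext r
      by_cases e21 : r = 21
      · subst e21; simp [hs3, hs2, hs1, h21]
      by_cases e20 : r = 20
      · subst e20; simp
      by_cases e15 : r = 15
      · subst e15; simp [hs3, h15]
      simp [hs3, hs2, hs1, e21, e20, e15]
    · have := M2 15
      omega
  · rw [if_neg hlt]
    have hz : (c - val l).bits = [] := by rw [bits_eq_nil]; omega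
    rw [hz] at r1
    have r2 := Runs.clear (R := R) 20 (Function.update s1 15 [])
    refine (r1.seq (Runs.branch_nil (by simp) r2)).cast ?_ ?_
    · funext r
      by_cases e21 : r = 21
      · subst e21; simp [hs1]
      by_cases e20 : r = 20
      · subst e20; simp [h20]
      by_cases e15 : r = 15
      · subst e15; simp [h15]
      simp [hs1, e21, e20, e15]
    · have := (M1.update (d := 15) (l := []) (by simp)) 20
      omega

/-- Every rejected round returns to the store `s0`, so the potential there is bounded by the cost of
a round plus a mean that contains it again, and `le_of_rejection` solves this inequality. Space does
not accumulate over the rounds. -/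
theorem spreads_sample (hs : Clean s) (hM : Small M s) (hM1 : 1 ≤ M) (hc : 0 < c)
    (h14 : s 14 = c.bits) (h15 : s 15 = []) (h20 : s 20 = []) (h21 : s 21 = []) :
    Spreads R sampleProg s c (fun v => Function.update s 20 v.bits) (540 * M + 640) := by
  have hn : c.bits.length ≤ M := h14 ▸ hM 14
  have hlast : ∀ v < c, Store.space (Function.update s 20 v.bits) ≤ s.space + M := fun v hv =>
    s.space_update_le _ _ _ (((length_bits_mono hv.le).trans hn).trans (by omega))
  have r0 := Runs.push (R := R) (s := s) 21 true
  rw [h21] at r0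
  refine (r0.seq_spreads (B₂ := 539 * M + 630) ?_).mono (by omega)
  set s0 : Store := Function.update s 21 [true] with hs0
  have hsp0 : s.space ≤ s0.space := by
    have := Store.space_update_le s0 21 [] 0 (by simp)
    have e : Function.update s0 21 [] = s := by
      rw [hs0, Function.update_idem, ← h21, Function.update_eq_self]
    rwa [e] at this
  have r1 := Runs.copy (R := R) (x := 14) (ds := [23]) (by omega) (by simp) (by simp) (s := s0)
    (by simp [hs0, hs 22])
  have e1 : (fun r => if r ∈ [23] then s0 14 ++ s0 r else s0 r) = Function.update s0 23 c.bits := by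
    funext r
    by_cases hr : r = 23
    · subst hr; simp [hs0, h14, hs 23]
    · simp [hr]
  have e2 : s0 14 = c.bits := by simp [hs0, h14]
  rw [e1, e2] at r1
  set s1 : Store := Function.update s0 23 c.bits with hs1
  obtain ⟨t, ht, hsp1, hr1⟩ := r1.mono (B' := 16 * M + 3) (by
    simp only [List.length_cons, List.length_nil]; omega)
  obtain ⟨D, hD, hr2⟩ := Runs.exists_uniform (R := R) (p := decideProg)
    (List.finite_length_eq Bool c.bits.length)
    (g := fun l => Function.update (Function.update s 21 [true]) 20 l)
    (g' := fun l => if val l < c then Function.update s 20 (val l).bits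
      else Function.update s 21 [true]) (B := 245 * M + 260)
    (fun l hl => runs_decide hs hM hM1 h14 h15 h20 h21 (by
      rw [Set.mem_ofPred_eq] at hl; omega))
  -- At most two rounds are expected. A round consists of three control steps, the copying of the
  -- counter, the coin tosses and the decision; the final 1 is the exit from the loop.
  refine ⟨2 * (3 + t + (4 * c.bits.length + 1) + D) + 1, fun h => ?_, fun v hv => ?_,
    fun m δ J hJ hm K => ?_⟩
  · have := ht h
    have := hD h
    omega
  · exact (hlast v hv).trans (by omega)
  have hroom : s0.space + M + (245 * M + 260) ≤ m :=
    (by linarith : s0.space + M + (245 * M + 260) ≤ s0.space + (539 * M + 630)).trans hm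
  set L : Prog := .loop 21 (.seq (copy 14 [23]) (.seq tossProg decideProg)) with hL
  have j1 : J (L :: K) s0 ≤ δ + J (.seq (copy 14 [23]) (.seq tossProg decideProg) :: L :: K) s0 := by
    refine (hJ.step _ _ _ fun b => by simp [hL, Prog.exec, hs0]; rw [← hs0]; omega).trans ?_
    simp [hL, Prog.exec, half_add_half, hs0]
  have j2 : J (.seq (copy 14 [23]) (.seq tossProg decideProg) :: L :: K) s0 ≤
      δ + J (copy 14 [23] :: .seq tossProg decideProg :: L :: K) s0 := by
    refine (hJ.step _ _ _ fun b => by simp only [Prog.exec]; omega).trans ?_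
    simp [Prog.exec, half_add_half]
  have j3 := (hr1 (.seq tossProg decideProg :: L :: K)).potential hJ (by omega)
  have j4 : J (.seq tossProg decideProg :: L :: K) s1 ≤
      δ + J (tossProg :: decideProg :: L :: K) s1 := by
    refine (hJ.step _ _ _ fun b => by simp only [Prog.exec]; omega).trans ?_
    simp [Prog.exec, half_add_half]
  have jexit : ∀ v < c, J (L :: K) (Function.update s 20 v.bits) ≤
      δ + J K (Function.update s 20 v.bits) := by
    intro v hv
    have e : (Function.update s 20 v.bits) 21 = [] := by simp [h21]
    refine (hJ.step _ _ _ fun b => by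
      simp only [hL, Prog.exec, e]; have := hlast v hv; omega).trans ?_
    simp [hL, Prog.exec, half_add_half, h21]
  have j5 := tossProg_potential hJ (decideProg :: L :: K) c.bits.length s1
    (fun v => D * δ + if v < c then δ + J K (Function.update s 20 v.bits) else J (L :: K) s0)
    (by simp [hs1]) (by omega) (fun l hl => by
      have e : Function.update (Function.update s1 23 []) 20 (l ++ s1 20)
          = Function.update (Function.update s 21 [true]) 20 l := by
        funext r
        by_cases e20 : r = 20
        · subst e20; simp [hs1, hs0, h20]
        by_cases e23 : r = 23
        · subst e23; simp [hs 23]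
        simp [hs1, hs0, e20, e23]
      have hsp : Store.space (Function.update s0 20 l) ≤ s0.space + M :=
        Store.space_update_le s0 _ _ _ (by omega)
      rw [e]
      refine (hr2 l hl m δ J hJ ?_ (L :: K)).trans ?_
      · exact (Nat.add_le_add_right hsp (245 * M + 260)).trans hroom
      · refine add_le_add_right ?_ _
        by_cases hlt : val l < c
        · simp only [if_pos hlt]; exact jexit _ hlt
        · simp only [if_neg hlt]; exact le_rfl)
  rw [mean_add, mean_const (by positivity)] at j5
  have key := le_of_rejection (N := 2 ^ c.bits.length) (c := c)
    (a := (3 + t + (4 * c.bits.length + 1) + D : ℕ) * δ) hc (lt_two_pow_length_bits c).le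
    (two_pow_length_bits_le hc.ne') (hJ.ne_top (L :: K) s0) (Y := fun v => δ + J K (Function.update s 20 v.bits)) (by
      refine j1.trans ((add_le_add_right (j2.trans (add_le_add_right (j3.trans (add_le_add_right
        (j4.trans (add_le_add_right j5 _)) _)) _)) _).trans (le_of_eq ?_))
      push_cast
      ring)
  rw [mean_add, mean_const hc] at key
  refine key.trans (le_of_eq ?_)
  push_cast
  ring

end

/-! ## The improvisers -/

/-- Remove the results of an allocation. -/
def dropProg : Prog := .seq (clear 15) (.seq (clear 16) (.seq (clear 17) (clear 18)))

/-- Decide whether the number in register `20` is smaller than the mass of the current letter. If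
so, stop; otherwise subtract this mass and skip the letter. -/
def pickStep (P : Prog) : Prog :=
  .seq (allocProg P) (.seq (subProg 19 17 20) (.branch 19
    (.seq (subProg 20 20 17) (.seq dropProg (skipProg P)))
    (.seq dropProg (.seq (clear 19) (.pop 21)))
    (.seq dropProg (.seq (clear 19) (.pop 21)))))

/-- Skip letters until the sum of their masses exceeds the number in register `20`. -/
def pickProg (P : Prog) : Prog := .seq (.push 21 true) (.loop 21 (pickStep P))

/-- Choose the letter to be played if the history that was read is incomplete, it is our turn and
the mass of the history is not `0`. -/
def chooseProg (P : Prog) : Prog :=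
  .branch 12 .nop
    (.branch 11 (.branch 14 .nop (.seq sampleProg (pickProg P)) (.seq sampleProg (pickProg P)))
      .nop .nop)
    (.branch 11 (.branch 14 .nop (.seq sampleProg (pickProg P)) (.seq sampleProg (pickProg P)))
      .nop .nop)

/-- The part of the improvisers that does not depend on the instance. -/
def moveProg (I P : Prog) : Prog :=
  .seq (initProg I P) (.seq (readProg P) (.seq (chooseProg P) (.seq (.push 0 false) (pour 10 [0]))))

/-- A bound for the cost of `pickStep`. -/
def pickCost (P : Prog) (M : ℕ) : ℕ := allocCost P M + adoptCost P M + 270 * M + 270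

section

variable {A : Type*} {k : ℕ} {e : A ≃ Fin k} [Fintype A] {𝒮 : SpecClass A}
  {R : Resource} {C : Instance 𝒮 𝒮} {P : Prog} {Z : 𝒮.Spec} {M : ℕ}

theorem Data.runs_drop (d : Data) {H D U T N A C r s t v S F : List Bool} (hr : r.length ≤ M)
    (hs : s.length ≤ M) (ht : t.length ≤ M) (hv : v.length ≤ M) (l : List Bool) :
    Runs R dropProg (Function.update (d.allocated H D U T N A C r s t v S F) 19 l)
      (Function.update (d.store H D U T N A C S F) 19 l) (20 * M + 7) := by
  have h1 := Runs.clear (R := R) 15 (Function.update (d.allocated H D U T N A C r s t v S F) 19 l)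
  have h2 := Runs.clear (R := R) 16
    (Function.update (d.allocated H D U T N A C [] s t v S F) 19 l)
  have h3 := Runs.clear (R := R) 17
    (Function.update (d.allocated H D U T N A C [] [] t v S F) 19 l)
  have h4 := Runs.clear (R := R) 18
    (Function.update (d.allocated H D U T N A C [] [] [] v S F) 19 l)
  simp only [Data.allocated, update_inputStore, List.length_cons, List.length_nil,
    Nat.reduceAdd, Nat.reduceLT, List.set_cons_zero, List.set_cons_succ] at h1 h2 h3 h4
  have h := h1.seq (h2.seq (h3.seq h4))
  simp only [inputStore, List.getD_cons_succ, List.getD_cons_zero] at h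
  rw [dropProg, Data.allocated, update_inputStore (by simp)]
  refine h.cast ?_ ?_
  · simp only [Data.store_def, update_inputStore, List.length_cons, List.length_nil,
      Nat.reduceAdd, Nat.reduceLT, List.set_cons_zero, List.set_cons_succ]
  · omega

/-- Comparing the sample with the mass `x` of the current letter: if `x ≤ r` the sample lies beyond
this letter's interval and is shifted down by `x`; otherwise the letter is found and the flag is
removed. -/
theorem Setting.runs_pickStep (S : Setting e R C P Z M) {EN ED : List Bool} {h : List A}
    {j : ℕ} {m : ℕ × ℕ} (hEN : EN.length ≤ M) (hED : ED.length ≤ M) (hev : Even h.length)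
    (hl : h.length < C.n) (hj : j < k) (hm1 : m.1 ≤ C.ρ.den) (hm2 : m.2 ≤ C.ρ.den)
    (hM : 1 ≤ M) {r x : ℕ} (hr : r ≤ C.ρ.den)
    (hx : x = (takeStep (capOf e C.widthSoft h j) (capOf e C.widthHard h j) m).2) :
    Runs R (pickStep P) (C.reading e EN ED Z [] h j m r.bits [true])
      (if x ≤ r then C.reading e EN ED Z [] h (j + 1)
          (restStep (capOf e C.widthSoft h j) (capOf e C.widthHard h j) m) (r - x).bits [true]
        else C.reading e EN ED Z [] h j m r.bits []) (pickCost P M) := by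
  have hb : ∀ {a : ℕ}, a ≤ C.ρ.den → a.bits.length ≤ M :=
    fun h => (length_bits_mono h).trans S.rhoDen
  have hsm : ∀ m : ℕ × ℕ, m.1 ≤ C.ρ.den → m.2 ≤ C.ρ.den →
      Small M (C.reading e EN ED Z [] h j m r.bits [true]) := fun m h1 h2 =>
    S.small_reading hEN hED (by simp) hl.le hj.le h1 h2 (hb hr) (by simpa using hM) hM
  have h1 := S.runs_alloc_store hsm hl hj hm1 hm2 rfl rfl
  set rs := restStep (capOf e C.widthSoft h j) (capOf e C.widthHard h j) m with hrs
  set tk := takeStep (capOf e C.widthSoft h j) (capOf e C.widthHard h j) m with htk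
  subst hx
  have hle : rs.1 ≤ C.ρ.den ∧ rs.2 ≤ C.ρ.den ∧ tk.1 ≤ C.ρ.den ∧ tk.2 ≤ C.ρ.den := by
    simp only [hrs, htk, restStep, takeStep]; omega
  set d := C.data EN ED Z with hd
  set N := List.replicate (C.n - h.length) true with hN
  set D := (wordCode e h).reverse with hD
  set U := List.replicate j true with hU
  set s1 := d.allocated [] D U (turnBits h) N m.1.bits m.2.bits rs.1.bits tk.1.bits tk.2.bits
    rs.2.bits r.bits [true] with hs1
  have hM1 : Small M s1 := by
    rw [hs1, ← Data.allocated_eq]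
    intro i
    have := hsm m hm1 hm2 i
    simp only []
    split_ifs
    · exact hb hle.1
    · exact hb hle.2.2.1
    · exact hb hle.2.2.2
    · exact hb hle.2.1
    · simp
    · exact this
  have hc1 : Clean s1 := clean_inputStore (by simp)
  have h2 := Runs.subProg (R := R) (d := 19) (x := 17) (y := 20) (by omega) (by omega) (by omega)
    (fun r hr _ => hc1 r hr) hM1
  rw [show s1 17 = tk.2.bits from rfl, show s1 20 = r.bits from rfl, val_bits, val_bits] at h2
  by_cases hxr : tk.2 ≤ r
  · rw [if_pos hxr]
    have e19 : Function.update s1 19 (tk.2 - r).bits = s1 := by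
      rw [Nat.sub_eq_zero_of_le hxr]
      simp only [hs1, Data.allocated]
      rw [update_inputStore (by simp)]
      rfl
    rw [e19] at h2
    have h3 := Runs.subProg (R := R) (d := 20) (x := 20) (y := 17) (by omega) (by omega) (by omega)
      (fun r hr _ => hc1 r hr) hM1
    rw [show s1 17 = tk.2.bits from rfl, show s1 20 = r.bits from rfl, val_bits, val_bits] at h3
    have e20 : Function.update s1 20 (r - tk.2).bits = Function.update (d.allocated [] D U
        (turnBits h) N m.1.bits m.2.bits rs.1.bits tk.1.bits tk.2.bits rs.2.bits
        (r - tk.2).bits [true]) 19 [] := by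
      simp only [hs1, Data.allocated]
      rw [update_inputStore (by simp), update_inputStore (by simp)]
      rfl
    rw [e20] at h3
    have h4 := Data.runs_drop (R := R) (M := M) d (H := []) (D := D) (U := U) (T := turnBits h)
      (N := N) (A := m.1.bits) (C := m.2.bits) (S := (r - tk.2).bits) (F := [true]) (hb hle.1)
      (hb hle.2.2.1) (hb hle.2.2.2) (hb hle.2.1) []
    have e19' : Function.update (d.store [] D U (turnBits h) N m.1.bits m.2.bits (r - tk.2).bits
        [true]) 19 [] = C.reading e EN ED Z [] h j m (r - tk.2).bits [true] := by
      rw [Data.store_def, update_inputStore (by simp)]; rfl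
    rw [e19'] at h4
    have h5 := S.runs_skip (H := []) (F := [true]) hEN hED (by simp) hl hj hm1 hm2
      (hb ((Nat.sub_le r tk.2).trans hr)) (by simpa using hM) hM
    rw [if_pos hev] at h5
    refine (h1.seq (h2.seq (Runs.branch_nil rfl (h3.seq (h4.seq h5))))).mono ?_
    unfold pickCost
    omega
  · rw [if_neg hxr]
    have h3 := Data.runs_drop (R := R) (M := M) d (H := []) (D := D) (U := U) (T := turnBits h)
      (N := N) (A := m.1.bits) (C := m.2.bits) (S := r.bits) (F := [true]) (hb hle.1)
      (hb hle.2.2.1) (hb hle.2.2.2) (hb hle.2.1) (tk.2 - r).bits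
    have h4 := Runs.clear (R := R) 19 (Function.update (d.store [] D U (turnBits h) N m.1.bits
      m.2.bits r.bits [true]) 19 (tk.2 - r).bits)
    rw [Function.update_idem, Function.update_self] at h4
    have h5 := Runs.pop (R := R) (s := Function.update (d.store [] D U (turnBits h) N m.1.bits
      m.2.bits r.bits [true]) 19 []) 21
    refine (h1.seq (h2.seq (Runs.branch_cons ?_ (h3.seq (h4.seq h5))))).cast ?_ ?_
    · rw [Function.update_self, ne_eq, bits_eq_nil]; omega
    · rw [Data.store_def, update_inputStore (by simp), update_inputStore (by simp)]; rfl
    · have := hb ((Nat.sub_le tk.2 r).trans hle.2.2.2)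
      unfold pickCost
      omega

/-- After `j` skipped letters the sample has been reduced by the sum of their masses, so the loop
stops at the letter `i` whose interval of partial sums contains `v`. -/
theorem Setting.runs_pick (S : Setting e R C P Z M) {EN ED : List Bool} {h : List A}
    {m : ℕ × ℕ} (hEN : EN.length ≤ M) (hED : ED.length ≤ M) (hev : Even h.length)
    (hl : h.length < C.n) (hm1 : m.1 ≤ C.ρ.den) (hm2 : m.2 ≤ C.ρ.den)
    (hM : 1 ≤ M) {v i : ℕ} (hv : v ≤ C.ρ.den) (hi : i < k) {x : ℕ → ℕ}
    (hx : ∀ j, x j = (take (capOf e C.widthSoft h) (capOf e C.widthHard h) m j).2)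
    (h1 : ∑ j ∈ Finset.range i, x j ≤ v) (h2 : v < ∑ j ∈ Finset.range (i + 1), x j) :
    ∃ s', s' 0 = [] ∧ s' 10 = List.replicate i true ∧
      Runs R (pickProg P) (C.reading e EN ED Z [] h 0 m v.bits []) s'
        (k * (pickCost P M + 1) + 5) := by
  have key : ∀ d j, j + d = i → Runs R (.loop 21 (pickStep P))
      (C.reading e EN ED Z [] h j (rest (capOf e C.widthSoft h) (capOf e C.widthHard h) m j)
        (v - ∑ j ∈ Finset.range j, x j).bits [true])
      (C.reading e EN ED Z [] h i (rest (capOf e C.widthSoft h) (capOf e C.widthHard h) m i)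
        (v - ∑ j ∈ Finset.range i, x j).bits []) ((d + 1) * (pickCost P M + 1) + 1) := by
    intro d
    induction d with
    | zero =>
      rintro j rfl
      have hr := rest_le (capOf e C.widthSoft h) (capOf e C.widthHard h) m j
      have h3 := S.runs_pickStep (r := v - ∑ l ∈ Finset.range j, x l) (x := x j) hEN hED hev hl hi
        (hr.1.trans hm1) (hr.2.trans hm2) hM ((Nat.sub_le _ _).trans hv) (hx j)
      rw [Finset.sum_range_succ] at h2
      rw [if_neg (by simp at h1 h2 ⊢; omega)] at h3
      refine (Runs.loop_cons ?_ h3 (Runs.loop_nil rfl)).mono (by omega)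
      exact List.cons_ne_nil _ _
    | succ d ih =>
      intro j hj
      have hr := rest_le (capOf e C.widthSoft h) (capOf e C.widthHard h) m j
      have h3 := S.runs_pickStep (r := v - ∑ l ∈ Finset.range j, x l) (x := x j) hEN hED hev hl
        (show j < k by omega) (hr.1.trans hm1) (hr.2.trans hm2) hM ((Nat.sub_le _ _).trans hv) (hx j)
      have h4 : ∑ l ∈ Finset.range (j + 1), x l ≤ ∑ l ∈ Finset.range i, x l :=
        Finset.sum_le_sum_of_subset (Finset.range_mono (by omega))
      rw [Finset.sum_range_succ] at h4
      rw [if_pos (by omega), Nat.sub_sub, ← Finset.sum_range_succ] at h3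
      refine (Runs.loop_cons ?_ h3 (ih (j + 1) (by omega))).mono ?_
      · exact List.cons_ne_nil _ _
      · have := Nat.add_one_mul (d + 1) (pickCost P M + 1)
        omega
  have h3 := key i 0 (by omega)
  have h4 := Runs.push (R := R) (s := C.reading e EN ED Z [] h 0 m v.bits []) 21 true
  have e4 : Function.update (C.reading e EN ED Z [] h 0 m v.bits []) 21
      (true :: C.reading e EN ED Z [] h 0 m v.bits [] 21)
      = C.reading e EN ED Z [] h 0 m v.bits [true] := by
    rw [reading_def, Data.store_def, update_inputStore (by simp)]; rfl
  rw [e4] at h4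
  refine ⟨_, ?_, ?_, (h4.seq h3).mono ?_⟩
  · rfl
  · rfl
  · have := Nat.mul_le_mul_right (pickCost P M + 1) (show i + 1 ≤ k by omega)
    omega

end

/-! ### From samples to letter probabilities -/

theorem unaryCode_injective : Function.Injective unaryCode := fun i j h =>
  (unaryCode_append_inj (x := []) (y := []) (by simpa using h)).1

theorem exists_partial_sum {x : ℕ → ℕ} {k v : ℕ} (hv : v < ∑ j ∈ Finset.range k, x j) :
    ∃ i < k, ∑ j ∈ Finset.range i, x j ≤ v ∧ v < ∑ j ∈ Finset.range (i + 1), x j := by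
  induction k with
  | zero => simp at hv
  | succ k ih =>
    by_cases h : v < ∑ j ∈ Finset.range k, x j
    · obtain ⟨i, hi, h'⟩ := ih h
      exact ⟨i, by omega, h'⟩
    · exact ⟨k, by omega, by omega, hv⟩

/-- The samples that pick letter `i` form the interval between two consecutive partial sums, which
has length `x i`. Uniqueness of the letter follows from monotonicity of the partial sums. -/
theorem card_partial_sum {x : ℕ → ℕ} {k i : ℕ} (hi : i < k) {pick : ℕ → ℕ}
    (h : ∀ v < ∑ j ∈ Finset.range k, x j, ∑ j ∈ Finset.range (pick v), x j ≤ v ∧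
      v < ∑ j ∈ Finset.range (pick v + 1), x j) :
    ((Finset.range (∑ j ∈ Finset.range k, x j)).filter fun v => pick v = i).card = x i := by
  have hmono : Monotone fun n => ∑ j ∈ Finset.range n, x j := fun a b hab =>
    Finset.sum_le_sum_of_subset (Finset.range_mono hab)
  have : (Finset.range (∑ j ∈ Finset.range k, x j)).filter (fun v => pick v = i)
      = Finset.Ico (∑ j ∈ Finset.range i, x j) (∑ j ∈ Finset.range (i + 1), x j) := by
    ext v
    simp only [Finset.mem_filter, Finset.mem_range, Finset.mem_Ico]
    constructor
    · rintro ⟨hv, rfl⟩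
      exact h v hv
    · rintro ⟨h1, h2⟩
      have hv : v < ∑ j ∈ Finset.range k, x j := h2.trans_le (hmono hi)
      refine ⟨hv, ?_⟩
      obtain ⟨h3, h4⟩ := h v hv
      by_contra hne
      rcases Nat.lt_or_gt_of_ne hne with hlt | hlt
      · have : ∑ j ∈ Finset.range (pick v + 1), x j ≤ ∑ j ∈ Finset.range i, x j := hmono hlt
        omega
      · have : ∑ j ∈ Finset.range (i + 1), x j ≤ ∑ j ∈ Finset.range (pick v), x j := hmono hlt
        omega
  rw [this, Nat.card_Ico, Finset.sum_range_succ]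
  omega

/-- A bound for the cost of `chooseProg`. -/
def chooseCost (k : ℕ) (P : Prog) (M : ℕ) : ℕ := 540 * M + k * (pickCost P M + 1) + 655

/-- A bound for the cost of `moveProg`. -/
def moveCost (k : ℕ) (I P : Prog) (M : ℕ) : ℕ :=
  initCost I P M + M * (readCost P M + 1) + chooseCost k P M + 7 * M + 10

theorem Runs.output {R : Resource} {s : Store} {i M : ℕ} (h0 : s 0 = [])
    (h10 : s 10 = List.replicate i true) (hi : i ≤ M) :
    ∃ s', s' 0 = unaryCode i ∧ Runs R (.seq (.push 0 false) (RCI.pour 10 [0])) s s' (7 * M + 3) := by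
  refine ⟨_, ?_, ((Runs.push 0 false).seq (Runs.pour (R := R) (src := 10) (ds := [0]) (by simp)
    (by simp) (Function.update s 0 (false :: s 0)))).mono ?_⟩
  · simp [h0, h10, unaryCode]
  · simp only [ne_eq, show (10 : ℕ) ≠ 0 by omega, not_false_eq_true, Function.update_of_ne, h10,
      List.length_replicate, List.length_cons, List.length_nil]
    omega

section

variable {A : Type*} {k : ℕ} {e : A ≃ Fin k} [Fintype A] [Nonempty A] {𝒮 : SpecClass A}
  {R : Resource} {C : Instance 𝒮 𝒮} {P : Prog} {Z : 𝒮.Spec} {M : ℕ}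

/-- When a choice has to be made, there is one outcome for each of the `m.2` equally likely samples,
and each letter is output by as many samples as its second mass, in agreement with the quotient in
`moveProb`. -/
theorem Setting.spreads_choose (S : Setting e R C P Z M) (hC : C.Feasible) {EN ED : List Bool}
    (hEN : EN.length ≤ M) (hED : ED.length ≤ M) (hM : 1 ≤ M) {h : List A} (hh : h.length ≤ C.n) :
    ∃ c > 0, ∃ f : ℕ → Store, Spreads R
        (.seq (chooseProg P) (.seq (.push 0 false) (pour 10 [0])))
        (C.reading e EN ED Z [] h 0 (mass e C.widthSoft C.widthHard C.initial h) [] []) c f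
        (chooseCost k P M + 7 * M + 4) ∧
      ∀ u, mean c (fun v => if f v 0 = letterCode e u then 1 else 0) =
        ENNReal.ofReal (moveProb e C.widthSoft C.widthHard C.n C.initial h u) := by
  set m := mass e C.widthSoft C.widthHard C.initial h with hm
  set s := C.reading e EN ED Z [] h 0 m [] [] with hs
  obtain ⟨hm1, hm2⟩ := mass_le e C.widthSoft C.widthHard (a := C.ρ.den) (c := C.ρ.den)
    (s := C.initial) (by simp [Instance.initial]) (by simp [Instance.initial]) h
  rw [← hm] at hm1 hm2
  have s11 : s 11 = turnBits h := rfl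
  have s12 : s 12 = List.replicate (C.n - h.length) true := rfl
  have s14 : s 14 = m.2.bits := rfl
  by_cases hturn : Even h.length ∧ h.length < C.n ∧ m.2 ≠ 0
  · obtain ⟨hev, hl, h0⟩ := hturn
    have hM0 : Small M s := S.small_reading hEN hED (by simp) hh (by simp) hm1 hm2 (by simp)
      (by simp) hM
    have hc0 : Clean s := Data.clean _ _ _ _ _ _ _ _ _ _
    have hsample := spreads_sample (R := R) (s := s) (M := M) (c := m.2) hc0 hM0 hM
      (Nat.pos_of_ne_zero h0) s14 rfl rfl rfl
    set x : ℕ → ℕ := fun j => (take (capOf e C.widthSoft h) (capOf e C.widthHard h) m j).2 with hx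
    have hsum : ∑ j ∈ Finset.range k, x j = m.2 := by
      rw [Finset.sum_range, ← e.sum_comp]
      exact (C.widths.sum_take hl (C.widths.fits_mass (C.fits hC) h hh)).2
    have hpick : ∀ v, ∃ i, v < m.2 → i < k ∧ ∑ j ∈ Finset.range i, x j ≤ v ∧
        v < ∑ j ∈ Finset.range (i + 1), x j := by
      intro v
      by_cases hv : v < m.2
      · obtain ⟨i, h1, h2⟩ := exists_partial_sum (hsum ▸ hv)
        exact ⟨i, fun _ => ⟨h1, h2⟩⟩
      · exact ⟨0, fun h => absurd h hv⟩
    choose pick hpick using hpick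
    have hrun : ∀ v, ∃ s', v < m.2 → (s' 0 = [] ∧ s' 10 = List.replicate (pick v) true) ∧
        Runs R (pickProg P) (Function.update s 20 v.bits) s' (k * (pickCost P M + 1) + 5) := by
      intro v
      by_cases hv : v < m.2
      · obtain ⟨h1, h2, h3⟩ := hpick v hv
        obtain ⟨s1, h4, h5, h6⟩ := S.runs_pick hEN hED hev hl hm1 hm2 hM (hv.le.trans hm2) h1
          (x := x) (fun _ => rfl) h2 h3
        have e : Function.update s 20 v.bits = C.reading e EN ED Z [] h 0 m v.bits [] := by
          rw [hs, reading_def, Data.store_def, update_inputStore (by simp)]; rfl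
        exact ⟨s1, fun _ => ⟨⟨h4, h5⟩, e ▸ h6⟩⟩
      · exact ⟨s, fun h => absurd h hv⟩
    choose f₁ hf₁ using hrun
    have hout : ∀ v, ∃ s', v < m.2 → s' 0 = unaryCode (pick v) ∧
        Runs R (.seq (.push 0 false) (pour 10 [0])) (f₁ v) s' (7 * M + 3) := by
      intro v
      by_cases hv : v < m.2
      · obtain ⟨⟨h4, h5⟩, -⟩ := hf₁ v hv
        obtain ⟨s2, h7, h8⟩ := Runs.output (R := R) (M := M) h4 h5
          ((hpick v hv).1.le.trans S.letters)
        exact ⟨s2, fun _ => ⟨h7, h8⟩⟩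
      · exact ⟨s, fun h => absurd h hv⟩
    choose f hf using hout
    refine ⟨m.2, Nat.pos_of_ne_zero h0, f, ?_, fun u => ?_⟩
    · have h3 := hsample.seq_runs (Nat.pos_of_ne_zero h0) fun v hv => (hf₁ v hv).2
      have h4 : Spreads R (chooseProg P) s m.2 f₁ _ :=
        .branch_cons (by rw [s12]; simp; omega) (.branch_nil (by rw [s11]; simp [turnBits, hev])
          (.branch_cons (by rwa [s14, ne_eq, bits_eq_nil]) h3))
      refine (h4.seq_runs (Nat.pos_of_ne_zero h0) fun v hv => (hf v hv).2).mono ?_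
      unfold chooseCost
      omega
    · have h1 : mean m.2 (fun v => if f v 0 = letterCode e u then 1 else 0)
          = mean m.2 (fun v => if pick v = e u then 1 else 0) := by
        refine le_antisymm (mean_mono fun v hv => ?_) (mean_mono fun v hv => ?_) <;>
          simp [(hf v hv).1, letterCode, unaryCode_injective.eq_iff]
      have h2 := card_partial_sum (x := x) (k := k) (i := e u) (e u).2 (pick := pick)
        (fun v hv => (hpick v (hsum ▸ hv)).2)
      rw [hsum] at h2
      rw [h1, mean, Finset.sum_boole, h2, moveProb, if_pos ⟨hev, hl, h0⟩, mass_append, nextMass,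
        if_pos hev, ENNReal.ofReal_div_of_pos (by exact_mod_cast Nat.pos_of_ne_zero h0),
        ENNReal.ofReal_natCast, ENNReal.ofReal_natCast]
  -- Without a choice register `10` is empty, so letter number 0 is output, matching the default of
  -- `moveProb`.
  · obtain ⟨s2, h7, h8⟩ := Runs.output (R := R) (M := M) (s := s) (i := 0) rfl rfl (by omega)
    have hnop : Runs R (chooseProg P) s s 4 := by
      by_cases hl : h.length < C.n
      · refine Runs.branch_cons (B := 3) (by rw [s12]; simp; omega) ?_
        by_cases hev : Even h.length
        · refine (Runs.branch_nil (by rw [s11]; simp [turnBits, hev]) (Runs.branch_nil ?_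
            Runs.nop)).mono (by omega)
          rw [s14, bits_eq_nil]
          by_contra h0
          exact hturn ⟨hev, hl, h0⟩
        · exact (Runs.branch_true (l := []) (by rw [s11]; simp [turnBits, hev]) Runs.nop).mono
            (by omega)
      · refine (Runs.branch_nil ?_ Runs.nop).mono (by omega)
        rw [s12, Nat.sub_eq_zero_of_le (by omega)]; rfl
    refine ⟨1, one_pos, fun _ => s2, ?_, fun u => ?_⟩
    · exact ((hnop.seq h8).spreads one_pos).mono (by unfold chooseCost; omega)
    rw [moveProb, if_neg hturn, mean_const one_pos, h7, letterCode]
    simp only [unaryCode_injective.eq_iff, eq_comm (a := 0)]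
    split_ifs <;> simp

end

/-- A bound for the cost of an improviser. -/
def improviserCost (k : ℕ) (I P : Prog) (M : ℕ) : ℕ := moveCost k I P M + 10 * M

section

variable {A : Type*} {k : ℕ} {e : A ≃ Fin k} [Fintype A] [Nonempty A] {𝒮 : SpecClass A}
  {R : Resource} {C : Instance 𝒮 𝒮} {P : Prog} {Z : 𝒮.Spec} {M : ℕ}

/-- The improvisers do not load `ε`: it only matters for deciding feasibility, so registers `3` and
`4` stay empty. -/
theorem Setting.spreads_improviser (S : Setting e R C P Z M) {I : Prog} (hI : I.Deterministic)
    {B : ℕ} (hZ : I.Computes R [𝒮.code C.hard, 𝒮.code C.soft] (𝒮.code Z) B)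
    (hB : B + inputSize [𝒮.code C.hard, 𝒮.code C.soft] ≤ M) (hM : 1 ≤ M) (hC : C.Feasible)
    {h : List A} (hh : h.length ≤ C.n) :
    ∃ c > 0, ∃ f : ℕ → Store, Spreads R (C.improviser (moveProg I P)) (inputStore [wordCode e h])
        c f (improviserCost k I P M) ∧
      ∀ u, mean c (fun v => if f v 0 = letterCode e u then 1 else 0) =
        ENNReal.ofReal (moveProb e C.widthSoft C.widthHard C.n C.initial h u) := by
  obtain ⟨c, hc, f, h3, h4⟩ := S.spreads_choose hC (EN := []) (ED := []) (by simp) (by simp) hM hh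
  refine ⟨c, hc, f, ?_, h4⟩
  have h1 := S.runs_init hI hZ hB (H := wordCode e h) (EN := []) (ED := []) (S.word h hh) (by simp)
    (by simp)
  have h2 := S.runs_read (EN := []) (ED := []) (S₀ := []) (F := []) (m := C.initial) (by simp)
    (by simp) (by simp [Instance.initial]) (by simp [Instance.initial]) (by simp) (by simp) hM h []
    (by simpa using hh)
  have hw := Nat.mul_le_mul_right (readCost P M + 1) (S.word h hh)
  have h5 : Spreads R (moveProg I P) (C.loaded (wordCode e h) [] []) c f (moveCost k I P M) := by
    rw [List.nil_append, mass_nil] at h2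
    have h6 : Spreads R (.seq (readProg P) (.seq (chooseProg P) (.seq (.push 0 false)
        (pour 10 [0])))) _ c f _ := h2.seq_spreads h3
    refine (h1.seq_spreads h6).mono ?_
    unfold moveCost
    omega
  have e5 : Function.update (Function.update (Function.update (Function.update (Function.update
      (inputStore [wordCode e h]) 6 C.ρ.den.bits) 5 C.rhoNum.bits) 2 (List.replicate C.n true)) 1
      (𝒮.code C.soft)) 7 (𝒮.code C.hard) = C.loaded (wordCode e h) [] [] := by
    funext i
    rcases i with _|_|_|_|_|_|_|_|i <;> simp [inputStore, Instance.loaded]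
  rw [← e5] at h5
  refine (Spreads.loadProg 6 _ (Spreads.loadProg 5 _ (Spreads.loadProg 2 _ (Spreads.loadProg 1 _
    (Spreads.loadProg 7 _ (B := moveCost k I P M) ?_))))).mono ?_
  · simpa [inputStore] using h5
  · have := S.codeHard
    have := S.codeSoft
    have := S.length
    have := S.rhoNum
    have := S.rhoDen
    rw [List.length_replicate]
    unfold improviserCost
    omega

end

/-! ## Determinism -/

theorem deterministic_pushAll (b : Bool) (ds : List ℕ) : (pushAll b ds).Deterministic := by
  induction ds with
  | nil => trivial
  | cons d ds ih => exact ⟨trivial, ih⟩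

theorem deterministic_pour (x : ℕ) (ds : List ℕ) : (pour x ds).Deterministic :=
  ⟨trivial, ⟨trivial, deterministic_pushAll _ _⟩, trivial, deterministic_pushAll _ _⟩

theorem deterministic_clear (x : ℕ) : (clear x).Deterministic := deterministic_pour _ _

theorem deterministic_copy (x : ℕ) (ds : List ℕ) : (copy x ds).Deterministic :=
  ⟨deterministic_pour _ _, deterministic_pour _ _⟩

theorem deterministic_readBit (r : ℕ) {p : Bool → Prog} (h : ∀ b, (p b).Deterministic) :
    (readBit r p).Deterministic := ⟨h _, ⟨trivial, h _⟩, trivial, h _⟩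

theorem deterministic_normPour (x d : ℕ) : (normPour x d).Deterministic := by
  unfold normPour
  rw [Prog.Deterministic]
  refine deterministic_readBit _ fun b => ?_
  cases b <;> simp [Prog.Deterministic]

theorem deterministic_arith (f : Bool → Bool → Bool → Bool × Bool) (d x y : ℕ) :
    (arith f d x y).Deterministic :=
  ⟨deterministic_copy _ _, deterministic_copy _ _, trivial, trivial,
    ⟨trivial, deterministic_readBit _ fun _ => deterministic_readBit _ fun _ =>
      deterministic_readBit _ fun _ => ⟨trivial, trivial⟩⟩,
    ⟨trivial, trivial, deterministic_clear _⟩, trivial, deterministic_clear _,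
    deterministic_normPour _ _⟩

theorem deterministic_mulProg (d x y : ℕ) : (mulProg d x y).Deterministic := by
  refine ⟨deterministic_copy _ _, deterministic_pour _ _, ?_, deterministic_arith _ _ _ _,
    deterministic_clear _⟩
  rw [Prog.Deterministic]
  refine deterministic_readBit _ fun b => ?_
  cases b
  · exact ⟨⟨trivial, trivial, trivial⟩, trivial⟩
  · exact ⟨⟨trivial, trivial, trivial⟩, deterministic_arith _ _ _ _⟩

theorem deterministic_clearRange (n : ℕ) : ∀ a, (clearRange a n).Deterministic := by
  induction n with
  | zero => intro a; trivial
  | succ n ih => intro a; exact ⟨deterministic_clear _, ih _⟩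

theorem deterministic_callProg {P : Prog} (hP : P.Deterministic) : (callProg P).Deterministic :=
  ⟨hP.shift _, deterministic_clearRange _ _⟩

theorem deterministic_fetch (d : ℕ) : (fetch d).Deterministic :=
  ⟨deterministic_pour _ _, deterministic_clear _, deterministic_pour _ _⟩

theorem deterministic_capProg {P : Prog} (hP : P.Deterministic) {q : Prog} (hq : q.Deterministic)
    (r : ℕ) : (capProg P q r).Deterministic :=
  ⟨hq, deterministic_copy _ _, deterministic_copy _ _, deterministic_callProg hP,
    deterministic_fetch _, deterministic_mulProg _ _ _⟩

theorem deterministic_initProg {I P : Prog} (hI : I.Deterministic) (hP : P.Deterministic) :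
    (initProg I P).Deterministic :=
  ⟨deterministic_copy _ _, ⟨deterministic_copy _ _, deterministic_copy _ _,
    deterministic_callProg hI, deterministic_fetch _⟩, deterministic_capProg hP (q := .nop) trivial _,
    deterministic_arith _ _ _ _, deterministic_arith _ _ _ _, deterministic_arith _ _ _ _,
    deterministic_clear _, deterministic_clear _⟩

theorem deterministic_pushList (r : ℕ) (l : List Bool) : (pushList r l).Deterministic := by
  induction l with
  | nil => trivial
  | cons b l ih => exact ⟨ih, trivial⟩

theorem deterministic_emitProg (r : ℕ) : (emitProg r).Deterministic :=
  deterministic_readBit _ fun _ => deterministic_pushList _ _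

theorem deterministic_schemeProg {I P : Prog} (hI : I.Deterministic) (hP : P.Deterministic)
    (F : Prog) : (schemeProg I P F).Deterministic :=
  ⟨deterministic_pour _ _, deterministic_pour _ _, deterministic_initProg hI hP,
    deterministic_capProg hP (q := .nop) trivial _, deterministic_arith _ _ _ _, deterministic_arith _ _ _ _,
    deterministic_mulProg _ _ _, deterministic_mulProg _ _ _, deterministic_arith _ _ _ _,
    ⟨⟨deterministic_pushList _ _, deterministic_emitProg _, deterministic_emitProg _,
      deterministic_emitProg _, deterministic_emitProg _, deterministic_emitProg _, trivial⟩,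
      trivial, trivial⟩, trivial, trivial⟩

/-! ## Polynomial bounds -/

theorem eval_mono (p : Polynomial ℕ) {a b : ℕ} (h : a ≤ b) : p.eval a ≤ p.eval b := by
  rw [Polynomial.eval_eq_sum_range, Polynomial.eval_eq_sum_range]
  gcongr

/-- `f` is bounded by a polynomial. -/
def PolyBounded (f : ℕ → ℕ) : Prop := ∃ p : Polynomial ℕ, ∀ n, f n ≤ p.eval n

theorem PolyBounded.const (a : ℕ) : PolyBounded fun _ => a := ⟨.C a, by simp⟩

theorem PolyBounded.id : PolyBounded fun n => n := ⟨.X, by simp⟩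

theorem PolyBounded.add {f g : ℕ → ℕ} (hf : PolyBounded f) (hg : PolyBounded g) :
    PolyBounded fun n => f n + g n := by
  obtain ⟨p, hp⟩ := hf
  obtain ⟨q, hq⟩ := hg
  exact ⟨p + q, fun n => by simpa using add_le_add (hp n) (hq n)⟩

theorem PolyBounded.mul {f g : ℕ → ℕ} (hf : PolyBounded f) (hg : PolyBounded g) :
    PolyBounded fun n => f n * g n := by
  obtain ⟨p, hp⟩ := hf
  obtain ⟨q, hq⟩ := hg
  exact ⟨p * q, fun n => by simpa using Nat.mul_le_mul (hp n) (hq n)⟩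

theorem polyBounded_callCost (P : Prog) : PolyBounded (callCost P) :=
  (PolyBounded.id.add ((PolyBounded.const _).mul (((PolyBounded.const _).mul .id).add
    (.const _)))).add (.const _)

theorem polyBounded_capCost (P : Prog) : PolyBounded (capCost P) := by
  unfold capCost
  exact (((polyBounded_callCost P).add (((PolyBounded.const _).mul .id).mul .id)).add
    ((PolyBounded.const _).mul .id)).add (.const _)

theorem polyBounded_initCost (I P : Prog) : PolyBounded (initCost I P) := by
  unfold initCost
  exact (((polyBounded_callCost I).add (polyBounded_capCost P)).add
    ((PolyBounded.const _).mul .id)).add (.const _)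

theorem polyBounded_schemeCost (I P : Prog) (L : ℕ) : PolyBounded (schemeCost I P L) := by
  unfold schemeCost outputCost
  exact (((((polyBounded_initCost I P).add (polyBounded_capCost P)).add
    (((PolyBounded.const _).add ((PolyBounded.const _).mul .id)).add (.const _))).add
    (((PolyBounded.const _).mul .id).mul .id)).add ((PolyBounded.const _).mul .id)).add (.const _)

theorem polyBounded_adoptCost (P : Prog) : PolyBounded (adoptCost P) := by
  unfold adoptCost allocCost
  exact (((((PolyBounded.const _).mul (polyBounded_capCost P)).add
    ((PolyBounded.const _).mul .id)).add (.const _)).add ((PolyBounded.const _).mul .id)).add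
    (.const _)

theorem polyBounded_pickCost (P : Prog) : PolyBounded (pickCost P) := by
  unfold pickCost allocCost
  exact ((((((PolyBounded.const _).mul (polyBounded_capCost P)).add
    ((PolyBounded.const _).mul .id)).add (.const _)).add (polyBounded_adoptCost P)).add
    ((PolyBounded.const _).mul .id)).add (.const _)

theorem polyBounded_improviserCost (k : ℕ) (I P : Prog) : PolyBounded (improviserCost k I P) := by
  unfold improviserCost moveCost readCost chooseCost
  exact (((((polyBounded_initCost I P).add (PolyBounded.id.mul
    ((((polyBounded_adoptCost P).add ((PolyBounded.const _).mul .id)).add (.const _)).add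
    (.const _)))).add ((((PolyBounded.const _).mul .id).add ((PolyBounded.const _).mul
    ((polyBounded_pickCost P).add (.const _)))).add (.const _))).add
    ((PolyBounded.const _).mul .id)).add (.const _)).add ((PolyBounded.const _).mul .id)

/-- The cost of a subroutine also bounds the length of its output. Hence the code of the
intersection is polynomially long, and so are the inputs and outputs of all width queries. -/
theorem exists_setting {A : Type*} [Fintype A] {k : ℕ} (e : A ≃ Fin k) {R : Resource}
    {𝒮 : SpecClass A} {I P : Prog} {p q : Polynomial ℕ} (hI : I.Deterministic)
    (hP : P.Deterministic)
    (hinter : ∀ X Y : 𝒮.Spec, ∃ Z : 𝒮.Spec, 𝒮.lang Z = 𝒮.lang X ∩ 𝒮.lang Y ∧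
      I.Computes R [𝒮.code X, 𝒮.code Y] (𝒮.code Z) (p.eval (inputSize [𝒮.code X, 𝒮.code Y])))
    (hwidth : ∀ (X : 𝒮.Spec) (n : ℕ) (h : List A), h.length ≤ n →
      P.Computes R [𝒮.code X, List.replicate n true, wordCode e h]
        (width n (slice (𝒮.lang X) n) h).bits
        (q.eval (inputSize [𝒮.code X, List.replicate n true, wordCode e h]))) :
    ∃ r : Polynomial ℕ, ∀ C : Instance 𝒮 𝒮, ∃ (Z : 𝒮.Spec) (B : ℕ),
      Setting e R C P Z (r.eval C.size) ∧
      I.Computes R [𝒮.code C.hard, 𝒮.code C.soft] (𝒮.code Z) B ∧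
      B + inputSize [𝒮.code C.hard, 𝒮.code C.soft] ≤ r.eval C.size ∧
      C.ε.den.bits.length + C.ρ.den.bits.length ≤ r.eval C.size ∧ 1 ≤ r.eval C.size := by
  -- A bound for the input size of a width query: `p + X` for the specification, `X` for the unary
  -- length and `k * X` for the code of the history.
  set V : Polynomial ℕ := p + .C (k + 2) * .X with hV
  -- The first two summands bound a width query together with its input, `2 * X` leaves room for a
  -- factor from the instance and for the product of denominators, and the constant covers the
  -- number of letters and the condition `1 ≤ M`.
  refine ⟨q.comp V + V + 2 * .X + .C (k + 1), fun C => ?_⟩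
  obtain ⟨Z, hZ, hcomp⟩ := hinter C.hard C.soft
  set N := C.size with hN
  set v := V.eval N with hv
  have hsize : (𝒮.code C.hard).length + (𝒮.code C.soft).length + C.n + C.epsNum.bits.length +
      C.ε.den.bits.length + C.rhoNum.bits.length + C.ρ.den.bits.length = N := by
    rw [hN, Instance.size, inputs_eq]
    simp [inputSize]
    omega
  have hM : (q.comp V + V + 2 * .X + .C (k + 1)).eval N = q.eval v + v + 2 * N + (k + 1) := by
    simp [Polynomial.eval_comp, hv]
  have hv' : v = p.eval N + (k * N + 2 * N) := by simp [hv, hV]; ring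
  have hword : ∀ h : List A, h.length ≤ C.n → (wordCode e h).length ≤ k * N := fun h hl =>
    (length_wordCode_le e h).trans (Nat.mul_le_mul_left k (by omega))
  rw [hM]
  have hI2 : inputSize [𝒮.code C.hard, 𝒮.code C.soft] ≤ N := by
    simp [inputSize]; omega
  have hp := eval_mono p hI2
  have hZl := length_output_le hI (by simp) hcomp
  have hin : ∀ (X : 𝒮.Spec), (𝒮.code X).length ≤ p.eval N + N → ∀ h : List A, h.length ≤ C.n →
      inputSize [𝒮.code X, List.replicate C.n true, wordCode e h] ≤ v := by
    intro X hX h hl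
    have := hword h hl
    simp only [inputSize, List.map_cons, List.map_nil, List.sum_cons, List.sum_nil,
      List.length_replicate]
    omega
  have hcost : ∀ (X : 𝒮.Spec), (𝒮.code X).length ≤ p.eval N + N → ∀ h : List A,
      h.length ≤ C.n → ∃ B, P.Computes R [𝒮.code X, List.replicate C.n true, wordCode e h]
        (width C.n (slice (𝒮.lang X) C.n) h).bits B ∧
        B + inputSize [𝒮.code X, List.replicate C.n true, wordCode e h] ≤ q.eval v + v := by
    intro X hX h hl
    have h1 := hin X hX h hl
    exact ⟨_, hwidth X C.n h hl, add_le_add (eval_mono q h1) h1⟩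
  have hH : (𝒮.code C.hard).length ≤ p.eval N + N := by omega
  have hS : (𝒮.code Z).length ≤ p.eval N + N := by omega
  have hbits : ∀ (X : 𝒮.Spec), (𝒮.code X).length ≤ p.eval N + N → ∀ h : List A,
      h.length ≤ C.n → (C.rhoNum * width C.n (slice (𝒮.lang X) C.n) h).bits.length ≤
        q.eval v + v + 2 * N + (k + 1) := by
    intro X hX h hl
    obtain ⟨B, h1, h2⟩ := hcost X hX h hl
    have h3 := length_output_le hP (by simp) h1
    have h4 := length_bits_mul_le C.rhoNum (width C.n (slice (𝒮.lang X) C.n) h)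
    omega
  refine ⟨Z, _, ?_, hcomp, by omega, by omega, by omega⟩
  exact {
    det := hP
    hard := fun h hl => by
      obtain ⟨B, h1, h2⟩ := hcost _ hH h hl
      exact ⟨B, h1, by omega⟩
    soft := fun h hl => by
      obtain ⟨B, h1, h2⟩ := hcost _ hS h hl
      rw [hZ] at h1
      exact ⟨B, h1, by omega⟩
    widthHard := fun h hl => hbits _ hH h hl
    widthSoft := fun h hl => by
      have := hbits _ hS h hl
      rwa [hZ] at this
    codeHard := by omega
    codeSoft := by omega
    codeInter := by omega
    length := by omega
    word := fun h hl => (hword h hl).trans (by omega)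
    letters := by omega
    rhoNum := by omega
    rhoDen := by omega
    epsNum := by omega
    epsDen := by omega }

end RCI

theorem theorem2 {A : Type*} [Fintype A] [Nonempty A] {k : ℕ} (e : A ≃ Fin k)
    (R : RCI.Resource) (𝒮 : RCI.SpecClass A)
    (hinter : RCI.SupportsIntersection R 𝒮) (hwidth : RCI.SupportsWidth e R 𝒮) :
    RCI.HasImprovisationScheme e R 𝒮 𝒮 := by
  obtain ⟨I, p, hI, hinter⟩ := hinter
  obtain ⟨P, q, hP, hwidth⟩ := hwidth
  obtain ⟨r, hr⟩ := RCI.exists_setting e hI hP hinter hwidth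
  set F := RCI.moveProg I P
  -- The common program `F` does not depend on the instance, so the length of its code is a
  -- constant.
  obtain ⟨a, ha⟩ := RCI.polyBounded_schemeCost I P F.encode.length
  obtain ⟨b, hb⟩ := RCI.polyBounded_improviserCost k I P
  refine ⟨RCI.schemeProg I P F, fun C => C.result F, .X + a.comp r, r + b.comp r,
    RCI.deterministic_schemeProg hI hP F, fun C => ?_, fun C hC => ?_, fun C hC => ?_,
    fun C G hG h hl => ?_⟩
  · obtain ⟨Z, B, S, h1, h2, h3, h4⟩ := hr C
    obtain ⟨s', hs', h5⟩ := S.runs_scheme hI h1 h2 h3 h4 F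
    rw [← hs', Polynomial.eval_add, Polynomial.eval_X,
      show C.size = (RCI.inputStore C.inputs).space from (RCI.space_inputStore _).symm]
    rw [show C.size = (RCI.inputStore C.inputs).space from (RCI.space_inputStore _).symm] at h5
    exact (h5.mono ((ha _).trans (le_of_eq Polynomial.eval_comp.symm))).computes
  · rw [RCI.Instance.realizable_iff] at hC
    obtain ⟨Z, B, S, h1, h2, h3, h4⟩ := hr C
    refine ⟨C.improviser F, if_pos hC, _, C.improvising_strategy hC e, fun h hl => ?_⟩
    obtain ⟨c, hc, f, h5, h6⟩ := S.spreads_improviser hI h1 h2 h4 hC hl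
    exact ⟨h5.expectedCost_time_lt_top hc, fun u => (h5.outputProb_eq hc _).trans (h6 u)⟩
  · rw [RCI.Instance.realizable_iff] at hC
    exact if_neg hC
  · obtain ⟨Z, B, S, h1, h2, h3, h4⟩ := hr C
    by_cases hC : C.Feasible
    · obtain rfl : C.improviser F = G := by simpa [RCI.Instance.result, hC] using hG
      obtain ⟨c, hc, f, h5, h6⟩ := S.spreads_improviser hI h1 h2 h4 hC hl
      refine (h5.expectedCost_le hc).trans (Nat.cast_le.2 ?_)
      have := hb (r.eval C.size)
      have := S.word h hl
      simp [RCI.inputSize, Polynomial.eval_comp]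
      omega
    · simp [RCI.Instance.result, hC] at hG
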